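/- Let $X$ be a compact metrizable abelian Lie group with normalized Haar measure $\mu$, and let $(y_t)_{t\in\mathbb R}$ be a continuous one-parameter subgroup of $X$ such that the translation by $y_1$ is ergodic. Write $F_t(x)=y_t x$ and $V_t\psi=\psi\circ F_t$ on $L^2(X,\mu)$. Let $P=-i\mathscr L_Y$ be the self-adjoint generator of $(V_t)$, so that $\psi\in\mathrm{Dom}(P)$ if and only if $(\psi\circ F_t-\psi)/t$ converges in $L^2(X,\mu)$ as $t\to0$, and the limit is then $\mathscr L_Y\psi$. Let $G$ be a compact metrizable abelian group with normalized Haar measure $\nu$ and character group $\hat G$. Let $\varphi:X\to G$ be a measurable map of the form $\varphi=\xi\eta$, where $\xi:X\to G$ is a continuous group homomorphism and where, for every $\chi\in\hat G$ with $\chi\circ\xi\not\equiv1$, the map $\eta$ satisfies the following: (a) $\mathscr L_Y(\chi\circ\eta)$ exists and $$\sup_{t>0}\left\|\frac{\mathscr L_Y(\chi\circ\eta)\circ F_t-\mathscr L_Y(\chi\circ\eta)}{t}\right\|_{L^\infty(X)}<\infty;$$ (b) $\chi\circ\eta=e^{i\tilde\eta_\chi}$ almost everywhere for some real-valued $\tilde\eta_\chi\in\mathrm{Dom}(P)$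 such that $P\tilde\eta_\chi$ is (a.e. equal to) a continuous function. (When $\eta$ is continuous, the continuity of $P\tilde\eta_\chi$ follows from the other conditions.) Consider the skew product $T(x,z)=(y_1x,\varphi(x)z)$ on $X\times G$, the unitary operator $W\Psi=\Psi\circ T$ on $L^2(X\times G,\mu\otimes\nu)$, the $W$-invariant closed subspaces $L_\chi=\{\psi\otimes\chi:\psi\in L^2(X,\mu)\}$, and the unitary operators $U_\chi\psi=(\chi\circ\varphi)\,V_1\psi$ on $L^2(X,\mu)$, so that $U_\chi$ is unitarily equivalent to $W|_{L_\chi}$. Then for every $\chi\in\hat G$ with $\chi\circ\xi\not\equiv1$ the operator $U_\chi$ on $L^2(X,\mu)$, and equally $W|_{L_\chi}$, has Lebesgue spectrum: its maximal spectral type is the class of Lebesgue measure on the circle. That is, all its spectral measures are absolutely continuous, and one of them is equivalent to Lebesgue measure. Moreover, if there is at least one such $\chi$, then $W$ restricted to the closed subspace $\bigoplus_{\chi\in\hat G,\ \chi\circ\xi\not\equiv1}L_\chi$ has countable Lebesgue spectrum: this subspace has an orthonormal basis $(b_{j,k})_{j\in\mathbb N,\,k\in\mathbb Z}$ with $Wb_{j,k}=b_{j,k+1}$.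 -/

import Mathlib

open MeasureTheory Filter Topology
open scoped ENNReal Manifold ContDiff

/-! ### Spectral types of unitary operators -/

section Spectral

variable {H : Type*} [NormedAddCommGroup H] [InnerProductSpace ℂ H]

/-- `σ` is the spectral measure of the vector `f` for the unitary operator `U`: the finite Borel
measure on the circle `ℝ / ℤ` with `∫ e^{2π i n θ} dσ(θ) = ⟨U ^ n f, f⟩` for every integer `n`
(Mathlib's inner product is linear in its second argument). -/
def IsSpectralMeasure (U : H ≃ₗᵢ[ℂ] H) (f : H) (σ : Measure UnitAddCircle) : Prop :=
  IsFiniteMeasure σ ∧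
    ∀ n : ℤ, ∫ θ, (fourier n θ : ℂ) ∂σ = inner ℂ f ((U ^ n) f)

/-- The unitary operator `U` has Lebesgue spectrum on the subspace `S`: `S` is invariant under `U`
and `U⁻¹`, and the maximal spectral type of `U` on `S` is the Lebesgue class, that is, the spectral
measure of every `f ∈ S` is absolutely continuous with respect to Lebesgue measure on the circle,
and some `f ∈ S` has a spectral measure equivalent to Lebesgue measure. -/
def HasLebesgueSpectrumOn (U : H ≃ₗᵢ[ℂ] H) (S : Submodule ℂ H) : Prop :=
  (∀ f, U f ∈ S ↔ f ∈ S) ∧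
  (∀ f ∈ S, ∃ σ : Measure UnitAddCircle,
    IsSpectralMeasure U f σ ∧ σ ≪ AddCircle.haarAddCircle) ∧
  ∃ f ∈ S, ∃ σ : Measure UnitAddCircle,
    IsSpectralMeasure U f σ ∧ σ ≪ AddCircle.haarAddCircle ∧ AddCircle.haarAddCircle ≪ σ

/-- The unitary operator `U` has countable Lebesgue spectrum on the closed subspace `S`: there is
an orthonormal basis `(b (j, k))` of `S`, with `j ∈ ℕ` and `k ∈ ℤ`, such that
`U (b (j, k)) = b (j, k + 1)`. In other words, `U` restricted to `S` is unitarily equivalent to the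
orthogonal sum of countably infinitely many copies of the multiplication by `e^{2π i θ}` on
`L²(ℝ / ℤ)`. -/
def HasCountableLebesgueSpectrumOn (U : H ≃ₗᵢ[ℂ] H) (S : Submodule ℂ H) : Prop :=
  ∃ b : ℕ × ℤ → H, Orthonormal ℂ b ∧
    (Submodule.span ℂ (Set.range b)).topologicalClosure = S ∧
    ∀ (j : ℕ) (k : ℤ), U (b (j, k)) = b (j, k + 1)

end Spectral

/-! ### Weighted composition operators -/

section Koopman

variable {α : Type*} [MeasurableSpace α] {m : Measure α}

theorem memLp_weighted {T : α → α} (hT : MeasurePreserving T m m) {w : α → ℂ}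
    (hw : Measurable w) (hw1 : ∀ x, ‖w x‖ = 1) (f : Lp ℂ 2 m) :
    MemLp (fun x => w x * f (T x)) 2 m := by
  have h : MemLp (fun x => f (T x)) 2 m := (Lp.memLp f).comp_measurePreserving hT
  refine h.of_le (hw.aestronglyMeasurable.mul h.1) (ae_of_all _ fun x => ?_)
  rw [norm_mul, hw1, one_mul]

/-- The linear isometry `f ↦ w · (f ∘ T)` of `L²(m)`, for `T` measure preserving and `|w| = 1`. -/
noncomputable def weightedCompₗᵢ (T : α → α) (hT : MeasurePreserving T m m) (w : α → ℂ)
    (hw : Measurable w) (hw1 : ∀ x, ‖w x‖ = 1) : Lp ℂ 2 m →ₗᵢ[ℂ] Lp ℂ 2 m where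
  toFun f := (memLp_weighted hT hw hw1 f).toLp _
  map_add' f g := by
    apply Lp.ext
    filter_upwards [(memLp_weighted hT hw hw1 (f + g)).coeFn_toLp,
      (memLp_weighted hT hw hw1 f).coeFn_toLp, (memLp_weighted hT hw hw1 g).coeFn_toLp,
      Lp.coeFn_add ((memLp_weighted hT hw hw1 f).toLp _) ((memLp_weighted hT hw hw1 g).toLp _),
      hT.quasiMeasurePreserving.ae (Lp.coeFn_add f g)] with x h1 h2 h3 h4 h5
    rw [h1, h4, Pi.add_apply, h2, h3, h5, Pi.add_apply, mul_add]
  map_smul' c f := by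
    apply Lp.ext
    filter_upwards [(memLp_weighted hT hw hw1 (c • f)).coeFn_toLp,
      (memLp_weighted hT hw hw1 f).coeFn_toLp,
      Lp.coeFn_smul c ((memLp_weighted hT hw hw1 f).toLp _),
      hT.quasiMeasurePreserving.ae (Lp.coeFn_smul c f)] with x h1 h2 h3 h4
    rw [RingHom.id_apply, h1, h3, Pi.smul_apply, h2, h4, Pi.smul_apply, smul_eq_mul, smul_eq_mul]
    ring
  norm_map' f := by
    change ‖(memLp_weighted hT hw hw1 f).toLp _‖ = ‖f‖
    rw [Lp.norm_toLp, Lp.norm_def, ← eLpNorm_comp_measurePreserving (Lp.aestronglyMeasurable f) hT]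
    congr 1
    refine eLpNorm_congr_norm_ae (ae_of_all _ fun x => ?_)
    rw [norm_mul, hw1, one_mul, Function.comp_apply]

theorem weightedCompₗᵢ_coeFn (T : α → α) (hT : MeasurePreserving T m m) (w : α → ℂ)
    (hw : Measurable w) (hw1 : ∀ x, ‖w x‖ = 1) (f : Lp ℂ 2 m) :
    weightedCompₗᵢ T hT w hw hw1 f =ᵐ[m] fun x => w x * f (T x) :=
  (memLp_weighted hT hw hw1 f).coeFn_toLp

theorem weightedCompₗᵢ_surjective (T : α ≃ᵐ α) (hT : MeasurePreserving T m m) (w : α → ℂ)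
    (hw : Measurable w) (hw1 : ∀ x, ‖w x‖ = 1) :
    Function.Surjective (weightedCompₗᵢ T hT w hw hw1) := by
  intro g
  have hS : MeasurePreserving T.symm m m := hT.symm T
  have hv : Measurable fun x => (w (T.symm x))⁻¹ := (hw.comp T.symm.measurable).inv
  have hv1 : ∀ x, ‖(w (T.symm x))⁻¹‖ = 1 := fun x => by rw [norm_inv, hw1, inv_one]
  refine ⟨weightedCompₗᵢ T.symm hS _ hv hv1 g, ?_⟩
  apply Lp.ext
  filter_upwards [weightedCompₗᵢ_coeFn T hT w hw hw1 (weightedCompₗᵢ T.symm hS _ hv hv1 g),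
    hT.quasiMeasurePreserving.ae (weightedCompₗᵢ_coeFn T.symm hS _ hv hv1 g)] with x h1 h2
  have hne : w x ≠ 0 := fun h => by simpa [h] using hw1 x
  rw [h1, h2, T.symm_apply_apply, mul_inv_cancel_left₀ hne]

/-- The unitary operator `f ↦ w · (f ∘ T)` of `L²(m)`, for an invertible measure preserving
transformation `T` and a measurable function `w` of modulus one. -/
noncomputable def weightedKoopman (T : α ≃ᵐ α) (hT : MeasurePreserving T m m) (w : α → ℂ)
    (hw : Measurable w) (hw1 : ∀ x, ‖w x‖ = 1) : Lp ℂ 2 m ≃ₗᵢ[ℂ] Lp ℂ 2 m :=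
  LinearIsometryEquiv.ofSurjective (weightedCompₗᵢ T hT w hw hw1)
    (weightedCompₗᵢ_surjective T hT w hw hw1)

theorem weightedKoopman_coeFn (T : α ≃ᵐ α) (hT : MeasurePreserving T m m) (w : α → ℂ)
    (hw : Measurable w) (hw1 : ∀ x, ‖w x‖ = 1) (f : Lp ℂ 2 m) :
    weightedKoopman T hT w hw hw1 f =ᵐ[m] fun x => w x * f (T x) :=
  weightedCompₗᵢ_coeFn T hT w hw hw1 f

end Koopman

/-! ### Skew products over translations -/

section Skew

variable {X : Type*} [CommGroup X] [MeasurableSpace X] [MeasurableMul X]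

/-- `g` lies in the domain of the generator of the group `V_t ψ = ψ ∘ F_t` of unitary operators of
`L²(X, μ)`, where `F_t x = y_t x`, and `g'` is its Lie derivative along the flow:
`(g ∘ F_t - g) / t → g'` in `L²(X, μ)` as `t → 0`. Thus `Dom(P)`, for the self-adjoint operator
`P = -i 𝓛_Y`, consists of the `g` for which such a `g'` exists, and `P g = -i g'`. -/
def HasLieDeriv (μ : Measure X) (y : ℝ → X) (g g' : X → ℂ) : Prop :=
  MemLp g 2 μ ∧ MemLp g' 2 μ ∧
    Tendsto (fun t : ℝ => eLpNorm (fun x => (g (y t * x) - g x) / (t : ℂ) - g' x) 2 μ)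
      (𝓝[≠] 0) (𝓝 0)

/-- The regularity condition on `u = χ ∘ η`. First, the Lie derivative `𝓛_Y u` exists and
`sup_{t > 0} ‖(𝓛_Y u ∘ F_t - 𝓛_Y u) / t‖_∞ < ∞`. Second, `u = exp (i h)` for a real-valued function
`h` in the domain of `P` whose Lie derivative is a continuous function. -/
def IsFlowRegular [TopologicalSpace X] (μ : Measure X) (y : ℝ → X) (u : X → ℂ) : Prop :=
  (∃ u' : X → ℂ, HasLieDeriv μ y u u' ∧
    (⨆ (t : ℝ) (_ : 0 < t), eLpNorm (fun x => (u' (y t * x) - u' x) / (t : ℂ)) ⊤ μ) < ⊤) ∧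
  ∃ (h : X → ℝ) (h' : X → ℂ), HasLieDeriv μ y (fun x => (h x : ℂ)) h' ∧ Continuous h' ∧
    ∀ᵐ x ∂μ, u x = Complex.exp (Complex.I * (h x : ℂ))

variable {G : Type*} [CommGroup G] [MeasurableSpace G]

/-- The skew product `T (x, z) = (a x, φ(x) z)` on `X × G`. -/
def skewProduct [MeasurableMul₂ G] [MeasurableInv G] (a : X) (φ : X → G) (hφ : Measurable φ) :
    X × G ≃ᵐ X × G where
  toFun p := (a * p.1, φ p.1 * p.2)
  invFun p := (a⁻¹ * p.1, (φ (a⁻¹ * p.1))⁻¹ * p.2)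
  left_inv p := by simp
  right_inv p := by simp
  measurable_toFun := (measurable_fst.const_mul a).prodMk
    ((hφ.comp measurable_fst).mul measurable_snd)
  measurable_invFun := (measurable_fst.const_mul a⁻¹).prodMk
    ((hφ.comp (measurable_fst.const_mul a⁻¹)).inv.mul measurable_snd)

theorem measurePreserving_skewProduct [MeasurableMul₂ G] [MeasurableInv G] (μ : Measure X)
    [μ.IsMulLeftInvariant] [SFinite μ] (ν : Measure G) [ν.IsMulLeftInvariant] [SFinite ν]
    (a : X) (φ : X → G) (hφ : Measurable φ) :
    MeasurePreserving (skewProduct a φ hφ) (μ.prod ν) (μ.prod ν) :=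
  (measurePreserving_mul_left μ a).skew_product (g := fun x z => φ x * z)
    ((hφ.comp measurable_fst).mul measurable_snd)
    (ae_of_all _ fun x => map_mul_left_eq_self ν (φ x))

/-- The unitary operator `W Ψ = Ψ ∘ T` of `L²(X × G)`, for the skew product `T`. -/
noncomputable def skewKoopman [MeasurableMul₂ G] [MeasurableInv G] (μ : Measure X)
    [μ.IsMulLeftInvariant] [SFinite μ] (ν : Measure G) [ν.IsMulLeftInvariant] [SFinite ν]
    (a : X) (φ : X → G) (hφ : Measurable φ) :
    Lp ℂ 2 (μ.prod ν) ≃ₗᵢ[ℂ] Lp ℂ 2 (μ.prod ν) :=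
  weightedKoopman (skewProduct a φ hφ) (measurePreserving_skewProduct μ ν a φ hφ)
    (fun _ => 1) measurable_const (fun _ => norm_one)

variable [TopologicalSpace G]

theorem measurable_character [BorelSpace G] (χ : PontryaginDual G) :
    Measurable fun z => (χ z : ℂ) :=
  (continuous_subtype_val.comp (map_continuous χ)).measurable

/-- The unitary operator `U_χ ψ = (χ ∘ φ) · (ψ ∘ F)` of `L²(X)`, where `F x = a x`. -/
noncomputable def fiberKoopman [BorelSpace G] (μ : Measure X) [μ.IsMulLeftInvariant]
    (a : X) (φ : X → G) (hφ : Measurable φ) (χ : PontryaginDual G) :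
    Lp ℂ 2 μ ≃ₗᵢ[ℂ] Lp ℂ 2 μ :=
  weightedKoopman (MeasurableEquiv.mulLeft a) (measurePreserving_mul_left μ a)
    (fun x => (χ (φ x) : ℂ)) ((measurable_character χ).comp hφ) (fun _ => Circle.norm_coe _)

/-- The subspace `L_χ = {ψ ⊗ χ : ψ ∈ L²(X)}` of `L²(X × G)`. -/
noncomputable def fiberSubspace (μ : Measure X) (ν : Measure G) [SFinite ν]
    (χ : PontryaginDual G) : Submodule ℂ (Lp ℂ 2 (μ.prod ν)) where
  carrier := {Ψ | ∃ ψ : Lp ℂ 2 μ, Ψ =ᵐ[μ.prod ν] fun p => ψ p.1 * (χ p.2 : ℂ)}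
  add_mem' := by
    rintro Ψ₁ Ψ₂ ⟨ψ₁, h₁⟩ ⟨ψ₂, h₂⟩
    refine ⟨ψ₁ + ψ₂, ?_⟩
    filter_upwards [h₁, h₂, Lp.coeFn_add Ψ₁ Ψ₂,
      Measure.quasiMeasurePreserving_fst.ae (Lp.coeFn_add ψ₁ ψ₂)] with p e1 e2 e3 e4
    rw [e3, e4, Pi.add_apply, Pi.add_apply, e1, e2, add_mul]
  zero_mem' := by
    refine ⟨0, ?_⟩
    filter_upwards [Lp.coeFn_zero ℂ 2 (μ.prod ν),
      Measure.quasiMeasurePreserving_fst.ae (Lp.coeFn_zero ℂ 2 μ)] with p e1 e2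
    rw [e1, e2, Pi.zero_apply, Pi.zero_apply, zero_mul]
  smul_mem' := by
    rintro c Ψ ⟨ψ, h⟩
    refine ⟨c • ψ, ?_⟩
    filter_upwards [h, Lp.coeFn_smul c Ψ,
      Measure.quasiMeasurePreserving_fst.ae (Lp.coeFn_smul c ψ)] with p e1 e2 e3
    rw [e2, e3, Pi.smul_apply, Pi.smul_apply, e1, smul_eq_mul, smul_eq_mul, mul_assoc]

end Skew

section Intertwiners

variable {K H : Type*} [NormedAddCommGroup K] [InnerProductSpace ℂ K]
  [NormedAddCommGroup H] [InnerProductSpace ℂ H]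

/-- `T` intertwines the unitary operators `S` and `U`. -/
def Intertwines (S : K ≃ₗᵢ[ℂ] K) (U : H ≃ₗᵢ[ℂ] H) (T : K →L[ℂ] H) : Prop :=
  ∀ x, T (S x) = U (T x)

theorem linearIsometryEquiv_mul_apply (U V : H ≃ₗᵢ[ℂ] H) (x : H) : (U * V) x = U (V x) := rfl

theorem inner_map_eq_inner_symm (U : H ≃ₗᵢ[ℂ] H) (x z : H) :
    inner ℂ (U x) z = inner ℂ x (U.symm z) := by
  rw [← U.inner_map_map x, U.apply_symm_apply]

theorem starProjection_map_of_invariant {U : H ≃ₗᵢ[ℂ] H} {Z : Submodule ℂ H}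
    [Z.HasOrthogonalProjection] (hZ : ∀ x, U x ∈ Z ↔ x ∈ Z) (x : H) :
    Z.starProjection (U x) = U (Z.starProjection x) := by
  refine Submodule.eq_starProjection_of_mem_of_inner_eq_zero ((hZ _).2 (by simp)) fun w hw => ?_
  have hw' : U.symm w ∈ Z := (hZ _).1 (by simpa using hw)
  rw [← map_sub, inner_map_eq_inner_symm]
  exact Submodule.starProjection_inner_eq_zero _ _ hw'

theorem map_mem_topologicalClosure_iff {U : H ≃ₗᵢ[ℂ] H} {Z : Submodule ℂ H}
    (hZ : ∀ x, U x ∈ Z ↔ x ∈ Z) (x : H) :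
    U x ∈ Z.topologicalClosure ↔ x ∈ Z.topologicalClosure := by
  simp only [← SetLike.mem_coe, Submodule.topologicalClosure_coe]
  have h : (U.toHomeomorph : H → H) ⁻¹' (Z : Set H) = Z := by
    ext z; exact hZ z
  have h2 := U.toHomeomorph.preimage_closure (Z : Set H)
  rw [h] at h2
  rw [← Set.ext_iff.1 h2 x]
  rfl

namespace Intertwines

variable {S : K ≃ₗᵢ[ℂ] K} {U : H ≃ₗᵢ[ℂ] H} {T T' : K →L[ℂ] H}

theorem map_symm (hT : Intertwines S U T) (x : K) : T (S.symm x) = U.symm (T x) := by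
  apply U.injective
  rw [← hT, S.apply_symm_apply, U.apply_symm_apply]

theorem map_zpow (hT : Intertwines S U T) (n : ℤ) (x : K) :
    T ((S ^ n) x) = (U ^ n) (T x) := by
  induction n generalizing x with
  | zero => simp
  | succ n ih =>
    rw [zpow_add, zpow_add, zpow_one, zpow_one, linearIsometryEquiv_mul_apply,
      linearIsometryEquiv_mul_apply, ih, hT]
  | pred n ih =>
    rw [zpow_sub, zpow_sub, zpow_one, zpow_one, linearIsometryEquiv_mul_apply,
      linearIsometryEquiv_mul_apply, ih]
    exact congrArg _ (hT.map_symm x)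

theorem add (hT : Intertwines S U T) (hT' : Intertwines S U T') : Intertwines S U (T + T') :=
  fun x => by simp [hT x, hT' x]

theorem sub (hT : Intertwines S U T) (hT' : Intertwines S U T') : Intertwines S U (T - T') :=
  fun x => by simp [hT x, hT' x]

theorem one : Intertwines S S 1 := fun _ => rfl

theorem comp {L : Type*} [NormedAddCommGroup L] [InnerProductSpace ℂ L] {R : L ≃ₗᵢ[ℂ] L}
    {T' : H →L[ℂ] L} (hT' : Intertwines U R T') (hT : Intertwines S U T) :
    Intertwines S R (T' ∘L T) := fun x => by
  simp only [ContinuousLinearMap.comp_apply]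
  rw [hT, hT']

theorem adjoint [CompleteSpace K] [CompleteSpace H] (hT : Intertwines S U T) :
    Intertwines U S (ContinuousLinearMap.adjoint T) := fun z => by
  refine ext_inner_left ℂ fun x => ?_
  rw [ContinuousLinearMap.adjoint_inner_right, ← S.apply_symm_apply x,
    S.inner_map_map, hT, U.inner_map_map, ContinuousLinearMap.adjoint_inner_right]

theorem starProjection {Z : Submodule ℂ H} [Z.HasOrthogonalProjection]
    (hZ : ∀ x, U x ∈ Z ↔ x ∈ Z) : Intertwines U U Z.starProjection :=
  starProjection_map_of_invariant hZ

theorem map_mem_range_iff (hT : Intertwines S U T) (x : H) :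
    U x ∈ LinearMap.range T.toLinearMap ↔ x ∈ LinearMap.range T.toLinearMap := by
  constructor
  · rintro ⟨z, hz⟩
    refine ⟨S.symm z, ?_⟩
    have hz' : T z = U x := hz
    change T (S.symm z) = x
    rw [hT.map_symm, hz', U.symm_apply_apply]
  · rintro ⟨z, rfl⟩
    exact ⟨S z, hT z⟩

end Intertwines

theorem exists_clm_of_norm_eq [CompleteSpace K] [CompleteSpace H] {M : Type*} [AddCommGroup M]
    [Module ℂ M] (e : M →ₗ[ℂ] K) (f : M →ₗ[ℂ] H) (h : ∀ x, ‖f x‖ = ‖e x‖) :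
    ∃ V : K →L[ℂ] H, (∀ x, V (e x) = f x) ∧
      ContinuousLinearMap.adjoint V ∘L V =
        (LinearMap.range e).topologicalClosure.starProjection := by
  set Z := (LinearMap.range e).topologicalClosure with hZ
  have hmem : ∀ x, e x ∈ Z := fun x => Submodule.le_topologicalClosure _ ⟨x, rfl⟩
  let e' : M →ₗ[ℂ] Z := e.codRestrict Z hmem
  have hd : DenseRange e' := by
    intro z
    rw [Metric.mem_closure_iff]
    intro ε hε
    have hz : (z : K) ∈ closure (LinearMap.range e : Set K) := by
      rw [← Submodule.topologicalClosure_coe]; exact z.2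
    obtain ⟨_, ⟨x, rfl⟩, hx⟩ := Metric.mem_closure_iff.1 hz ε hε
    exact ⟨_, ⟨x, rfl⟩, hx⟩
  have hn : ∃ C : ℝ, ∀ x, ‖f x‖ ≤ C * ‖e' x‖ := ⟨1, fun x => by rw [one_mul, h]; rfl⟩
  let V₀ : Z →L[ℂ] H := f.extendOfNorm e'
  have hV₀ : ∀ x, V₀ (e' x) = f x := LinearMap.extendOfNorm_eq hd hn
  have hiso : ∀ z, ‖V₀ z‖ = ‖z‖ := fun z =>
    hd.induction_on (p := fun z => ‖V₀ z‖ = ‖z‖) z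
      (isClosed_eq (by fun_prop) (by fun_prop)) fun x => by rw [hV₀, h]; rfl
  have hin : ∀ z w, inner ℂ (V₀ z) (V₀ w) = inner ℂ z w :=
    (⟨V₀.toLinearMap, hiso⟩ : Z →ₗᵢ[ℂ] H).inner_map_map
  refine ⟨V₀ ∘L Z.orthogonalProjectionOnto, fun x => ?_, ?_⟩
  · rw [ContinuousLinearMap.comp_apply,
      Z.orthogonalProjectionOnto_mem_subspace_eq_self ⟨e x, hmem x⟩]
    exact hV₀ x
  · ext1 x
    refine ext_inner_left ℂ fun w => ?_
    rw [ContinuousLinearMap.comp_apply, ContinuousLinearMap.adjoint_inner_right]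
    simp only [ContinuousLinearMap.comp_apply, hin]
    rw [Submodule.coe_inner, ← Submodule.starProjection_apply, ← Submodule.starProjection_apply,
      Submodule.inner_starProjection_left_eq_right,
      Submodule.starProjection_eq_self_iff.2 (Submodule.starProjection_apply_mem _ _)]

/-- `V` is a partial isometry that intertwines `S` and `U`. -/
structure IsPartialIsometricIntertwiner [CompleteSpace K] [CompleteSpace H] (S : K ≃ₗᵢ[ℂ] K)
    (U : H ≃ₗᵢ[ℂ] H) (V : K →L[ℂ] H) : Prop where
  intertwines : Intertwines S U V
  idem : ∀ x, ContinuousLinearMap.adjoint V (V (ContinuousLinearMap.adjoint V (V x))) =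
    ContinuousLinearMap.adjoint V (V x)
  apply_idem : ∀ x, V (ContinuousLinearMap.adjoint V (V x)) = V x

theorem Intertwines.exists_polar [CompleteSpace K] [CompleteSpace H] {S : K ≃ₗᵢ[ℂ] K}
    {U : H ≃ₗᵢ[ℂ] H} {T : K →L[ℂ] H} (hT : Intertwines S U T) :
    ∃ V : K →L[ℂ] H, IsPartialIsometricIntertwiner S U V ∧
      LinearMap.range T.toLinearMap ≤ LinearMap.range V.toLinearMap ∧
      LinearMap.range V.toLinearMap ≤ (LinearMap.range T.toLinearMap).topologicalClosure := by
  set B : K →L[ℂ] K := ContinuousLinearMap.adjoint T ∘L T with hB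
  have hB0 : 0 ≤ B := by
    rw [ContinuousLinearMap.nonneg_iff_isPositive]
    exact ContinuousLinearMap.isPositive_adjoint_comp_self T
  set A : K →L[ℂ] K := CFC.sqrt B with hA
  have hA0 : 0 ≤ A := CFC.sqrt_nonneg B
  have hAsa : ContinuousLinearMap.adjoint A = A :=
    (ContinuousLinearMap.isSelfAdjoint_iff').1 (IsSelfAdjoint.of_nonneg hA0)
  have hAA : A ∘L A = B := CFC.sqrt_mul_sqrt_self B hB0
  have hAS : Intertwines S S A := by
    let S' : K →L[ℂ] K := S.toContinuousLinearEquiv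
    have hc : Commute B S' := by
      refine ContinuousLinearMap.ext fun x => ?_
      exact (hT.adjoint.comp hT) x
    have : Commute A S' := hc.cfcₙ_nnreal _
    intro x
    exact DFunLike.congr_fun this.eq x
  have hnorm : ∀ x, ‖T x‖ = ‖A x‖ := fun x => by
    have h1 : inner ℂ (T x) (T x) = inner ℂ (A x) (A x) := by
      rw [← ContinuousLinearMap.adjoint_inner_right T,
        ← ContinuousLinearMap.adjoint_inner_right A, hAsa]
      exact congrArg (inner ℂ x) (DFunLike.congr_fun hAA x).symm
    rw [inner_self_eq_norm_sq_to_K, inner_self_eq_norm_sq_to_K] at h1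
    have h2 : ‖T x‖ ^ 2 = ‖A x‖ ^ 2 := by exact_mod_cast h1
    exact (pow_left_inj₀ (norm_nonneg _) (norm_nonneg _) two_ne_zero).1 h2
  obtain ⟨V, hV, hQ⟩ := exists_clm_of_norm_eq A.toLinearMap T.toLinearMap hnorm
  set Z := (LinearMap.range A.toLinearMap).topologicalClosure with hZ
  have hQ' : ∀ x, ContinuousLinearMap.adjoint V (V x) = Z.starProjection x :=
    fun x => DFunLike.congr_fun hQ x
  have hVQ : ∀ x, V (Z.starProjection x) = V x := fun x => by
    rw [← sub_eq_zero, ← map_sub, ← inner_self_eq_zero (𝕜 := ℂ),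
      ← ContinuousLinearMap.adjoint_inner_right, hQ', map_sub,
      Submodule.starProjection_eq_self_iff.2 (Submodule.starProjection_apply_mem _ _), sub_self,
      inner_zero_right]
  have hZS := map_mem_topologicalClosure_iff hAS.map_mem_range_iff
  have hVcl : ∀ p : K → Prop, IsClosed {x | p x} → (∀ x, p (A x)) → ∀ x ∈ Z, p x := by
    intro p hp h x hx
    have : (Z : Set K) ⊆ {x | p x} := by
      rw [hZ, Submodule.topologicalClosure_coe]
      refine closure_minimal ?_ hp
      rintro _ ⟨z, rfl⟩
      exact h z
    exact this hx
  refine ⟨V, ⟨fun x => ?_, fun x => ?_, fun x => ?_⟩, ?_, ?_⟩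
  · rw [← hVQ, starProjection_map_of_invariant hZS, ← hVQ x]
    refine hVcl (fun z => V (S z) = U (V z)) (isClosed_eq (by fun_prop) (by fun_prop)) (fun z => ?_)
      _ (Submodule.starProjection_apply_mem _ _)
    have e1 : V (A (S z)) = T (S z) := hV (S z)
    have e2 : V (A z) = T z := hV z
    rw [← hAS, e1, e2, hT]
  · rw [hQ', hQ', Submodule.starProjection_eq_self_iff]
    exact Submodule.starProjection_apply_mem _ _
  · rw [hQ', hVQ]
  · rintro _ ⟨x, rfl⟩
    exact ⟨A x, hV x⟩
  · rintro _ ⟨x, rfl⟩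
    change V x ∈ _
    rw [← hVQ x]
    refine hVcl (fun z => V z ∈ (LinearMap.range T.toLinearMap).topologicalClosure)
      ((Submodule.isClosed_topologicalClosure _).preimage V.continuous) (fun z => ?_)
      _ (Submodule.starProjection_apply_mem _ _)
    exact Submodule.le_topologicalClosure _ ⟨z, (hV z).symm⟩

end Intertwiners

section Cyclic

variable {K H : Type*} [NormedAddCommGroup K] [InnerProductSpace ℂ K]
  [NormedAddCommGroup H] [InnerProductSpace ℂ H]

theorem map_mem_span_orbit_iff (U : H ≃ₗᵢ[ℂ] H) {ι : Type*} (g : ι × ℤ → H)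
    (hg : ∀ i n, U (g (i, n)) = g (i, n + 1)) (x : H) :
    U x ∈ Submodule.span ℂ (Set.range g) ↔ x ∈ Submodule.span ℂ (Set.range g) := by
  have key : ∀ (R : H →ₗ[ℂ] H), (∀ p, R (g p) ∈ Submodule.span ℂ (Set.range g)) →
      ∀ z ∈ Submodule.span ℂ (Set.range g), R z ∈ Submodule.span ℂ (Set.range g) := by
    intro R hR z hz
    have : Submodule.span ℂ (Set.range g) ≤ (Submodule.span ℂ (Set.range g)).comap R := by
      rw [Submodule.span_le]
      rintro _ ⟨p, rfl⟩
      exact hR p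
    exact this hz
  constructor
  · intro h
    rw [← U.symm_apply_apply x]
    refine key U.symm.toLinearEquiv.toLinearMap (fun p => ?_) _ h
    have : U.symm (g p) = g (p.1, p.2 - 1) := by
      rw [LinearIsometryEquiv.symm_apply_eq, hg, sub_add_cancel]
    exact this ▸ Submodule.subset_span ⟨_, rfl⟩
  · refine key U.toLinearEquiv.toLinearMap (fun p => ?_) _
    exact (hg p.1 p.2) ▸ Submodule.subset_span ⟨_, rfl⟩

theorem zpow_succ_apply (U : H ≃ₗᵢ[ℂ] H) (n : ℤ) (x : H) :
    U ((U ^ n) x) = (U ^ (n + 1)) x := by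
  rw [add_comm, zpow_one_add]; rfl

theorem basis_eq_zpow {S : K ≃ₗᵢ[ℂ] K} (b : HilbertBasis ℤ ℂ K) (hb : ∀ n, S (b n) = b (n + 1))
    (n : ℤ) : b n = (S ^ n) (b 0) := by
  induction n with
  | zero => simp
  | succ n ih => rw [← hb, ih, zpow_succ_apply]
  | pred n ih =>
    apply S.injective
    rw [hb, zpow_succ_apply, sub_add_cancel, ih]

theorem exists_intertwiner_of_summable [CompleteSpace K] [CompleteSpace H] {S : K ≃ₗᵢ[ℂ] K}
    (b : HilbertBasis ℤ ℂ K) (hb : ∀ n, S (b n) = b (n + 1)) (U : H ≃ₗᵢ[ℂ] H) {D : Set H}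
    (hD : Dense D) (f : H)
    (hf : ∀ d ∈ D, Summable fun n : ℤ => ‖inner ℂ d ((U ^ n) f)‖ ^ 2) :
    ∃ T : K →L[ℂ] H, Intertwines S U T ∧
      f ∈ (LinearMap.range T.toLinearMap).topologicalClosure := by
  let W : WithLp 2 (K × H) ≃ₗᵢ[ℂ] WithLp 2 (K × H) := LinearIsometryEquiv.withLpProdCongr 2 S U
  let g : Unit × ℤ → WithLp 2 (K × H) := fun n => WithLp.toLp 2 (b n.2, (U ^ n.2) f)
  have hg : ∀ i n, W (g (i, n)) = g (i, n + 1) := fun i n => by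
    change WithLp.toLp 2 (S (b n), U ((U ^ n) f)) = WithLp.toLp 2 (b (n + 1), (U ^ (n + 1)) f)
    rw [hb, zpow_succ_apply]
  set G := (Submodule.span ℂ (Set.range g)).topologicalClosure with hG
  have hGW : ∀ x, W x ∈ G ↔ x ∈ G :=
    map_mem_topologicalClosure_iff (map_mem_span_orbit_iff W g hg)
  have hclos : ∀ h : H, WithLp.toLp 2 ((0 : K), h) ∈ G → h = 0 := by
    intro h hh
    refine hD.eq_zero_of_inner_right ℂ fun d hd => ?_
    have hmem : Memℓp (fun n : ℤ => star (inner ℂ d ((U ^ n) f))) 2 := by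
      refine memℓp_gen ?_
      simpa [norm_inner_symm] using hf d hd
    let k : K := b.repr.symm ⟨_, hmem⟩
    have hk : ∀ n, inner ℂ k (b n) = inner ℂ d ((U ^ n) f) := fun n => by
      rw [← inner_conj_symm, ← b.repr_apply_apply, b.repr.apply_symm_apply]
      exact star_star _
    have hcl : IsClosed {z : WithLp 2 (K × H) | inner ℂ k z.fst = inner ℂ d z.snd} := by
      refine isClosed_eq ?_ ?_
      · exact continuous_const.inner (WithLp.fstL 2 ℂ K H).continuous
      · exact continuous_const.inner (WithLp.sndL 2 ℂ K H).continuous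
    have hsub : (G : Set (WithLp 2 (K × H))) ⊆ {z | inner ℂ k z.fst = inner ℂ d z.snd} := by
      rw [hG, Submodule.topologicalClosure_coe]
      refine closure_minimal (fun z hz => ?_) hcl
      refine Submodule.span_induction (p := fun z _ => inner ℂ k z.fst = inner ℂ d z.snd)
        ?_ ?_ ?_ ?_ hz
      · rintro _ ⟨n, rfl⟩
        exact hk n.2
      · simp
      · intro x z _ _ h1 h2
        simp [h1, h2]
      · intro c x _ h1
        simp [h1]
    have := hsub hh
    simpa using this.symm
  let inl : K →L[ℂ] WithLp 2 (K × H) :=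
    (WithLp.prodContinuousLinearEquiv 2 ℂ K H).symm.toContinuousLinearMap ∘L
      ContinuousLinearMap.inl ℂ K H
  have hinl : ∀ x, inl x = WithLp.toLp 2 (x, 0) := fun _ => rfl
  let T : K →L[ℂ] H := WithLp.sndL 2 ℂ K H ∘L G.starProjection ∘L inl
  refine ⟨T, fun x => ?_, ?_⟩
  · have h1 : inl (S x) = W (inl x) := by
      rw [hinl, hinl]
      change _ = WithLp.toLp 2 (S x, U 0)
      rw [map_zero]
    change (G.starProjection (inl (S x))).snd = U (G.starProjection (inl x)).snd
    rw [h1, starProjection_map_of_invariant hGW]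
    rfl
  · rw [← Submodule.orthogonal_orthogonal_eq_closure, Submodule.mem_orthogonal]
    intro h hh
    rw [Submodule.mem_orthogonal'] at hh
    set p := G.starProjection (WithLp.toLp 2 ((0 : K), h)) with hp
    have hp1 : p.fst = 0 := by
      refine ext_inner_right ℂ fun x => ?_
      have h0 := hh (T x) ⟨x, rfl⟩
      have h1 : inner ℂ p (WithLp.toLp 2 (x, (0 : H))) =
          inner ℂ (WithLp.toLp 2 ((0 : K), h)) (G.starProjection (inl x)) := by
        rw [hp, Submodule.inner_starProjection_left_eq_right]; rfl
      rw [WithLp.prod_inner_apply, WithLp.prod_inner_apply] at h1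
      simp only [inner_zero_right, add_zero, inner_zero_left, zero_add] at h1 ⊢
      exact h1.trans h0
    have hp2 : p = WithLp.toLp 2 ((0 : K), p.snd) := by
      rw [← hp1]; rfl
    have hp3 : p.snd = 0 :=
      hclos _ (hp2 ▸ Submodule.starProjection_apply_mem _ _)
    have hp0 : p = 0 := by rw [hp2, hp3]; rfl
    have hgG : g ((), 0) ∈ G := Submodule.le_topologicalClosure _ (Submodule.subset_span ⟨_, rfl⟩)
    have h2 : inner ℂ p (g ((), 0)) = inner ℂ (WithLp.toLp 2 ((0 : K), h)) (g ((), 0)) := by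
      rw [hp, Submodule.inner_starProjection_left_eq_right,
        Submodule.starProjection_eq_self_iff.2 hgG]
    rw [hp0, inner_zero_left, WithLp.prod_inner_apply] at h2
    simpa [g] using h2.symm

/-- The closed span of `Z` and the ranges of `T 0, …, T (n - 1)`. -/
noncomputable def partialSpan (Z : Submodule ℂ H) (T : ℕ → K →L[ℂ] H) (n : ℕ) : Submodule ℂ H :=
  (Z ⊔ ⨆ i : Fin n, LinearMap.range (T i).toLinearMap).topologicalClosure

theorem partialSpan_mono (Z : Submodule ℂ H) (T : ℕ → K →L[ℂ] H) : Monotone (partialSpan Z T) := by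
  intro m n hmn
  refine Submodule.topologicalClosure_mono (sup_le_sup_left (iSup_le fun i => ?_) _)
  exact le_iSup (fun j : Fin n => LinearMap.range (T j).toLinearMap) (Fin.castLE hmn i)

theorem le_partialSpan (Z : Submodule ℂ H) (T : ℕ → K →L[ℂ] H) (n : ℕ) : Z ≤ partialSpan Z T n :=
  le_sup_left.trans (Submodule.le_topologicalClosure _)

theorem range_le_partialSpan (Z : Submodule ℂ H) (T : ℕ → K →L[ℂ] H) (n : ℕ) :
    LinearMap.range (T n).toLinearMap ≤ partialSpan Z T (n + 1) :=
  ((le_iSup (fun j : Fin (n + 1) => LinearMap.range (T j).toLinearMap) (Fin.last n)).trans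
    le_sup_right).trans (Submodule.le_topologicalClosure _)

theorem map_mem_sup_iff {U : H ≃ₗᵢ[ℂ] H} {A B : Submodule ℂ H} (hA : ∀ x, U x ∈ A ↔ x ∈ A)
    (hB : ∀ x, U x ∈ B ↔ x ∈ B) (x : H) : U x ∈ A ⊔ B ↔ x ∈ A ⊔ B := by
  constructor
  · intro h
    obtain ⟨a, ha, c, hc, hac⟩ := Submodule.mem_sup.1 h
    refine Submodule.mem_sup.2 ⟨U.symm a, (hA _).1 (by simpa), U.symm c, (hB _).1 (by simpa), ?_⟩
    rw [← map_add, hac, U.symm_apply_apply]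
  · intro h
    obtain ⟨a, ha, c, hc, rfl⟩ := Submodule.mem_sup.1 h
    rw [map_add]
    exact Submodule.mem_sup.2 ⟨_, (hA _).2 ha, _, (hB _).2 hc, rfl⟩

theorem map_mem_iSup_iff {U : H ≃ₗᵢ[ℂ] H} {ι : Sort*} {A : ι → Submodule ℂ H}
    (hA : ∀ i x, U x ∈ A i ↔ x ∈ A i) (x : H) : U x ∈ ⨆ i, A i ↔ x ∈ ⨆ i, A i := by
  have h1 : (⨆ i, A i) ≤ (⨆ i, A i).comap U.toLinearEquiv.toLinearMap :=
    iSup_le fun i z hz => Submodule.mem_iSup_of_mem i ((hA i z).2 hz)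
  have h2 : (⨆ i, A i) ≤ (⨆ i, A i).comap U.symm.toLinearEquiv.toLinearMap :=
    iSup_le fun i z hz => Submodule.mem_iSup_of_mem i ((hA i _).1 (by simpa using hz))
  refine ⟨fun h => ?_, fun h => h1 h⟩
  have := h2 h
  simpa using this

theorem map_mem_partialSpan_iff {S : K ≃ₗᵢ[ℂ] K} {U : H ≃ₗᵢ[ℂ] H} {Z : Submodule ℂ H}
    (hZ : ∀ x, U x ∈ Z ↔ x ∈ Z) {T : ℕ → K →L[ℂ] H} (hT : ∀ i, Intertwines S U (T i)) (n : ℕ)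
    (x : H) : U x ∈ partialSpan Z T n ↔ x ∈ partialSpan Z T n :=
  map_mem_topologicalClosure_iff
    (map_mem_sup_iff hZ (map_mem_iSup_iff fun i : Fin n => (hT i).map_mem_range_iff)) x

theorem exists_orthogonal_intertwiners [CompleteSpace K] [CompleteSpace H] {S : K ≃ₗᵢ[ℂ] K}
    {U : H ≃ₗᵢ[ℂ] H} {Z : Submodule ℂ H} (hZ : ∀ x, U x ∈ Z ↔ x ∈ Z) {T : ℕ → K →L[ℂ] H}
    (hT : ∀ i, Intertwines S U (T i)) :
    ∃ V : ℕ → K →L[ℂ] H, (∀ i, IsPartialIsometricIntertwiner S U (V i)) ∧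
      (∀ i j, i ≠ j → ∀ x z, inner ℂ (V i x) (V j z) = 0) ∧
      (∀ i x, ∀ z ∈ Z, inner ℂ z (V i x) = 0) ∧
      (Z ⊔ ⨆ i, LinearMap.range (V i).toLinearMap).topologicalClosure =
        (Z ⊔ ⨆ i, LinearMap.range (T i).toLinearMap).topologicalClosure := by
  have hpc : ∀ i, IsClosed (partialSpan Z T i : Set H) := fun i =>
    Submodule.isClosed_topologicalClosure _
  have : ∀ i, CompleteSpace (partialSpan Z T i) := fun i => (hpc i).completeSpace_coe
  let T' : ℕ → K →L[ℂ] H := fun i => T i - (partialSpan Z T i).starProjection ∘L T i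
  have hT'a : ∀ i x, T' i x = T i x - (partialSpan Z T i).starProjection (T i x) := fun _ _ => rfl
  have hT' : ∀ i, Intertwines S U (T' i) := fun i =>
    (hT i).sub ((Intertwines.starProjection (map_mem_partialSpan_iff hZ hT i)).comp (hT i))
  choose V hV hTV hVT using fun i => (hT' i).exists_polar
  have hT'o : ∀ i, LinearMap.range (T' i).toLinearMap ≤ (partialSpan Z T i)ᗮ := by
    rintro i _ ⟨x, rfl⟩
    exact Submodule.sub_starProjection_mem_orthogonal _
  have hVo : ∀ i x, V i x ∈ (partialSpan Z T i)ᗮ := fun i x =>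
    Submodule.topologicalClosure_minimal _ (hT'o i) (Submodule.isClosed_orthogonal _)
      (hVT i ⟨x, rfl⟩)
  have hT'm : ∀ i, LinearMap.range (T' i).toLinearMap ≤ partialSpan Z T (i + 1) := by
    rintro i _ ⟨x, rfl⟩
    exact Submodule.sub_mem _ (range_le_partialSpan Z T i ⟨x, rfl⟩)
      (partialSpan_mono Z T i.le_succ (Submodule.starProjection_apply_mem _ _))
  have hVm : ∀ i x, V i x ∈ partialSpan Z T (i + 1) := fun i x =>
    Submodule.topologicalClosure_minimal _ (hT'm i) (hpc _) (hVT i ⟨x, rfl⟩)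
  have hlt : ∀ i j, i < j → ∀ x z, inner ℂ (V i x) (V j z) = 0 := fun i j hij x z =>
    (Submodule.mem_orthogonal _ _).1 (hVo j z) _ (partialSpan_mono Z T hij (hVm i x))
  refine ⟨V, hV, fun i j hij x z => ?_, fun i x z hz => ?_, le_antisymm ?_ ?_⟩
  · rcases lt_or_gt_of_ne hij with h | h
    · exact hlt i j h x z
    · exact inner_eq_zero_symm.1 (hlt j i h z x)
  · exact (Submodule.mem_orthogonal _ _).1 (hVo i x) _ (le_partialSpan Z T i hz)
  · refine Submodule.topologicalClosure_minimal _ (sup_le ?_ (iSup_le fun i => ?_))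
      (Submodule.isClosed_topologicalClosure _)
    · exact le_sup_left.trans (Submodule.le_topologicalClosure _)
    · rintro _ ⟨x, rfl⟩
      refine (Submodule.topologicalClosure_mono (sup_le_sup_left (iSup_le fun j => ?_) _))
        (hVm i x)
      exact le_iSup (fun j => LinearMap.range (T j).toLinearMap) (j : ℕ)
  · set C := (Z ⊔ ⨆ i, LinearMap.range (V i).toLinearMap).topologicalClosure with hC
    have hCc : IsClosed (C : Set H) := Submodule.isClosed_topologicalClosure _
    have hVC : ∀ i, LinearMap.range (V i).toLinearMap ≤ C := fun i =>
      ((le_iSup (fun i => LinearMap.range (V i).toLinearMap) i).trans le_sup_right).trans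
        (Submodule.le_topologicalClosure _)
    have hZC : Z ≤ C := le_sup_left.trans (Submodule.le_topologicalClosure _)
    have step : ∀ i, partialSpan Z T i ≤ C → LinearMap.range (T i).toLinearMap ≤ C := by
      rintro i hi _ ⟨x, rfl⟩
      have : T i x = T' i x + (partialSpan Z T i).starProjection (T i x) := by
        rw [hT'a, sub_add_cancel]
      change T i x ∈ C
      rw [this]
      exact C.add_mem (hVC i (hTV i ⟨x, rfl⟩)) (hi (Submodule.starProjection_apply_mem _ _))
    have all : ∀ n, ∀ i < n, LinearMap.range (T i).toLinearMap ≤ C := by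
      intro n
      induction n with
      | zero => simp
      | succ n ih =>
        intro i hi
        rcases Nat.lt_succ_iff_lt_or_eq.1 hi with h | rfl
        · exact ih i h
        · exact step i (Submodule.topologicalClosure_minimal _
            (sup_le hZC (iSup_le fun j => ih j j.2)) hCc)
    exact Submodule.topologicalClosure_minimal _
      (sup_le hZC (iSup_le fun i => all (i + 1) i i.lt_succ_self)) hCc

end Cyclic

section Swindle

variable {K H : Type*} [NormedAddCommGroup K] [InnerProductSpace ℂ K] [CompleteSpace K]
  [NormedAddCommGroup H] [InnerProductSpace ℂ H] [CompleteSpace H]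

theorem hasCountableLebesgueSpectrumOn_of_isometries {S : K ≃ₗᵢ[ℂ] K}
    (b : HilbertBasis ℤ ℂ K) (hb : ∀ n, S (b n) = b (n + 1)) {U : H ≃ₗᵢ[ℂ] H}
    {M : Submodule ℂ H} {T : ℕ → K →L[ℂ] H} (hT : ∀ i, Intertwines S U (T i))
    (hTM : (⨆ i, LinearMap.range (T i).toLinearMap).topologicalClosure = M)
    {J : ℕ → K →L[ℂ] H} (hJ : ∀ i, Intertwines S U (J i)) (hJM : ∀ i x, J i x ∈ M)
    (hJJ : ∀ i x z, inner ℂ (J i x) (J i z) = inner ℂ x z)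
    (hJo : ∀ i j, i ≠ j → ∀ x z, inner ℂ (J i x) (J j z) = 0) :
    HasCountableLebesgueSpectrumOn U M := by
  have hMc : IsClosed (M : Set H) := hTM ▸ Submodule.isClosed_topologicalClosure _
  set Z : Submodule ℂ H := ⨆ i, LinearMap.range (J i).toLinearMap with hZ
  have hJZ : ∀ i x, J i x ∈ Z := fun i x => Submodule.mem_iSup_of_mem i ⟨x, rfl⟩
  have hZM : Z ≤ M := iSup_le fun i => by rintro _ ⟨x, rfl⟩; exact hJM i x
  have hTleM : ⨆ i, LinearMap.range (T i).toLinearMap ≤ M :=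
    (Submodule.le_topologicalClosure _).trans_eq hTM
  obtain ⟨V, hV, hVo, hVZ, hVT⟩ := exists_orthogonal_intertwiners (Z := Z)
    (map_mem_iSup_iff fun i => (hJ i).map_mem_range_iff) hT
  have hVTM : (Z ⊔ ⨆ i, LinearMap.range (V i).toLinearMap).topologicalClosure = M := by
    rw [hVT]
    refine le_antisymm (Submodule.topologicalClosure_minimal _ (sup_le hZM hTleM) hMc) ?_
    rw [← hTM]
    exact Submodule.topologicalClosure_mono le_sup_right
  have hVM : ∀ i x, V i x ∈ M := fun i x => by
    rw [← hVTM]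
    exact Submodule.le_topologicalClosure _ (Submodule.mem_sup_right
      (Submodule.mem_iSup_of_mem i ⟨x, rfl⟩))
  let Q : ℕ → K →L[ℂ] K := fun i => ContinuousLinearMap.adjoint (V i) ∘L V i
  have hQQ : ∀ i x, Q i (Q i x) = Q i x := fun i x => (hV i).idem x
  have hQsa : ∀ i x z, inner ℂ (Q i x) z = inner ℂ x (Q i z) := fun i x z => by
    change inner ℂ (ContinuousLinearMap.adjoint (V i) (V i x)) z =
      inner ℂ x (ContinuousLinearMap.adjoint (V i) (V i z))
    rw [ContinuousLinearMap.adjoint_inner_left, ContinuousLinearMap.adjoint_inner_right]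
  have hQS : ∀ i, Intertwines S S (Q i) := fun i =>
    (hV i).intertwines.adjoint.comp (hV i).intertwines
  have hVV : ∀ i x z, inner ℂ (V i x) (V i z) = inner ℂ (Q i x) z := fun i x z =>
    (ContinuousLinearMap.adjoint_inner_left (V i) z (V i x)).symm
  let A : ℕ → ℕ → K →L[ℂ] H := fun i k =>
    Nat.casesOn k (V i) fun k => J (Nat.pairEquiv (i, k))
  have hA0 : ∀ i, A i 0 = V i := fun _ => rfl
  have hA1 : ∀ i k, A i (k + 1) = J (Nat.pairEquiv (i, k)) := fun _ _ => rfl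
  have hAint : ∀ i k, Intertwines S U (A i k) := by
    rintro i (_ | k)
    exacts [(hV i).intertwines, hJ _]
  have hAM : ∀ i k x, A i k x ∈ M := by
    rintro i (_ | k) x
    exacts [hVM i x, hJM _ x]
  have hAo : ∀ i k i' k', (i, k) ≠ (i', k') → ∀ x z, inner ℂ (A i k x) (A i' k' z) = 0 := by
    rintro i (_ | k) i' (_ | k') hne x z
    · exact hVo i i' (fun h => hne (by rw [h])) x z
    · exact inner_eq_zero_symm.1 (hVZ i x _ (hJZ _ z))
    · exact hVZ i' z _ (hJZ _ x)
    · refine hJo _ _ (fun h => hne ?_) x z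
      have := Nat.pairEquiv.injective h
      simp only [Prod.mk.injEq] at this
      rw [this.1, this.2]
  have hAQ : ∀ i k x z, inner ℂ (A i k (Q i x)) (A i k (Q i z)) = inner ℂ (Q i x) (Q i z) := by
    rintro i (_ | k) x z
    · rw [hA0, hVV, hQQ]
    · rw [hA1, hJJ]
  have hAQ' : ∀ i x, A i 0 (Q i x) = A i 0 x := fun i x => (hV i).apply_idem x
  let B : ℕ → ℕ → K →L[ℂ] H := fun i k => A i k ∘L Q i + A i (k + 1) ∘L (1 - Q i)
  have hB : ∀ i k x, B i k x = A i k (Q i x) + A i (k + 1) (x - Q i x) := fun _ _ _ => rfl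
  have hBint : ∀ i k, Intertwines S U (B i k) := fun i k =>
    ((hAint i k).comp (hQS i)).add ((hAint i (k + 1)).comp (Intertwines.one.sub (hQS i)))
  have hQ1 : ∀ i x z, inner ℂ (x - Q i x) (Q i z) = 0 := fun i x z => by
    rw [inner_sub_left, hQsa, hQQ, sub_self]
  have hQ2 : ∀ i x z, inner ℂ (Q i z) (x - Q i x) = 0 := fun i x z =>
    inner_eq_zero_symm.1 (hQ1 i x z)
  have hBB : ∀ i k x z, inner ℂ (B i k x) (B i k z) = inner ℂ x z := fun i k x z => by
    have hne : (i, k) ≠ (i, k + 1) := by simp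
    rw [hB, hB, inner_add_left, inner_add_right, inner_add_right, hAQ,
      hAo _ _ _ _ hne, hAo _ _ _ _ hne.symm, hA1, hJJ]
    have e : inner ℂ x z = inner ℂ (Q i x + (x - Q i x)) (Q i z + (z - Q i z)) := by simp
    rw [e, inner_add_left, inner_add_right, inner_add_right, hQ1, hQ2]
  have hBo1 : ∀ i k x z, inner ℂ (B i k x) (B i (k + 1) z) = 0 := fun i k x z => by
    have h1 : (i, k) ≠ (i, k + 1) := by simp
    have h2 : (i, k) ≠ (i, k + 1 + 1) := by simp; omega
    have h3 : (i, k + 1) ≠ (i, k + 1 + 1) := by simp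
    rw [hB i k, hB i (k + 1), inner_add_left, inner_add_right, inner_add_right, hAo _ _ _ _ h1,
      hAo _ _ _ _ h2, hAo _ _ _ _ h3, hA1, hJJ, hQ1]
    simp
  have hBo : ∀ i k i' k', (i, k) ≠ (i', k') → ∀ x z, inner ℂ (B i k x) (B i' k' z) = 0 := by
    intro i k i' k' hne x z
    by_cases hi : i = i'
    · subst hi
      have hk : k ≠ k' := fun h => hne (by rw [h])
      by_cases h1 : k' = k + 1
      · subst h1; exact hBo1 i k x z
      by_cases h2 : k = k' + 1
      · subst h2; exact inner_eq_zero_symm.1 (hBo1 i k' z x)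
      rw [hB i k, hB i k', inner_add_left, inner_add_right, inner_add_right,
        hAo i k i k' (by simpa using hk), hAo i k i (k' + 1) (by simpa using h2),
        hAo i (k + 1) i k' (by simpa using Ne.symm h1),
        hAo i (k + 1) i (k' + 1) (by simpa using hk)]
      simp
    · have hne' : ∀ l l' : ℕ, (i, l) ≠ (i', l') := fun l l' h => hi (congrArg Prod.fst h)
      rw [hB i k, hB i' k', inner_add_left, inner_add_right, inner_add_right,
        hAo i k i' k' (hne' _ _), hAo i k i' (k' + 1) (hne' _ _), hAo i (k + 1) i' k' (hne' _ _),
        hAo i (k + 1) i' (k' + 1) (hne' _ _)]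
      simp
  have hBM : ∀ i k x, B i k x ∈ M := fun i k x =>
    M.add_mem (hAM i k (Q i x)) (hAM i (k + 1) (x - Q i x))
  let v : ℕ × ℤ → H := fun p => B (Nat.pairEquiv.symm p.1).1 (Nat.pairEquiv.symm p.1).2 (b p.2)
  refine ⟨v, ?_, ?_, fun j k => ?_⟩
  · rw [orthonormal_iff_ite]
    rintro ⟨j, n⟩ ⟨j', n'⟩
    by_cases hj : j = j'
    · subst hj
      change inner ℂ (B _ _ _) (B _ _ _) = _
      rw [hBB, orthonormal_iff_ite.1 b.orthonormal]
      simp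
    · rw [if_neg fun h => hj (congrArg Prod.fst h)]
      exact hBo _ _ _ _ (fun h => hj (Nat.pairEquiv.symm.injective h)) _ _
  · set C := (Submodule.span ℂ (Set.range v)).topologicalClosure with hC
    have hCc : IsClosed (C : Set H) := Submodule.isClosed_topologicalClosure _
    refine le_antisymm (Submodule.topologicalClosure_minimal _ (Submodule.span_le.2 ?_) hMc) ?_
    · rintro _ ⟨p, rfl⟩
      exact hBM _ _ _
    have hBC : ∀ i k x, B i k x ∈ C := by
      intro i k x
      have hx : x ∈ (Submodule.span ℂ (Set.range b)).topologicalClosure := by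
        rw [b.dense_span]; trivial
      have hle : Submodule.span ℂ (Set.range b) ≤ C.comap (B i k).toLinearMap := by
        rw [Submodule.span_le]
        rintro _ ⟨n, rfl⟩
        refine Submodule.le_topologicalClosure _
          (Submodule.subset_span ⟨(Nat.pairEquiv (i, k), n), ?_⟩)
        simp only [v, Equiv.symm_apply_apply]
        rfl
      exact Submodule.topologicalClosure_minimal _ hle (hCc.preimage (B i k).continuous) hx
    have hAC1 : ∀ i k x, A i k (Q i x) ∈ C := fun i k x => by
      have : B i k (Q i x) = A i k (Q i x) := by rw [hB, hQQ, sub_self, map_zero, add_zero]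
      exact this ▸ hBC i k _
    have hAC2 : ∀ i k x, A i (k + 1) (x - Q i x) ∈ C := fun i k x => by
      have : B i k (x - Q i x) = A i (k + 1) (x - Q i x) := by
        rw [hB, map_sub (Q i), hQQ, sub_self, map_zero, zero_add, sub_zero]
      exact this ▸ hBC i k _
    rw [← hVTM]
    refine Submodule.topologicalClosure_minimal _ (sup_le (iSup_le fun p => ?_)
      (iSup_le fun i => ?_)) hCc
    · rintro _ ⟨x, rfl⟩
      obtain ⟨⟨i, k⟩, rfl⟩ := Nat.pairEquiv.surjective p
      have h := C.add_mem (hAC1 i (k + 1) x) (hAC2 i k x)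
      rwa [← map_add, add_sub_cancel] at h
    · rintro _ ⟨x, rfl⟩
      have h := hAC1 i 0 x
      rwa [hAQ'] at h
  · change U (B _ _ (b k)) = B _ _ (b (k + 1))
    rw [← hBint, hb]

end Swindle

section CircleModel

/-- `L²(ℝ / ℤ)`. -/
noncomputable abbrev CircleL2 := Lp ℂ 2 (AddCircle.haarAddCircle (T := (1 : ℝ)))

theorem norm_fourier_apply (n : ℤ) (θ : UnitAddCircle) : ‖(fourier n θ : ℂ)‖ = 1 :=
  Circle.norm_coe _

/-- Multiplication by `e^{2π i θ}` on `L²(ℝ / ℤ)`. -/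
noncomputable def circleShift : CircleL2 ≃ₗᵢ[ℂ] CircleL2 :=
  weightedKoopman (MeasurableEquiv.refl _) (MeasurePreserving.id _) (fun θ => fourier 1 θ)
    (fourier 1).continuous.measurable (norm_fourier_apply 1)

/-- Translation by `α` on `L²(ℝ / ℤ)`. -/
noncomputable def circleRotation (α : UnitAddCircle) : CircleL2 ≃ₗᵢ[ℂ] CircleL2 :=
  weightedKoopman (MeasurableEquiv.addLeft α) (measurePreserving_add_left _ α) (fun _ => 1)
    measurable_const (fun _ => norm_one)

theorem circleShift_coeFn (f : CircleL2) :
    circleShift f =ᵐ[AddCircle.haarAddCircle] fun θ => fourier 1 θ * f θ :=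
  weightedKoopman_coeFn _ _ _ _ _ f

theorem circleRotation_coeFn (α : UnitAddCircle) (f : CircleL2) :
    circleRotation α f =ᵐ[AddCircle.haarAddCircle] fun θ => f (α + θ) := by
  filter_upwards [weightedKoopman_coeFn (MeasurableEquiv.addLeft α)
    (measurePreserving_add_left AddCircle.haarAddCircle α) (fun _ => 1)
    measurable_const (fun _ => norm_one) f] with θ h
  exact h.trans (one_mul _)

theorem fourier_mul_fourier (m n : ℤ) (θ : UnitAddCircle) :
    (fourier m θ : ℂ) * fourier n θ = fourier (m + n) θ := fourier_add.symm

theorem circleShift_zpow_coeFn (n : ℤ) (f : CircleL2) :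
    (circleShift ^ n) f =ᵐ[AddCircle.haarAddCircle] fun θ => fourier n θ * f θ := by
  induction n with
  | zero => exact ae_of_all _ fun θ => by simp
  | succ n ih =>
    rw [← zpow_succ_apply]
    filter_upwards [ih, circleShift_coeFn ((circleShift ^ (n : ℤ)) f)] with θ h1 h2
    rw [h2, h1, ← mul_assoc, fourier_mul_fourier, add_comm]
  | pred n ih =>
    have e : circleShift ((circleShift ^ (-(n : ℤ) - 1)) f) = (circleShift ^ (-(n : ℤ))) f := by
      rw [zpow_succ_apply, sub_add_cancel]
    have h3 := circleShift_coeFn ((circleShift ^ (-(n : ℤ) - 1)) f)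
    rw [e] at h3
    filter_upwards [ih, h3] with θ h1 h2
    have : (fourier (-1) θ : ℂ) * (fourier 1 θ * ((circleShift ^ (-(n : ℤ) - 1)) f : CircleL2) θ) =
        fourier (-1) θ * (fourier (-(n : ℤ)) θ * f θ) := by rw [← h2, h1]
    rw [← mul_assoc, ← mul_assoc, fourier_mul_fourier, fourier_mul_fourier] at this
    rwa [neg_add_cancel, fourier_zero, one_mul, neg_add_eq_sub] at this

theorem circleShift_fourierBasis (n : ℤ) :
    circleShift (fourierBasis n) = fourierBasis (n + 1) := by
  rw [coe_fourierBasis]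
  apply Lp.ext
  filter_upwards [circleShift_coeFn (fourierLp 2 n), coeFn_fourierLp (T := (1 : ℝ)) 2 n,
    coeFn_fourierLp (T := (1 : ℝ)) 2 (n + 1)] with θ h1 h2 h3
  rw [h1, h2, h3, fourier_mul_fourier, add_comm]

theorem fourierBasis_zero_coeFn :
    (fourierBasis (T := (1 : ℝ)) 0 : CircleL2) =ᵐ[AddCircle.haarAddCircle] fun _ => (1 : ℂ) := by
  rw [coe_fourierBasis]
  filter_upwards [coeFn_fourierLp (T := (1 : ℝ)) 2 0] with θ h
  rw [h, fourier_zero]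

/-- An operator on `L²(ℝ / ℤ)` that commutes with `e^{2π i θ}` is a multiplication operator. -/
theorem coeFn_of_commute_circleShift {C : CircleL2 →L[ℂ] CircleL2}
    (hC : Intertwines circleShift circleShift C) (f : CircleL2) :
    C f =ᵐ[AddCircle.haarAddCircle] fun θ => C (fourierBasis 0) θ * f θ := by
  set c : CircleL2 := C (fourierBasis 0) with hc
  have hspan : ∀ g ∈ Submodule.span ℂ (Set.range (fourierBasis (T := (1 : ℝ)))),
      C g =ᵐ[AddCircle.haarAddCircle] fun θ => c θ * g θ := by
    intro g hg
    induction hg using Submodule.span_induction with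
    | mem g hg =>
      obtain ⟨n, rfl⟩ := hg
      rw [basis_eq_zpow fourierBasis circleShift_fourierBasis n, hC.map_zpow, ← hc]
      filter_upwards [circleShift_zpow_coeFn n c, circleShift_zpow_coeFn n (fourierBasis 0),
        fourierBasis_zero_coeFn] with θ h1 h2 h3
      rw [h1, h2, h3, mul_one, mul_comm]
    | zero =>
      rw [map_zero]
      filter_upwards [Lp.coeFn_zero ℂ 2 (AddCircle.haarAddCircle (T := (1 : ℝ)))] with θ h
      rw [h, Pi.zero_apply, mul_zero]
    | add g g' _ _ h1 h2 =>
      rw [map_add]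
      filter_upwards [h1, h2, Lp.coeFn_add g g', Lp.coeFn_add (C g) (C g')] with θ a1 a2 a3 a4
      rw [a3, a4, Pi.add_apply, Pi.add_apply, a1, a2, mul_add]
    | smul r g _ h1 =>
      rw [map_smul]
      filter_upwards [h1, Lp.coeFn_smul r g, Lp.coeFn_smul r (C g)] with θ a1 a3 a4
      rw [a3, a4, Pi.smul_apply, Pi.smul_apply, a1, smul_eq_mul, smul_eq_mul]
      ring
  have hf : f ∈ closure (Submodule.span ℂ (Set.range (fourierBasis (T := (1 : ℝ)))) :
      Set CircleL2) := by
    rw [← Submodule.topologicalClosure_coe, fourierBasis.dense_span]; trivial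
  obtain ⟨g, hg, hgf⟩ := mem_closure_iff_seq_limit.1 hf
  obtain ⟨m, hm, hm'⟩ := (tendstoInMeasure_of_tendsto_Lp hgf).exists_seq_tendsto_ae
  have hCg : Tendsto (fun i => C (g (m i))) atTop (𝓝 (C f)) :=
    ((C.continuous.tendsto f).comp hgf).comp hm.tendsto_atTop
  obtain ⟨l, hl, hl'⟩ := (tendstoInMeasure_of_tendsto_Lp hCg).exists_seq_tendsto_ae
  have hall : ∀ᵐ θ ∂AddCircle.haarAddCircle, ∀ i, C (g i) θ = c θ * g i θ :=
    ae_all_iff.2 fun i => hspan _ (hg i)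
  filter_upwards [hm', hl', hall] with θ h1 h2 h3
  refine tendsto_nhds_unique h2 ?_
  simp only [h3]
  exact (h1.comp hl.tendsto_atTop).const_mul _

variable {H : Type*} [NormedAddCommGroup H] [InnerProductSpace ℂ H]

theorem inner_circleShift_zpow (h : CircleL2) (n : ℤ) :
    inner ℂ h ((circleShift ^ n) h) =
      ∫ θ, (fourier n θ : ℂ) ∂(AddCircle.haarAddCircle.withDensity fun θ => ‖h θ‖ₑ ^ 2) := by
  have hm : Measurable fun θ => ‖h θ‖ₑ ^ 2 :=
    (Lp.stronglyMeasurable h).measurable.enorm.pow_const 2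
  rw [L2.inner_def, integral_withDensity_eq_integral_toReal_smul hm
    (ae_of_all _ fun θ => ENNReal.pow_lt_top enorm_lt_top)]
  refine integral_congr_ae ?_
  filter_upwards [circleShift_zpow_coeFn n h] with θ e
  rw [e]
  simp only [RCLike.inner_apply, ENNReal.toReal_pow, toReal_enorm, Complex.real_smul]
  rw [mul_assoc, Complex.mul_conj, Complex.normSq_eq_norm_sq, mul_comm]

theorem withDensity_enorm_sq_univ (h : CircleL2) :
    (AddCircle.haarAddCircle.withDensity fun θ => ‖h θ‖ₑ ^ 2) Set.univ =
      ENNReal.ofReal (‖h‖ ^ 2) := by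
  rw [withDensity_apply _ MeasurableSet.univ, Measure.restrict_univ, Lp.norm_def,
    ← ENNReal.toReal_pow, ENNReal.ofReal_toReal (ENNReal.pow_ne_top (Lp.eLpNorm_ne_top h)),
    eLpNorm_eq_lintegral_rpow_enorm_toReal two_ne_zero ENNReal.ofNat_ne_top]
  rw [← ENNReal.rpow_natCast, ← ENNReal.rpow_mul]
  simp

theorem exists_spectralMeasure [CompleteSpace H] {U : H ≃ₗᵢ[ℂ] H} {T : ℕ → CircleL2 →L[ℂ] H}
    (hT : ∀ i, Intertwines circleShift U (T i)) {f : H}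
    (hf : f ∈ (⨆ i, LinearMap.range (T i).toLinearMap).topologicalClosure) :
    ∃ σ : Measure UnitAddCircle, IsSpectralMeasure U f σ ∧ σ ≪ AddCircle.haarAddCircle := by
  obtain ⟨V, hV, hVo, -, hVT⟩ := exists_orthogonal_intertwiners (Z := (⊥ : Submodule ℂ H))
    (U := U) (by simp) hT
  rw [bot_sup_eq, bot_sup_eq] at hVT
  rw [← hVT] at hf
  let V' := fun i => ContinuousLinearMap.adjoint (V i)
  have hVV' : ∀ i x, V' i (V i (V' i x)) = V' i x := fun i x => by
    refine ext_inner_right ℂ fun z => ?_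
    calc inner ℂ (V' i (V i (V' i x))) z = inner ℂ (V i (V' i x)) (V i z) :=
          ContinuousLinearMap.adjoint_inner_left _ _ _
      _ = inner ℂ (V' i x) (V' i (V i z)) := (ContinuousLinearMap.adjoint_inner_right _ _ _).symm
      _ = inner ℂ x (V i (V' i (V i z))) := ContinuousLinearMap.adjoint_inner_left _ _ _
      _ = inner ℂ x (V i z) := congrArg _ ((hV i).apply_idem z)
      _ = inner ℂ (V' i x) z := (ContinuousLinearMap.adjoint_inner_left _ _ _).symm
  have hVV0 : ∀ i j x, i ≠ j → V' i (V j x) = 0 := fun i j x hij => by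
    refine ext_inner_left ℂ fun z => ?_
    rw [ContinuousLinearMap.adjoint_inner_right, hVo i j hij, inner_zero_right]
  let P : ℕ → H →L[ℂ] H := fun N => ∑ i ∈ Finset.range N, V i ∘L V' i
  have hP : ∀ N x, P N x = ∑ i ∈ Finset.range N, V i (V' i x) := fun N x => by
    simp [P]
  have hP1 : ∀ N x, inner ℂ (P N x) x = ((∑ i ∈ Finset.range N, ‖V' i x‖ ^ 2 : ℝ) : ℂ) := by
    intro N x
    rw [hP, sum_inner]
    push_cast
    refine Finset.sum_congr rfl fun i _ => ?_
    rw [← ContinuousLinearMap.adjoint_inner_right, inner_self_eq_norm_sq_to_K]; rfl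
  have hP2 : ∀ N x, inner ℂ (P N x) (P N x) = inner ℂ (P N x) x := by
    intro N x
    rw [hP, sum_inner, sum_inner]
    refine Finset.sum_congr rfl fun i hi => ?_
    rw [inner_sum, Finset.sum_eq_single_of_mem i hi fun j _ hj => hVo i j hj.symm _ _,
      ← ContinuousLinearMap.adjoint_inner_right, ← ContinuousLinearMap.adjoint_inner_right (V i)]
    exact congrArg _ (hVV' i x)
  have hP3 : ∀ N x, ‖P N x‖ ≤ ‖x‖ := by
    intro N x
    have h1 : ‖P N x‖ * ‖P N x‖ ≤ ‖P N x‖ * ‖x‖ := by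
      have h2 : ‖P N x‖ * ‖P N x‖ = ‖inner ℂ (P N x) (P N x)‖ := by
        rw [inner_self_eq_norm_sq_to_K, ← sq]; simp
      rw [h2, hP2]
      exact norm_inner_le_norm _ _
    rcases (norm_nonneg (P N x)).eq_or_lt with h | h
    · rw [← h]; exact norm_nonneg _
    · exact le_of_mul_le_mul_left h1 h
  have hB : ∀ N, ∑ i ∈ Finset.range N, ‖V' i f‖ ^ 2 ≤ ‖f‖ ^ 2 := fun N => by
    have h1 : ‖inner ℂ (P N f) f‖ ≤ ‖f‖ * ‖f‖ :=
      (norm_inner_le_norm _ _).trans (mul_le_mul_of_nonneg_right (hP3 N f) (norm_nonneg _))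
    rw [hP1, Complex.norm_real,
      Real.norm_of_nonneg (Finset.sum_nonneg fun i _ => sq_nonneg _)] at h1
    rwa [sq ‖f‖]
  have hlim : Tendsto (fun N => P N f) atTop (𝓝 f) := by
    have hspan : ∀ x ∈ ⨆ i, LinearMap.range (V i).toLinearMap,
        Tendsto (fun N => P N x) atTop (𝓝 x) := by
      intro x hx
      induction hx using Submodule.iSup_induction' with
      | mem i x hx =>
        obtain ⟨z, rfl⟩ := hx
        refine tendsto_const_nhds.congr' ?_
        filter_upwards [eventually_gt_atTop i] with N hN
        rw [hP, Finset.sum_eq_single_of_mem i (Finset.mem_range.2 hN)]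
        · exact ((hV i).apply_idem z).symm
        · intro j _ hj
          change V j (V' j (V i z)) = 0
          rw [hVV0 j i z hj, map_zero]
      | zero => simp
      | add x z _ _ h1 h2 => simpa only [map_add] using h1.add h2
    rw [Metric.tendsto_atTop]
    intro ε hε
    have hf' : f ∈ closure ((⨆ i, LinearMap.range (V i).toLinearMap : Submodule ℂ H) : Set H) := by
      rwa [← Submodule.topologicalClosure_coe]
    obtain ⟨x, hx, hfx⟩ := Metric.mem_closure_iff.1 hf' (ε / 3) (by positivity)
    obtain ⟨N, hN⟩ := Metric.tendsto_atTop.1 (hspan x hx) (ε / 3) (by positivity)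
    refine ⟨N, fun n hn => ?_⟩
    have h1 : dist (P n f) (P n x) ≤ dist f x := by
      rw [dist_eq_norm, dist_eq_norm, ← map_sub]; exact hP3 n _
    calc dist (P n f) f ≤ dist (P n f) (P n x) + dist (P n x) x + dist x f := dist_triangle4 _ _ _ _
      _ < ε := by rw [dist_comm x f]; linarith [hN n hn]
  let σ : ℕ → Measure UnitAddCircle := fun i =>
    AddCircle.haarAddCircle.withDensity fun θ => ‖V' i f θ‖ₑ ^ 2
  have hsum : Summable fun i => ‖V' i f‖ ^ 2 :=
    summable_of_sum_range_le (fun i => sq_nonneg _) hB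
  have hfin : IsFiniteMeasure (Measure.sum σ) := by
    refine ⟨?_⟩
    rw [Measure.sum_apply _ MeasurableSet.univ]
    simp only [σ, withDensity_enorm_sq_univ]
    exact hsum.tsum_ofReal_lt_top
  refine ⟨Measure.sum σ, ⟨hfin, fun n => ?_⟩, ?_⟩
  · have hint : Integrable (fun θ => (fourier n θ : ℂ)) (Measure.sum σ) :=
      Integrable.of_bound (fourier n).continuous.aestronglyMeasurable 1
        (ae_of_all _ fun θ => (norm_fourier_apply n θ).le)
    have h1 := (hasSum_integral_measure hint).tendsto_sum_nat
    refine tendsto_nhds_unique h1 ?_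
    have h2 : Tendsto (fun N => inner ℂ (P N f) ((U ^ n) f)) atTop (𝓝 (inner ℂ f ((U ^ n) f))) :=
      hlim.inner tendsto_const_nhds
    refine h2.congr fun N => ?_
    rw [hP, sum_inner]
    refine Finset.sum_congr rfl fun i _ => ?_
    rw [← ContinuousLinearMap.adjoint_inner_right, (hV i).intertwines.adjoint.map_zpow,
      inner_circleShift_zpow]
  · exact Measure.absolutelyContinuous_sum_left fun i => withDensity_absolutelyContinuous _ _

theorem isSpectralMeasure_haarAddCircle {U : H ≃ₗᵢ[ℂ] H} {J : CircleL2 →L[ℂ] H}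
    (hJ : Intertwines circleShift U J) (hJJ : ∀ x z, inner ℂ (J x) (J z) = inner ℂ x z) :
    IsSpectralMeasure U (J (fourierBasis 0)) AddCircle.haarAddCircle := by
  refine ⟨inferInstance, fun n => ?_⟩
  rw [← hJ.map_zpow, hJJ, L2.inner_def]
  refine integral_congr_ae ?_
  filter_upwards [circleShift_zpow_coeFn n (fourierBasis 0), fourierBasis_zero_coeFn] with θ h1 h2
  rw [h1, h2]
  simp

end CircleModel

section Wandering

variable {K H : Type*} [NormedAddCommGroup K] [InnerProductSpace ℂ K]
  [NormedAddCommGroup H] [InnerProductSpace ℂ H]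

theorem exists_isometric_intertwiner [CompleteSpace H] {S : K ≃ₗᵢ[ℂ] K}
    (b : HilbertBasis ℤ ℂ K) (hb : ∀ n, S (b n) = b (n + 1)) {U : H ≃ₗᵢ[ℂ] H} {w : H}
    (hw : ∀ n : ℤ, inner ℂ w ((U ^ n) w) = if n = 0 then 1 else 0) :
    ∃ J : K →L[ℂ] H, Intertwines S U J ∧ ∀ x z, inner ℂ (J x) (J z) = inner ℂ x z := by
  classical
  have ho : Orthonormal ℂ fun n : ℤ => (U ^ n) w := by
    rw [orthonormal_iff_ite]
    intro m n
    have e : (U ^ n) w = (U ^ m) ((U ^ (n - m)) w) := by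
      rw [← linearIsometryEquiv_mul_apply, ← zpow_add, add_sub_cancel]
    rw [e, LinearIsometryEquiv.inner_map_map, hw]
    simp [sub_eq_zero, eq_comm]
  let J : K →ₗᵢ[ℂ] H := ho.orthogonalFamily.linearIsometry.comp b.repr.toLinearIsometry
  have hJb : ∀ n, J (b n) = (U ^ n) w := fun n => by
    change ho.orthogonalFamily.linearIsometry (b.repr (b n)) = _
    rw [b.repr_self, OrthogonalFamily.linearIsometry_apply_single]
    simp
  refine ⟨J.toContinuousLinearMap, ?_, J.inner_map_map⟩
  have hd : Dense (Submodule.span ℂ (Set.range b) : Set K) := by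
    rw [Submodule.dense_iff_topologicalClosure_eq_top]
    exact b.dense_span
  have hext := ContinuousLinearMap.ext_on hd
    (f := J.toContinuousLinearMap ∘L (S.toContinuousLinearEquiv : K →L[ℂ] K))
    (g := (U.toContinuousLinearEquiv : H →L[ℂ] H) ∘L J.toContinuousLinearMap) (by
      rintro _ ⟨n, rfl⟩
      change J (S (b n)) = U (J (b n))
      rw [hb, hJb, hJb, zpow_succ_apply])
  exact fun x => DFunLike.congr_fun hext x

theorem circleRotation_symm (α : UnitAddCircle) (f : CircleL2) :
    (circleRotation α).symm f = circleRotation (-α) f := by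
  rw [LinearIsometryEquiv.symm_apply_eq]
  apply Lp.ext
  have h := (measurePreserving_add_left AddCircle.haarAddCircle α).quasiMeasurePreserving.ae
    (circleRotation_coeFn (-α) f)
  filter_upwards [h, circleRotation_coeFn α (circleRotation (-α) f)] with θ h1 h2
  rw [h2, h1, neg_add_cancel_left]

theorem circleRotation_circleShift (α : UnitAddCircle) (f : CircleL2) :
    circleRotation α (circleShift f) =
      (fourier 1 α : ℂ) • circleShift (circleRotation α f) := by
  apply Lp.ext
  have h := (measurePreserving_add_left AddCircle.haarAddCircle α).quasiMeasurePreserving.ae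
    (circleShift_coeFn f)
  filter_upwards [h, circleRotation_coeFn α (circleShift f), circleRotation_coeFn α f,
    circleShift_coeFn (circleRotation α f),
    Lp.coeFn_smul (fourier 1 α : ℂ) (circleShift (circleRotation α f))] with θ h1 h2 h3 h4 h5
  rw [h2, h1, h5, Pi.smul_apply, h4, h3, smul_eq_mul, ← mul_assoc]
  congr 1
  simp only [fourier_one, AddCircle.toCircle_add, Circle.coe_mul]

theorem circleRotation_fourierBasis_zero (α : UnitAddCircle) :
    circleRotation α (fourierBasis 0) = fourierBasis 0 := by
  apply Lp.ext
  have h := (measurePreserving_add_left AddCircle.haarAddCircle α).quasiMeasurePreserving.ae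
    fourierBasis_zero_coeFn
  filter_upwards [h, circleRotation_coeFn α (fourierBasis 0), fourierBasis_zero_coeFn]
    with θ h1 h2 h3
  rw [h2, h1, h3]

theorem ae_mem_iUnion_translates {α : UnitAddCircle} (hα : addOrderOf α = 0)
    {A : Set UnitAddCircle} (hA : MeasurableSet A) (hA0 : AddCircle.haarAddCircle A ≠ 0) :
    ∀ᵐ θ ∂AddCircle.haarAddCircle, ∃ k : ℕ, -(k • α) + θ ∈ A := by
  have hvol : (volume : Measure UnitAddCircle) = AddCircle.haarAddCircle := by
    rw [AddCircle.volume_eq_smul_haarAddCircle, ENNReal.ofReal_one, one_smul]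
  have herg : Ergodic (fun θ : UnitAddCircle => -α + θ) AddCircle.haarAddCircle := by
    rw [← hvol, AddCircle.ergodic_add_left, addOrderOf_neg, hα]
  set E : Set UnitAddCircle := ⋃ k : ℕ, (fun θ => -(k • α) + θ) ⁻¹' A with hE
  have hEm : MeasurableSet E :=
    MeasurableSet.iUnion fun k => (measurable_const_add _) hA
  have hsub : (fun θ => -α + θ) ⁻¹' E ⊆ E := by
    rintro θ hθ
    obtain ⟨k, hk⟩ := Set.mem_iUnion.1 hθ
    refine Set.mem_iUnion.2 ⟨k + 1, ?_⟩
    have : -((k + 1) • α) + θ = -(k • α) + (-α + θ) := by rw [succ_nsmul]; abel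
    simpa only [Set.mem_preimage, this] using hk
  have hAE : A ⊆ E := fun θ hθ => Set.mem_iUnion.2 ⟨0, by simpa using hθ⟩
  rcases herg.ae_empty_or_univ_of_preimage_ae_le hEm.nullMeasurableSet
    (LE.le.eventuallyLE hsub) with h | h
  · exact absurd (measure_mono_null hAE (ae_eq_empty.1 h)) hA0
  · filter_upwards [h] with θ hθ
    have : θ ∈ E := by
      have h' : (θ ∈ E) = (θ ∈ Set.univ) := hθ
      rw [h']; trivial
    exact Set.mem_iUnion.1 this

theorem summable_of_orthogonal [CompleteSpace H] {v : ℕ → H}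
    (ho : ∀ i j, i ≠ j → inner ℂ (v i) (v j) = 0)
    (hs : Summable fun i => ‖v i‖ ^ 2) : Summable v := by
  have hfam : OrthogonalFamily ℂ (fun i => ↥(ℂ ∙ v i)) fun i => (ℂ ∙ v i).subtypeₗᵢ := by
    intro i j hij x z
    obtain ⟨a, ha⟩ := Submodule.mem_span_singleton.1 x.2
    obtain ⟨c, hc⟩ := Submodule.mem_span_singleton.1 z.2
    change inner ℂ (x : H) (z : H) = 0
    rw [← ha, ← hc, inner_smul_left, inner_smul_right, ho i j hij, mul_zero, mul_zero]
  exact (hfam.summable_iff_norm_sq_summable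
    fun i => (⟨v i, Submodule.mem_span_singleton_self _⟩ : ℂ ∙ v i)).2 hs

theorem Intertwines.rotate {U : H ≃ₗᵢ[ℂ] H} {V : CircleL2 →L[ℂ] H}
    (hV : Intertwines circleShift U V) {β : UnitAddCircle}
    {κ : H ≃ₗᵢ[ℂ] H}
    (hκ : ∀ x, U (κ x) = (fourier 1 β : ℂ) • κ (U x)) {V' : CircleL2 →L[ℂ] H}
    (hV' : ∀ x, V' x = κ (V (circleRotation β x))) : Intertwines circleShift U V' := fun x => by
  rw [hV', hV', hκ, circleRotation_circleShift, map_smul, hV, map_smul]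

theorem adjoint_apply_rotate [CompleteSpace H] {V V' : CircleL2 →L[ℂ] H} {β : UnitAddCircle}
    {κ : H ≃ₗᵢ[ℂ] H}
    (hV' : ∀ x, V' x = κ (V (circleRotation β x))) :
    ContinuousLinearMap.adjoint V' (V' (fourierBasis 0)) =
      circleRotation (-β) (ContinuousLinearMap.adjoint V (V (fourierBasis 0))) := by
  refine ext_inner_left ℂ fun x => ?_
  rw [ContinuousLinearMap.adjoint_inner_right, hV', hV', LinearIsometryEquiv.inner_map_map,
    circleRotation_fourierBasis_zero, ← ContinuousLinearMap.adjoint_inner_right,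
    ← circleRotation_symm, ← inner_map_eq_inner_symm]

theorem exists_isometric_intertwiner_of_cover [CompleteSpace H] {U : H ≃ₗᵢ[ℂ] H}
    {V' : ℕ → CircleL2 →L[ℂ] H}
    (hV' : ∀ k, Intertwines circleShift U (V' k)) {A' : ℕ → Set UnitAddCircle}
    (hAm : ∀ k, MeasurableSet (A' k))
    (hcover : ∀ᵐ θ ∂AddCircle.haarAddCircle, θ ∈ ⋃ k, A' k)
    (hCk : ∀ k, ∀ᵐ θ ∂AddCircle.haarAddCircle, θ ∈ A' k →
      ContinuousLinearMap.adjoint (V' k) (V' k (fourierBasis 0)) θ = 1) :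
    ∃ J : CircleL2 →L[ℂ] H, Intertwines circleShift U J ∧
      ∀ x z, inner ℂ (J x) (J z) = inner ℂ x z := by
  let C : ℕ → ℕ → CircleL2 →L[ℂ] CircleL2 := fun j k => ContinuousLinearMap.adjoint (V' j) ∘L V' k
  have hC : ∀ j k, Intertwines circleShift circleShift (C j k) := fun j k =>
    (hV' j).adjoint.comp (hV' k)
  let B : ℕ → Set UnitAddCircle := disjointed A'
  have hBA : ∀ k, B k ⊆ A' k := disjointed_subset A'
  have hBd : Pairwise fun i j => Disjoint (B i) (B j) := disjoint_disjointed A'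
  have hBm : ∀ k, MeasurableSet (B k) := fun k =>
    MeasurableSet.disjointed hAm k
  have hBU : ∀ᵐ θ ∂AddCircle.haarAddCircle, θ ∈ ⋃ k, B k := by
    rw [iUnion_disjointed]
    exact hcover
  let e : ℕ → CircleL2 := fun k =>
    indicatorConstLp 2 (hBm k) (measure_ne_top AddCircle.haarAddCircle _) (1 : ℂ)
  let v : ℕ → H := fun k => V' k (e k)
  have hvv : ∀ j k (n : ℤ), inner ℂ (v j) ((U ^ n) (v k)) =
      ∫ θ in B j, C j k (fourierBasis 0) θ * (fourier n θ * e k θ) ∂AddCircle.haarAddCircle := by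
    intro j k n
    have e1 : inner ℂ (v j) ((U ^ n) (v k)) = inner ℂ (e j) (C j k ((circleShift ^ n) (e k))) := by
      rw [← (hV' k).map_zpow]
      exact (ContinuousLinearMap.adjoint_inner_right _ _ _).symm
    rw [e1, L2.inner_indicatorConstLp_one]
    refine integral_congr_ae (ae_restrict_of_ae ?_)
    filter_upwards [coeFn_of_commute_circleShift (hC j k) ((circleShift ^ n) (e k)),
      circleShift_zpow_coeFn n (e k)] with θ h1 h2
    rw [h1, h2]
  have hvo : ∀ j k (n : ℤ), j ≠ k → inner ℂ (v j) ((U ^ n) (v k)) = 0 := by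
    intro j k n hjk
    rw [hvv]
    refine integral_eq_zero_of_ae ?_
    rw [Filter.EventuallyEq, ae_restrict_iff' (hBm j)]
    filter_upwards [indicatorConstLp_coeFn (p := 2) (hs := hBm k)
      (hμs := measure_ne_top AddCircle.haarAddCircle _) (c := (1 : ℂ))] with θ h1 h2
    have h3 : e k θ = 0 := by
      rw [h1, Set.indicator_of_notMem]
      exact fun h4 => Set.disjoint_left.1 (hBd hjk) h2 h4
    rw [h3, mul_zero, mul_zero, Pi.zero_apply]
  have hvd : ∀ k (n : ℤ), inner ℂ (v k) ((U ^ n) (v k)) =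
      ∫ θ in B k, (fourier n θ : ℂ) ∂AddCircle.haarAddCircle := by
    intro k n
    rw [hvv]
    refine integral_congr_ae ?_
    rw [Filter.EventuallyEq, ae_restrict_iff' (hBm k)]
    filter_upwards [indicatorConstLp_coeFn (p := 2) (hs := hBm k)
      (hμs := measure_ne_top AddCircle.haarAddCircle _) (c := (1 : ℂ)), hCk k] with θ h1 h2 h3
    have h4 : e k θ = 1 := by rw [h1, Set.indicator_of_mem h3]
    have h5 : C k k (fourierBasis 0) θ = 1 := h2 (hBA k h3)
    rw [h4, h5, one_mul, mul_one]
  have hint : ∀ n : ℤ, HasSum (fun k => inner ℂ (v k) ((U ^ n) (v k)))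
      (∫ θ, (fourier n θ : ℂ) ∂AddCircle.haarAddCircle (T := (1 : ℝ))) := by
    intro n
    simp only [hvd]
    have h1 := hasSum_integral_iUnion (μ := AddCircle.haarAddCircle) hBm hBd
      (f := fun θ : UnitAddCircle => (fourier n θ : ℂ))
      (Integrable.integrableOn (Integrable.of_bound (fourier n).continuous.aestronglyMeasurable 1
        (ae_of_all _ fun θ => (norm_fourier_apply n θ).le)))
    rwa [Measure.restrict_eq_self_of_ae_mem hBU] at h1
  have hnorm : Summable fun k => ‖v k‖ ^ 2 := by
    have h1 := (hint 0).summable.norm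
    refine h1.congr fun k => ?_
    rw [zpow_zero, LinearIsometryEquiv.coe_one, id, inner_self_eq_norm_sq_to_K]
    simp
  have hsum : Summable v := summable_of_orthogonal (fun i j hij => by
    simpa using hvo i j 0 hij) hnorm
  obtain ⟨w, hw⟩ := hsum
  refine exists_isometric_intertwiner (w := w) fourierBasis circleShift_fourierBasis fun n => ?_
  have h1 : ∀ k, inner ℂ (v k) ((U ^ n) w) = inner ℂ (v k) ((U ^ n) (v k)) := by
    intro k
    have h2 : HasSum (fun j => inner ℂ (v k) ((U ^ n) (v j))) (inner ℂ (v k) ((U ^ n) w)) := by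
      have := (innerSL ℂ (v k)).hasSum (((U ^ n).toContinuousLinearEquiv : H →L[ℂ] H).hasSum hw)
      exact this
    exact h2.unique (hasSum_single k fun j hj => hvo k j n hj.symm)
  have h3 : HasSum (fun k => inner ℂ (v k) ((U ^ n) w)) (inner ℂ w ((U ^ n) w)) := by
    have h4 := (innerSL ℂ ((U ^ n) w)).hasSum hw
    have h5 := h4.star
    simpa only [Function.comp_def, innerSL_apply_apply, RCLike.star_def, inner_conj_symm] using h5
  simp only [h1] at h3
  rw [h3.unique (hint n)]
  have h6 := (orthonormal_iff_ite.1 (orthonormal_fourier (T := (1 : ℝ)))) 0 n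
  rw [L2.inner_def] at h6
  rw [show (if n = 0 then (1 : ℂ) else 0) = if (0 : ℤ) = n then 1 else 0 by simp [eq_comm], ← h6]
  refine integral_congr_ae ?_
  filter_upwards [coeFn_fourierLp (T := (1 : ℝ)) 2 0, coeFn_fourierLp (T := (1 : ℝ)) 2 n]
    with θ h7 h8
  rw [h7, h8]
  simp

theorem exists_isometric_intertwiner_of_rotation [CompleteSpace H] {U : H ≃ₗᵢ[ℂ] H}
    {T : CircleL2 →L[ℂ] H}
    (hT : Intertwines circleShift U T) (hT0 : T ≠ 0) {α : UnitAddCircle} (hα : addOrderOf α = 0)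
    (κ : ℕ → H ≃ₗᵢ[ℂ] H) (hκ : ∀ k x, U (κ k x) = (fourier 1 (k • α) : ℂ) • κ k (U x)) :
    ∃ J : CircleL2 →L[ℂ] H, Intertwines circleShift U J ∧
      ∀ x z, inner ℂ (J x) (J z) = inner ℂ x z := by
  obtain ⟨V, hV, hTV, -⟩ := hT.exists_polar
  have hV0 : V ≠ 0 := by
    rintro rfl
    refine hT0 (ContinuousLinearMap.ext fun x => ?_)
    obtain ⟨z, hz⟩ := hTV ⟨x, rfl⟩
    exact hz.symm
  set Q : CircleL2 →L[ℂ] CircleL2 := ContinuousLinearMap.adjoint V ∘L V with hQ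
  have hQS : Intertwines circleShift circleShift Q := hV.intertwines.adjoint.comp hV.intertwines
  set c : CircleL2 := Q (fourierBasis 0) with hc
  have hcc : ∀ᵐ θ ∂AddCircle.haarAddCircle, c θ = c θ * c θ := by
    have h1 := coeFn_of_commute_circleShift hQS c
    have h2 : Q c = c := hV.idem _
    rw [h2] at h1
    exact h1
  set A : Set UnitAddCircle := {θ | c θ ≠ 0} with hA
  have hAm : MeasurableSet A :=
    ((measurableSet_singleton (0 : ℂ)).preimage (Lp.stronglyMeasurable c).measurable).compl
  have hA0 : AddCircle.haarAddCircle A ≠ 0 := by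
    intro h0
    have hc0 : c =ᵐ[AddCircle.haarAddCircle] 0 := by
      rw [Filter.EventuallyEq, ae_iff]
      exact h0
    refine hV0 (ContinuousLinearMap.ext fun x => ?_)
    have hQx : Q x = 0 := by
      apply Lp.ext
      filter_upwards [hc0, coeFn_of_commute_circleShift hQS x,
        Lp.coeFn_zero ℂ 2 (AddCircle.haarAddCircle (T := (1 : ℝ)))] with θ h1 h2 h3
      rw [h2, h3, ← hc, h1, Pi.zero_apply, zero_mul]
    rw [← hV.apply_idem x]
    exact (congrArg V hQx).trans (map_zero V)
  have hcover := ae_mem_iUnion_translates hα hAm hA0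
  let V' : ℕ → CircleL2 →L[ℂ] H := fun k =>
    ((κ k).toContinuousLinearEquiv : H →L[ℂ] H) ∘L V ∘L
      ((circleRotation (k • α)).toContinuousLinearEquiv : CircleL2 →L[ℂ] CircleL2)
  have hV'a : ∀ k x, V' k x = κ k (V (circleRotation (k • α) x)) := fun _ _ => rfl
  refine exists_isometric_intertwiner_of_cover
    (A' := fun k => (fun θ => -(k • α) + θ) ⁻¹' A)
    (fun k => hV.intertwines.rotate (hκ k) (hV'a k))
    (fun k => (measurable_const_add _) hAm) ?_ fun k => ?_
  · filter_upwards [hcover] with θ hθ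
    exact Set.mem_iUnion.2 hθ
  · rw [adjoint_apply_rotate (hV'a k)]
    have h2 := (measurePreserving_add_left AddCircle.haarAddCircle
      (-(k • α))).quasiMeasurePreserving.ae hcc
    filter_upwards [circleRotation_coeFn (-(k • α)) c, h2] with θ h3 h4 h5
    refine Eq.trans h3 ?_
    have h6 : c (-(k • α) + θ) ≠ 0 := h5
    exact (mul_right_cancel₀ h6 (by rw [one_mul]; exact h4)).symm

end Wandering

section PhaseDerivative

theorem lintegral_enorm_sq {X : Type*} [MeasurableSpace X] {μ : Measure X} {E : Type*}
    [NormedAddCommGroup E] (g : X → E) :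
    ∫⁻ x, ‖g x‖ₑ ^ 2 ∂μ = eLpNorm g 2 μ ^ 2 := by
  rw [eLpNorm_eq_lintegral_rpow_enorm_toReal two_ne_zero ENNReal.ofNat_ne_top]
  rw [← ENNReal.rpow_natCast, ← ENNReal.rpow_mul]
  simp

variable {X : Type*} [CommGroup X] [MeasurableSpace X]

/-- Along the flow `F_t x = y_t x`, the function `w` satisfies `w ∘ F_t = w · e^{i t q_t}` with
real functions `q_t` that converge to `S` in `L²` as `t → 0+`. -/
def HasPhaseDeriv (μ : Measure X) (y : ℝ → X) (w : X → ℂ) (S : X → ℝ) : Prop :=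
  ∃ q : ℝ → X → ℝ, (∀ t, AEStronglyMeasurable (q t) μ) ∧
    (∀ t, 0 < t → ∀ᵐ x ∂μ, w (y t * x) = w x * Complex.exp (Complex.I * ((t * q t x : ℝ) : ℂ))) ∧
    Tendsto (fun t => eLpNorm (fun x => q t x - S x) 2 μ) (𝓝[>] 0) (𝓝 0)

namespace HasPhaseDeriv

variable {μ : Measure X} {y : ℝ → X} {w w' : X → ℂ} {S S' : X → ℝ}

theorem mul (hS : AEStronglyMeasurable S μ) (hS' : AEStronglyMeasurable S' μ)
    (hw : HasPhaseDeriv μ y w S) (hw' : HasPhaseDeriv μ y w' S') :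
    HasPhaseDeriv μ y (fun x => w x * w' x) (fun x => S x + S' x) := by
  obtain ⟨q, hq, hqw, hqS⟩ := hw
  obtain ⟨q', hq', hqw', hqS'⟩ := hw'
  refine ⟨fun t x => q t x + q' t x, fun t => (hq t).add (hq' t), fun t ht => ?_, ?_⟩
  · filter_upwards [hqw t ht, hqw' t ht] with x h1 h2
    rw [h1, h2, mul_mul_mul_comm, ← Complex.exp_add]
    congr 2
    push_cast
    ring
  · have h := hqS.add hqS'
    rw [add_zero] at h
    refine tendsto_of_tendsto_of_tendsto_of_le_of_le tendsto_const_nhds h (fun _ => zero_le)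
      fun t => ?_
    have e : (fun x => q t x + q' t x - (S x + S' x)) =
        (fun x => q t x - S x) + fun x => q' t x - S' x := by
      ext x; simp only [Pi.add_apply]; ring
    rw [e]
    exact eLpNorm_add_le ((hq t).sub hS) ((hq' t).sub hS') one_le_two

theorem comp_mul_left [MeasurableMul X] [μ.IsMulLeftInvariant] (hS : AEStronglyMeasurable S μ)
    (hw : HasPhaseDeriv μ y w S) (a : X) :
    HasPhaseDeriv μ y (fun x => w (a * x)) (fun x => S (a * x)) := by
  obtain ⟨q, hq, hqw, hqS⟩ := hw
  have ha := measurePreserving_mul_left μ a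
  refine ⟨fun t x => q t (a * x), fun t => (hq t).comp_measurePreserving ha, fun t ht => ?_, ?_⟩
  · filter_upwards [ha.quasiMeasurePreserving.ae (hqw t ht)] with x h1
    rw [← h1, mul_left_comm]
  · refine hqS.congr fun t => ?_
    exact (eLpNorm_comp_measurePreserving ((hq t).sub hS) ha).symm

theorem one : HasPhaseDeriv μ y (fun _ => 1) (fun _ => 0) :=
  ⟨fun _ _ => 0, fun _ => aestronglyMeasurable_const, fun _ _ => ae_of_all _ fun _ => by simp,
    by simp⟩

theorem prod [MeasurableMul X] [μ.IsMulLeftInvariant] {n : ℕ} (a : ℕ → X) (hS : Measurable S)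
    (hw : HasPhaseDeriv μ y w S) :
    HasPhaseDeriv μ y (fun x => ∏ k ∈ Finset.range n, w (a k * x))
      (fun x => ∑ k ∈ Finset.range n, S (a k * x)) := by
  induction n with
  | zero => simpa using one
  | succ n ih =>
    simp only [Finset.prod_range_succ, Finset.sum_range_succ]
    refine ih.mul ?_ ?_ (hw.comp_mul_left hS.aestronglyMeasurable (a n))
    · exact (Finset.measurable_fun_sum _ fun k _ =>
        hS.comp (measurable_const_mul (a k))).aestronglyMeasurable
    · exact (hS.comp (measurable_const_mul (a n))).aestronglyMeasurable

end HasPhaseDeriv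

theorem norm_exp_I_mul_sub_one_sub_le (a : ℝ) :
    ‖Complex.exp (Complex.I * (a : ℂ)) - 1 - Complex.I * a‖ ≤ 2 * a ^ 2 := by
  rcases le_or_gt |a| 1 with h | h
  · have h1 : ‖Complex.I * (a : ℂ)‖ = |a| := by simp
    have h2 := Complex.norm_exp_sub_one_sub_id_le (x := Complex.I * a) (by rwa [h1])
    rw [h1, sq_abs] at h2
    nlinarith [sq_nonneg a]
  · have h1 : ‖Complex.I * (a : ℂ)‖ = |a| := by simp
    have h2 := Real.norm_exp_I_mul_ofReal_sub_one_le (x := a)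
    have h3 := norm_sub_le (Complex.exp (Complex.I * (a : ℂ)) - 1) (Complex.I * a)
    rw [h1] at h3
    rw [Real.norm_eq_abs] at h2
    nlinarith [sq_abs a]

variable {μ : Measure X} {y : ℝ → X} {w : X → ℂ} {S : X → ℝ}

theorem HasPhaseDeriv.tendsto_eLpNorm_one [IsProbabilityMeasure μ] (hw : HasPhaseDeriv μ y w S)
    (hw1 : ∀ x, ‖w x‖ = 1) (hS : AEStronglyMeasurable S μ) {B : ℝ} (hSB : ∀ x, |S x| ≤ B) :
    Tendsto (fun t : ℝ => eLpNorm (fun x => (w (y t * x) - w x) / (t : ℂ) -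
      Complex.I * S x * w x) 1 μ) (𝓝[>] 0) (𝓝 0) := by
  obtain ⟨q, hq, hqw, hqS⟩ := hw
  set ε : ℝ → ℝ≥0∞ := fun t => eLpNorm (fun x => q t x - S x) 2 μ with hε
  have hlim : Tendsto (fun t : ℝ => ENNReal.ofReal (4 * t * B ^ 2) +
      (ENNReal.ofReal (4 * t) * ε t ^ 2 + ε t)) (𝓝[>] 0) (𝓝 0) := by
    have h4 : Tendsto (fun t : ℝ => ENNReal.ofReal (4 * t * B ^ 2)) (𝓝[>] 0) (𝓝 0) := by
      have : Tendsto (fun t : ℝ => ENNReal.ofReal (4 * t * B ^ 2)) (𝓝 0)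
          (𝓝 (ENNReal.ofReal (4 * 0 * B ^ 2))) :=
        ENNReal.tendsto_ofReal (Continuous.tendsto (by fun_prop) 0)
      simp only [mul_zero, zero_mul, ENNReal.ofReal_zero] at this
      exact this.mono_left nhdsWithin_le_nhds
    have h5 : Tendsto (fun t : ℝ => ENNReal.ofReal (4 * t)) (𝓝[>] 0) (𝓝 0) := by
      have : Tendsto (fun t : ℝ => ENNReal.ofReal (4 * t)) (𝓝 0) (𝓝 (ENNReal.ofReal (4 * 0))) :=
        ENNReal.tendsto_ofReal (Continuous.tendsto (by fun_prop) 0)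
      simp only [mul_zero, ENNReal.ofReal_zero] at this
      exact this.mono_left nhdsWithin_le_nhds
    have h6 : Tendsto (fun t => ε t ^ 2) (𝓝[>] 0) (𝓝 0) := by
      have := (ENNReal.continuous_pow 2).tendsto 0 |>.comp hqS
      simpa [Function.comp_def] using this
    have h7 := ENNReal.Tendsto.mul h5 (Or.inr ENNReal.zero_ne_top) h6 (Or.inr ENNReal.zero_ne_top)
    simpa using h4.add (h7.add hqS)
  refine tendsto_of_tendsto_of_tendsto_of_le_of_le' tendsto_const_nhds hlim
    (Eventually.of_forall fun _ => zero_le) ?_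
  filter_upwards [self_mem_nhdsWithin] with t ht
  have ht0 : (0 : ℝ) < t := ht
  have htc : (t : ℂ) ≠ 0 := by exact_mod_cast ht0.ne'
  have hpt : ∀ᵐ x ∂μ, ‖(w (y t * x) - w x) / (t : ℂ) - Complex.I * S x * w x‖ₑ ≤
      ENNReal.ofReal (4 * t * B ^ 2) +
        (ENNReal.ofReal (4 * t) * ‖q t x - S x‖ₑ ^ 2 + ‖q t x - S x‖ₑ) := by
    filter_upwards [hqw t ht0] with x hx
    set p := q t x with hp
    have e : (w (y t * x) - w x) / (t : ℂ) - Complex.I * S x * w x =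
        w x * ((Complex.exp (Complex.I * ((t * p : ℝ) : ℂ)) - 1 - Complex.I * ((t * p : ℝ) : ℂ)) /
          t + Complex.I * ((p - S x : ℝ) : ℂ)) := by
      rw [hx]
      push_cast
      field_simp
      ring
    have hb : ‖(w (y t * x) - w x) / (t : ℂ) - Complex.I * S x * w x‖ ≤
        4 * t * B ^ 2 + (4 * t * |p - S x| ^ 2 + |p - S x|) := by
      rw [e, norm_mul, hw1, one_mul]
      refine (norm_add_le _ _).trans ?_
      rw [norm_div, norm_mul, Complex.norm_I, one_mul, Complex.norm_real, Complex.norm_real,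
        Real.norm_eq_abs, Real.norm_eq_abs, abs_of_pos ht0, ← add_assoc]
      refine add_le_add_left ?_ _
      rw [div_le_iff₀ ht0]
      refine (norm_exp_I_mul_sub_one_sub_le _).trans ?_
      have h1 : p ^ 2 ≤ 2 * B ^ 2 + 2 * |p - S x| ^ 2 := by
        rw [sq_abs]
        have h2 : S x ^ 2 ≤ B ^ 2 := sq_le_sq' (by linarith [abs_le.1 (hSB x)]) (abs_le.1 (hSB x)).2
        nlinarith [sq_nonneg (p - 2 * S x)]
      have h3 : 0 ≤ t ^ 2 := sq_nonneg t
      nlinarith [mul_le_mul_of_nonneg_left h1 h3]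
    calc ‖(w (y t * x) - w x) / (t : ℂ) - Complex.I * S x * w x‖ₑ
        ≤ ENNReal.ofReal (4 * t * B ^ 2 + (4 * t * |p - S x| ^ 2 + |p - S x|)) := by
          rw [← ofReal_norm]; exact ENNReal.ofReal_le_ofReal hb
      _ = _ := by
          rw [ENNReal.ofReal_add (by positivity) (by positivity),
            ENNReal.ofReal_add (by positivity) (by positivity),
            ENNReal.ofReal_mul (p := 4 * t) (q := |p - S x| ^ 2) (by positivity),
            ENNReal.ofReal_pow (abs_nonneg _), ← Real.enorm_eq_ofReal_abs]
  have hm : AEMeasurable (fun x => ‖q t x - S x‖ₑ) μ := ((hq t).sub hS).enorm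
  rw [eLpNorm_one_eq_lintegral_enorm]
  refine (lintegral_mono_ae hpt).trans ?_
  rw [lintegral_add_left measurable_const, lintegral_const, measure_univ, mul_one,
    lintegral_add_right' _ hm, lintegral_const_mul' _ _ ENNReal.ofReal_ne_top, lintegral_enorm_sq]
  gcongr
  rw [← eLpNorm_one_eq_lintegral_enorm]
  exact eLpNorm_le_eLpNorm_of_exponent_le one_le_two ((hq t).sub hS)

theorem HasPhaseDeriv.norm_integral_le [MeasurableMul X] [IsProbabilityMeasure μ]
    [μ.IsMulLeftInvariant]
    (hw : HasPhaseDeriv μ y w S) (hwm : Measurable w) (hw1 : ∀ x, ‖w x‖ = 1) (hS : Measurable S)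
    {B : ℝ} (hSB : ∀ x, |S x| ≤ B) {Φ : X → ℂ} (hΦ : Measurable Φ) {M : ℝ} (hΦM : ∀ x, ‖Φ x‖ ≤ M)
    {L : ℝ} (hΦL : ∀ᶠ t : ℝ in 𝓝[>] 0,
      eLpNorm (fun x => Φ (y t * x) - Φ x) 1 μ ≤ ENNReal.ofReal (t * L)) :
    ‖∫ x, w x * S x * Φ x ∂μ‖ₑ ≤ ENNReal.ofReal L := by
  have hlim := hw.tendsto_eLpNorm_one hw1 hS.aestronglyMeasurable hSB
  have hmul : ∀ t, Measurable fun x => y t * x := fun t => measurable_const_mul (y t)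
  have hSc : Measurable fun x => (S x : ℂ) := Complex.measurable_ofReal.comp hS
  have hbd : ∀ (g : X → ℂ) (C : ℝ), Measurable g → (∀ x, ‖g x‖ ≤ C) → Integrable g μ :=
    fun g C hg hC => Integrable.of_bound hg.aestronglyMeasurable C (ae_of_all _ hC)
  have hM0 : ∀ x : X, 0 ≤ M := fun x => (norm_nonneg _).trans (hΦM x)
  have hwΦ : Integrable (fun x => w x * Φ x) μ :=
    hbd _ M (hwm.mul hΦ) fun x => by rw [norm_mul, hw1, one_mul]; exact hΦM x
  have hwSΦ : Integrable (fun x => Complex.I * S x * w x * Φ x) μ := by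
    refine hbd _ (B * M) (((measurable_const.mul hSc).mul hwm).mul hΦ) fun x => ?_
    rw [norm_mul, norm_mul, norm_mul, hw1, Complex.norm_I, one_mul, mul_one, Complex.norm_real]
    exact mul_le_mul (hSB x) (hΦM x) (norm_nonneg _) ((abs_nonneg _).trans (hSB x))
  have hdiff : ∀ t : ℝ, Integrable (fun x => (w (y t * x) - w x) / (t : ℂ) * Φ x) μ := fun t => by
    refine hbd _ (2 / |t| * M) ((((hwm.comp (hmul t)).sub hwm).div_const _).mul hΦ) fun x => ?_
    rw [norm_mul, norm_div, Complex.norm_real, Real.norm_eq_abs]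
    refine mul_le_mul ?_ (hΦM x) (norm_nonneg _) (by positivity)
    gcongr
    refine (norm_sub_le _ _).trans ?_
    rw [hw1, hw1]; norm_num
  have htend : Tendsto (fun t : ℝ => ∫ x, (w (y t * x) - w x) / (t : ℂ) * Φ x ∂μ) (𝓝[>] 0)
      (𝓝 (∫ x, Complex.I * S x * w x * Φ x ∂μ)) := by
    refine tendsto_integral_of_L1' _ hwSΦ.aestronglyMeasurable (Eventually.of_forall hdiff) ?_
    have h2 : Tendsto (fun t : ℝ => ENNReal.ofReal M * eLpNorm (fun x =>
        (w (y t * x) - w x) / (t : ℂ) - Complex.I * S x * w x) 1 μ) (𝓝[>] 0) (𝓝 0) := by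
      simpa using ENNReal.Tendsto.const_mul hlim (Or.inr ENNReal.ofReal_ne_top)
    refine tendsto_of_tendsto_of_tendsto_of_le_of_le tendsto_const_nhds h2 (fun _ => zero_le)
      fun t => ?_
    simp only [eLpNorm_one_eq_lintegral_enorm]
    rw [← lintegral_const_mul' _ _ ENNReal.ofReal_ne_top]
    refine lintegral_mono fun x => ?_
    rw [Pi.sub_apply, ← sub_mul, enorm_mul, mul_comm]
    gcongr
    rw [← ofReal_norm]
    exact ENNReal.ofReal_le_ofReal (hΦM x)
  have heq : ‖∫ x, w x * S x * Φ x ∂μ‖ₑ = ‖∫ x, Complex.I * S x * w x * Φ x ∂μ‖ₑ := by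
    have : ∀ x, Complex.I * S x * w x * Φ x = Complex.I * (w x * S x * Φ x) := fun x => by ring
    simp only [this]
    rw [integral_const_mul, enorm_mul, ← ofReal_norm Complex.I, Complex.norm_I,
      ENNReal.ofReal_one, one_mul]
  rw [heq]
  refine le_of_tendsto htend.enorm ?_
  filter_upwards [hΦL, self_mem_nhdsWithin] with t ht ht0
  have ht0 : (0 : ℝ) < t := ht0
  have htc : (t : ℂ) ≠ 0 := by exact_mod_cast ht0.ne'
  have hcomp : Integrable (fun x => w (y t * x) * Φ (y t * x)) μ :=
    hbd _ M ((hwm.comp (hmul t)).mul (hΦ.comp (hmul t))) fun x => by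
      rw [norm_mul, hw1, one_mul]; exact hΦM _
  have hmix : Integrable (fun x => w (y t * x) * Φ x) μ :=
    hbd _ M ((hwm.comp (hmul t)).mul hΦ) fun x => by
      rw [norm_mul, hw1, one_mul]; exact hΦM _
  have hinv : ∫ x, w (y t * x) * Φ (y t * x) ∂μ = ∫ x, w x * Φ x ∂μ :=
    integral_mul_left_eq_self (fun x => w x * Φ x) (y t)
  have hI : ∫ x, (w (y t * x) - w x) / (t : ℂ) * Φ x ∂μ =
      -((t : ℂ)⁻¹ * ∫ x, w (y t * x) * (Φ (y t * x) - Φ x) ∂μ) := by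
    have e1 : ∀ x, (w (y t * x) - w x) / (t : ℂ) * Φ x =
        (t : ℂ)⁻¹ * (w (y t * x) * Φ x - w x * Φ x) := fun x => by
      rw [div_eq_inv_mul]; ring
    have e2 : ∀ x, w (y t * x) * (Φ (y t * x) - Φ x) =
        w (y t * x) * Φ (y t * x) - w (y t * x) * Φ x := fun x => by ring
    simp only [e1, e2]
    rw [integral_const_mul, integral_sub hmix hwΦ, integral_sub hcomp hmix, hinv]
    ring
  rw [hI, enorm_neg, enorm_mul]
  have h3 : ‖∫ x, w (y t * x) * (Φ (y t * x) - Φ x) ∂μ‖ₑ ≤ ENNReal.ofReal (t * L) := by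
    refine (enorm_integral_le_lintegral_enorm _).trans (le_trans (le_of_eq ?_) ht)
    rw [eLpNorm_one_eq_lintegral_enorm]
    refine lintegral_congr fun x => ?_
    rw [enorm_mul, ← ofReal_norm (w _), hw1, ENNReal.ofReal_one, one_mul]
  have h4 : ‖(t : ℂ)⁻¹‖ₑ = ENNReal.ofReal t⁻¹ := by
    rw [← ofReal_norm, norm_inv, Complex.norm_real, Real.norm_of_nonneg ht0.le]
  rw [h4]
  calc ENNReal.ofReal t⁻¹ * ‖∫ x, w (y t * x) * (Φ (y t * x) - Φ x) ∂μ‖ₑ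
      ≤ ENNReal.ofReal t⁻¹ * ENNReal.ofReal (t * L) := by gcongr
    _ = ENNReal.ofReal L := by
      rw [← ENNReal.ofReal_mul (by positivity), inv_mul_cancel_left₀ ht0.ne']

end PhaseDerivative

section FlowRegular

variable {X : Type*} [CommGroup X] [MeasurableSpace X] [MeasurableMul X]

theorem enorm_eq_one_of_norm {z : ℂ} (hz : ‖z‖ = 1) : ‖z‖ₑ = 1 := by
  rw [← ofReal_norm, hz, ENNReal.ofReal_one]

theorem HasLieDeriv.hasPhaseDeriv {μ : Measure X} [μ.IsMulLeftInvariant] {y : ℝ → X} {u : X → ℂ}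
    {h : X → ℝ} {h' : X → ℂ} (hh : HasLieDeriv μ y (fun x => (h x : ℂ)) h')
    (hu : ∀ᵐ x ∂μ, u x = Complex.exp (Complex.I * (h x : ℂ))) :
    HasPhaseDeriv μ y u (fun x => (h' x).re) := by
  have hm : AEStronglyMeasurable h μ :=
    (Complex.continuous_re.comp_aestronglyMeasurable hh.1.1).congr
      (ae_of_all _ fun x => Complex.ofReal_re (h x))
  refine ⟨fun t x => (h (y t * x) - h x) / t, fun t => ?_, fun t ht => ?_, ?_⟩
  · exact ((hm.comp_measurePreserving (measurePreserving_mul_left μ (y t))).sub hm).mul_const _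
      |>.congr (ae_of_all _ fun x => (div_eq_mul_inv _ _).symm)
  · filter_upwards [hu, (measurePreserving_mul_left μ (y t)).quasiMeasurePreserving.ae hu]
      with x h1 h2
    rw [h2, h1, mul_div_cancel₀ _ ht.ne', ← Complex.exp_add, ← mul_add]
    push_cast
    rw [add_sub_cancel]
  · refine tendsto_of_tendsto_of_tendsto_of_le_of_le tendsto_const_nhds
      (hh.2.2.mono_left (nhdsWithin_mono 0 fun t ht => ne_of_gt ht)) (fun _ => zero_le) fun t => ?_
    refine eLpNorm_mono fun x => ?_
    have e : (h (y t * x) - h x) / t - (h' x).re =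
        (((h (y t * x) : ℂ) - h x) / (t : ℂ) - h' x).re := by
      rw [Complex.sub_re, ← Complex.ofReal_sub, ← Complex.ofReal_div, Complex.ofReal_re]
    rw [e]
    exact Complex.abs_re_le_norm _

theorem HasLieDeriv.integral_eq_zero {μ : Measure X} [μ.IsMulLeftInvariant] [IsProbabilityMeasure μ]
    {y : ℝ → X} {g g' : X → ℂ} (hg : HasLieDeriv μ y g g') : ∫ x, g' x ∂μ = 0 := by
  have hgi : Integrable g μ := hg.1.integrable one_le_two
  have hgt : ∀ t : ℝ, Integrable (fun x => g (y t * x)) μ := fun t =>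
    (measurePreserving_mul_left μ (y t)).integrable_comp_of_integrable hgi
  have hq : ∀ t : ℝ, Integrable (fun x => (g (y t * x) - g x) / (t : ℂ)) μ := fun t =>
    ((hgt t).sub hgi).div_const _
  have h1 : Tendsto (fun t : ℝ => ∫ x, (g (y t * x) - g x) / (t : ℂ) ∂μ) (𝓝[≠] 0)
      (𝓝 (∫ x, g' x ∂μ)) := by
    refine tendsto_integral_of_L1' _ hg.2.1.1 (Eventually.of_forall hq) ?_
    refine tendsto_of_tendsto_of_tendsto_of_le_of_le tendsto_const_nhds hg.2.2
      (fun _ => zero_le) fun t => ?_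
    exact eLpNorm_le_eLpNorm_of_exponent_le one_le_two ((hq t).1.sub hg.2.1.1)
  refine tendsto_nhds_unique h1 (tendsto_const_nhds.congr fun t => ?_)
  rw [integral_div, integral_sub (hgt t) hgi, integral_mul_left_eq_self g (y t), sub_self, zero_div]

theorem IsFlowRegular.exists_hasPhaseDeriv [TopologicalSpace X] [CompactSpace X] [BorelSpace X]
    {μ : Measure X} [μ.IsMulLeftInvariant] [IsProbabilityMeasure μ] {y : ℝ → X} {u : X → ℂ}
    (hum : Measurable u) (hu1 : ∀ x, ‖u x‖ = 1) (hu : IsFlowRegular μ y u) :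
    ∃ ρ : X → ℝ, Continuous ρ ∧ HasPhaseDeriv μ y u ρ ∧ ∫ x, ρ x ∂μ = 0 ∧
      ∃ C : ℝ, ∀ᶠ t : ℝ in 𝓝[>] 0,
        eLpNorm (fun x => ρ (y t * x) - ρ x) 1 μ ≤ ENNReal.ofReal (t * C) := by
  obtain ⟨⟨u', hu', hsup⟩, h, h', hh, hh'c, huh⟩ := hu
  set ρ : X → ℝ := fun x => (h' x).re with hρ
  have hρc : Continuous ρ := Complex.continuous_re.comp hh'c
  have hph : HasPhaseDeriv μ y u ρ := hh.hasPhaseDeriv huh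
  obtain ⟨B, hB⟩ : ∃ B : ℝ, ∀ x, |ρ x| ≤ B := by
    obtain ⟨B, hB⟩ := (isCompact_range hρc).isBounded.exists_norm_le
    exact ⟨B, fun x => hB _ ⟨x, rfl⟩⟩
  have hmp : ∀ t, MeasurePreserving (fun x => y t * x) μ μ := fun t =>
    measurePreserving_mul_left μ (y t)
  have hL1 := hph.tendsto_eLpNorm_one hu1 hρc.aestronglyMeasurable hB
  have hqm : ∀ t : ℝ, AEStronglyMeasurable (fun x => (u (y t * x) - u x) / (t : ℂ)) μ := fun t =>
    (((hum.comp (hmp t).measurable).sub hum).div_const _).aestronglyMeasurable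
  have hρm : AEStronglyMeasurable (fun x => Complex.I * ρ x * u x) μ :=
    (((Complex.continuous_ofReal.comp hρc).measurable.const_mul _).mul hum).aestronglyMeasurable
  have hu'eq : u' =ᵐ[μ] fun x => Complex.I * ρ x * u x := by
    have h2 : Tendsto (fun t : ℝ => eLpNorm (fun x => (u (y t * x) - u x) / (t : ℂ) - u' x) 1 μ)
        (𝓝[>] 0) (𝓝 0) := by
      refine tendsto_of_tendsto_of_tendsto_of_le_of_le tendsto_const_nhds
        (hu'.2.2.mono_left (nhdsWithin_mono 0 fun t ht => ne_of_gt ht)) (fun _ => zero_le)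
        fun t => ?_
      exact eLpNorm_le_eLpNorm_of_exponent_le one_le_two ((hqm t).sub hu'.2.1.1)
    have h3 := hL1.add h2
    rw [add_zero] at h3
    have h4 : eLpNorm (fun x => u' x - Complex.I * ρ x * u x) 1 μ ≤ 0 := by
      refine ge_of_tendsto h3 (Eventually.of_forall fun t => ?_)
      have e : (fun x => u' x - Complex.I * ρ x * u x) =
          (fun x => (u (y t * x) - u x) / (t : ℂ) - Complex.I * ρ x * u x) -
            fun x => (u (y t * x) - u x) / (t : ℂ) - u' x := by
        ext x; simp only [Pi.sub_apply]; ring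
      rw [e]
      exact eLpNorm_sub_le ((hqm t).sub hρm) ((hqm t).sub hu'.2.1.1) le_rfl
    have h5 := (eLpNorm_eq_zero_iff (hu'.2.1.1.sub hρm) one_ne_zero).1 (le_antisymm h4 zero_le)
    filter_upwards [h5] with x hx
    exact sub_eq_zero.1 hx
  have hInt : ∫ x, ρ x ∂μ = 0 := by
    have h1 := hh.integral_eq_zero
    have h2 := integral_re (hh.2.1.integrable one_le_two : Integrable h' μ)
    rw [h1] at h2
    simpa using h2
  set A := ⨆ (t : ℝ) (_ : 0 < t), eLpNorm (fun x => (u' (y t * x) - u' x) / (t : ℂ)) ⊤ μ with hA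
  refine ⟨ρ, hρc, hph, hInt, A.toReal + |B| * (1 + |B|), ?_⟩
  have hev : ∀ᶠ t : ℝ in 𝓝[>] 0, eLpNorm (fun x => (u (y t * x) - u x) / (t : ℂ) -
      Complex.I * ρ x * u x) 1 μ ≤ 1 := hL1.eventually_le_const one_pos
  filter_upwards [hev, self_mem_nhdsWithin] with t ht ht0
  have ht0 : (0 : ℝ) < t := ht0
  have htc : (t : ℂ) ≠ 0 := by exact_mod_cast ht0.ne'
  have hte : ‖(t : ℂ)‖ₑ = ENNReal.ofReal t := by
    rw [← ofReal_norm, Complex.norm_real, Real.norm_of_nonneg ht0.le]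
  have hu'm : AEStronglyMeasurable (fun x => (u' (y t * x) - u' x) / (t : ℂ)) μ :=
    ((hu'.2.1.1.comp_measurePreserving (hmp t)).sub hu'.2.1.1).mul_const _
      |>.congr (ae_of_all _ fun x => (div_eq_mul_inv _ _).symm)
  have e1 : eLpNorm (fun x => (u' (y t * x) - u' x) / (t : ℂ)) 1 μ ≤ ENNReal.ofReal A.toReal := by
    rw [ENNReal.ofReal_toReal hsup.ne]
    exact (eLpNorm_le_eLpNorm_of_exponent_le le_top hu'm).trans
      (le_iSup₂ (f := fun (t : ℝ) (_ : 0 < t) =>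
        eLpNorm (fun x => (u' (y t * x) - u' x) / (t : ℂ)) ⊤ μ) t ht0)
  have e2 : eLpNorm (fun x => (u (y t * x) - u x) / (t : ℂ)) 1 μ ≤ ENNReal.ofReal (1 + |B|) := by
    have e : (fun x => (u (y t * x) - u x) / (t : ℂ)) =
        (fun x => (u (y t * x) - u x) / (t : ℂ) - Complex.I * ρ x * u x) +
          fun x => Complex.I * ρ x * u x := by
      ext x; simp only [Pi.add_apply]; ring
    rw [e, ENNReal.ofReal_add zero_le_one (abs_nonneg _), ENNReal.ofReal_one]
    refine (eLpNorm_add_le ((hqm t).sub hρm) hρm le_rfl).trans (add_le_add ht ?_)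
    refine (eLpNorm_le_of_ae_bound (C := |B|) (ae_of_all _ fun x => ?_)).trans ?_
    · rw [norm_mul, norm_mul, hu1, Complex.norm_I, one_mul, mul_one, Complex.norm_real]
      exact (hB x).trans (le_abs_self B)
    · simp
  have hpt : ∀ᵐ x ∂μ, ‖ρ (y t * x) - ρ x‖ₑ ≤
      ENNReal.ofReal t * ‖(u' (y t * x) - u' x) / (t : ℂ)‖ₑ +
        ENNReal.ofReal t * ENNReal.ofReal |B| * ‖(u (y t * x) - u x) / (t : ℂ)‖ₑ := by
    filter_upwards [hu'eq, (hmp t).quasiMeasurePreserving.ae hu'eq] with x h1 h2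
    set a := y t * x with ha
    have hid : ((ρ a - ρ x : ℝ) : ℂ) * (Complex.I * u a) =
        (t : ℂ) * ((u' a - u' x) / t) - (t : ℂ) * (Complex.I * ρ x) * ((u a - u x) / t) := by
      rw [h1, h2]
      push_cast
      field_simp
      ring
    have hn : ‖ρ a - ρ x‖ₑ = ‖((ρ a - ρ x : ℝ) : ℂ) * (Complex.I * u a)‖ₑ := by
      rw [enorm_mul, enorm_mul, enorm_eq_one_of_norm (hu1 _), enorm_eq_one_of_norm Complex.norm_I,
        mul_one, mul_one, ← ofReal_norm, ← ofReal_norm, Complex.norm_real]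
    rw [hn, hid]
    refine (enorm_sub_le).trans (add_le_add ?_ ?_)
    · rw [enorm_mul, hte]
    · rw [enorm_mul, enorm_mul, hte, enorm_mul, enorm_eq_one_of_norm Complex.norm_I, one_mul]
      gcongr
      rw [← ofReal_norm, Complex.norm_real]
      exact ENNReal.ofReal_le_ofReal ((hB x).trans (le_abs_self B))
  rw [eLpNorm_one_eq_lintegral_enorm] at e1 e2 ⊢
  refine (lintegral_mono_ae hpt).trans ?_
  rw [lintegral_add_left' (hu'm.enorm.const_mul _), lintegral_const_mul' _ _ ENNReal.ofReal_ne_top,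
    lintegral_const_mul' _ _ (ENNReal.mul_ne_top ENNReal.ofReal_ne_top ENNReal.ofReal_ne_top)]
  calc _ ≤ ENNReal.ofReal t * ENNReal.ofReal A.toReal +
        ENNReal.ofReal t * ENNReal.ofReal |B| * ENNReal.ofReal (1 + |B|) := by gcongr
    _ = _ := by
      rw [ENNReal.ofReal_mul ht0.le, ENNReal.ofReal_add ENNReal.toReal_nonneg (by positivity),
        ENNReal.ofReal_mul (abs_nonneg _), mul_add, mul_assoc]

end FlowRegular

section Characters

theorem exists_eq_exp_of_continuous_character {f : ℝ → ℂ} (hf : Continuous f)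
    (hadd : ∀ s t, f (s + t) = f s * f t) (hf1 : ∀ t, ‖f t‖ = 1) :
    ∃ c : ℝ, ∀ t : ℝ, f t = Complex.exp (Complex.I * ((c * t : ℝ) : ℂ)) := by
  have hne : ∀ t, f t ≠ 0 := fun t h => by simpa [h] using hf1 t
  have h0 : f 0 = 1 := by
    have := hadd 0 0
    rw [add_zero] at this
    exact (mul_right_cancel₀ (hne 0) (by rw [one_mul]; exact this)).symm
  let F : ℝ → ℂ := fun a => ∫ s in (0 : ℝ)..a, f s
  have hF : ∀ a, HasDerivAt F (f a) a := fun a => hf.integral_hasStrictDerivAt 0 a |>.hasDerivAt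
  obtain ⟨a, ha⟩ : ∃ a, F a ≠ 0 := by
    by_contra! hall
    have h1 : HasDerivAt F 0 0 := by
      have : F = fun _ => 0 := funext hall
      rw [this]; exact hasDerivAt_const _ _
    have := h1.unique (hF 0)
    exact hne 0 this.symm
  have hfF : ∀ t, f t = (F (t + a) - F t) / F a := fun t => by
    rw [eq_div_iff ha]
    have e1 : f t * F a = ∫ s in (0 : ℝ)..a, f (t + s) := by
      simp only [hadd]
      exact (intervalIntegral.integral_const_mul _ _).symm
    rw [e1, intervalIntegral.integral_comp_add_left, add_zero]
    exact (intervalIntegral.integral_interval_sub_left (hf.intervalIntegrable _ _)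
      (hf.intervalIntegrable _ _)).symm
  have hd : ∀ t, HasDerivAt f ((f (t + a) - f t) / F a) t := fun t => by
    have h1 : HasDerivAt (fun t => F (t + a)) (f (t + a)) t := (hF (t + a)).comp_add_const t a
    have h2 := (h1.sub (hF t)).div_const (F a)
    exact h2.congr_of_eventuallyEq (Eventually.of_forall hfF)
  set m : ℂ := (f a - 1) / F a with hm
  have hd' : ∀ t, HasDerivAt f (f t * m) t := fun t => by
    convert hd t using 1
    rw [hm, hadd]; ring
  have hexp : ∀ t : ℝ, f t = Complex.exp (m * t) := by
    have hg : ∀ t : ℝ, HasDerivAt (fun t : ℝ => f t * Complex.exp (-(m * t))) 0 t := fun t => by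
      have h1 : HasDerivAt (fun t : ℝ => -(m * (t : ℂ))) (-(m * 1)) t :=
        ((Complex.ofRealCLM.hasDerivAt (x := t)).const_mul m).neg
      have h2 := (hd' t).mul h1.cexp
      exact h2.congr_deriv (by ring)
    intro t
    have h3 := is_const_of_deriv_eq_zero (fun t => (hg t).differentiableAt)
      (fun t => (hg t).deriv) t 0
    rw [h0] at h3
    simp only [Complex.ofReal_zero, mul_zero, neg_zero, Complex.exp_zero, mul_one] at h3
    rw [Complex.exp_neg] at h3
    exact (mul_inv_eq_one₀ (Complex.exp_ne_zero _)).1 h3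
  have hre : m.re = 0 := by
    have h1 := hf1 1
    rw [hexp, Complex.norm_exp] at h1
    simpa using h1
  refine ⟨m.im, fun t => ?_⟩
  rw [hexp]
  congr 1
  apply Complex.ext <;> simp [hre]

end Characters

section CompactGroup

variable {X : Type*} [MetricSpace X] [CommGroup X] [IsTopologicalGroup X]

/-- The translate `x ↦ f (a x)` of a continuous function. -/
def leftTranslate {E : Type*} [TopologicalSpace E] (f : C(X, E)) (a : X) : C(X, E) :=
  ⟨fun x => f (a * x), f.continuous.comp (continuous_const_mul a)⟩

theorem continuous_leftTranslate {E : Type*} [TopologicalSpace E] (f : C(X, E)) :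
    Continuous (leftTranslate f) :=
  ContinuousMap.continuous_of_continuous_uncurry _
    (f.continuous.comp (continuous_fst.mul continuous_snd) :
      Continuous fun p : X × X => f (p.1 * p.2))

theorem leftTranslate_one {E : Type*} [TopologicalSpace E] (f : C(X, E)) :
    leftTranslate f 1 = f := by
  ext x; exact congrArg f (one_mul x)

variable [CompactSpace X] [MeasurableSpace X] [BorelSpace X] {μ : Measure X} [μ.IsHaarMeasure]
  [IsProbabilityMeasure μ]

theorem tendsto_eLpNorm_birkhoffAverage {a : X} (ha : Ergodic (fun x : X => a * x) μ)
    (f : C(X, ℝ)) (hf : ∫ x, f x ∂μ = 0) :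
    Tendsto (fun n : ℕ => eLpNorm (fun x => (n : ℝ)⁻¹ * ∑ k ∈ Finset.range n, f (a ^ k * x)) 2 μ)
      atTop (𝓝 0) := by
  let K : Lp ℝ 2 μ →ₗᵢ[ℝ] Lp ℝ 2 μ :=
    Lp.compMeasurePreservingₗᵢ ℝ (fun x => a * x) ha.toMeasurePreserving
  have hK : ∀ g : Lp ℝ 2 μ, K g =ᵐ[μ] fun x => g (a * x) := fun g =>
    Lp.coeFn_compMeasurePreserving g ha.toMeasurePreserving
  let v : C(X, ℝ) → Lp ℝ 2 μ := fun g => ContinuousMap.toLp 2 μ ℝ g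
  have hv : ∀ g, v g =ᵐ[μ] g := fun g => ContinuousMap.coeFn_toLp μ g
  have hKv : ∀ g, K (v g) = v (leftTranslate g a) := fun g => by
    apply Lp.ext
    filter_upwards [hK (v g), hv (leftTranslate g a),
      ha.toMeasurePreserving.quasiMeasurePreserving.ae (hv g)] with x h1 h2 h3
    rw [h1, h2, h3]
    rfl
  have hiter : ∀ k : ℕ, K^[k] (v f) = v (leftTranslate f (a ^ k)) := fun k => by
    induction k with
    | zero => rw [pow_zero, leftTranslate_one]; rfl
    | succ k ih =>
      rw [Function.iterate_succ_apply', ih, hKv]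
      congr 1
      ext x
      change f (a ^ k * (a * x)) = f (a ^ (k + 1) * x)
      rw [pow_succ, mul_assoc]
  let A : ℕ → C(X, ℝ) := fun n => (n : ℝ)⁻¹ • ∑ k ∈ Finset.range n, leftTranslate f (a ^ k)
  have hA : ∀ n x, A n x = (n : ℝ)⁻¹ * ∑ k ∈ Finset.range n, f (a ^ k * x) := fun n x => by
    simp only [A, ContinuousMap.smul_apply, ContinuousMap.sum_apply, smul_eq_mul]
    rfl
  have hbirk : ∀ n, birkhoffAverage ℝ K.toContinuousLinearMap id n (v f) = v (A n) := fun n => by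
    have e : v (A n) = (n : ℝ)⁻¹ • ∑ k ∈ Finset.range n, v (leftTranslate f (a ^ k)) := by
      simp only [v, A, map_smul, map_sum]
    rw [e, birkhoffAverage, birkhoffSum]
    congr 1
    refine Finset.sum_congr rfl fun k _ => ?_
    rw [← hiter]; rfl
  have hlim := ContinuousLinearMap.tendsto_birkhoffAverage_orthogonalProjection
    K.toContinuousLinearMap K.norm_toContinuousLinearMap_le (v f)
  simp only [hbirk] at hlim
  obtain ⟨z, hz⟩ : ∃ z : LinearMap.eqLocus K.toContinuousLinearMap.toLinearMap
      (1 : Lp ℝ 2 μ →L[ℝ] Lp ℝ 2 μ).toLinearMap,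
      Tendsto (fun n => v (A n)) atTop (𝓝 (z : Lp ℝ 2 μ)) := ⟨_, hlim⟩
  have hKz : K z = z := z.2
  obtain ⟨c, hc⟩ := ha.ae_eq_const_of_ae_eq_comp_ae (Lp.aestronglyMeasurable (z : Lp ℝ 2 μ)) (by
    have h1 := hK z
    rw [hKz] at h1
    exact h1.symm)
  let e : Lp ℝ 2 μ := indicatorConstLp 2 MeasurableSet.univ (measure_ne_top μ _) (1 : ℝ)
  have hin : ∀ g : Lp ℝ 2 μ, inner ℝ e g = ∫ x, g x ∂μ := fun g => by
    have := L2.inner_indicatorConstLp_one (𝕜 := ℝ) MeasurableSet.univ (measure_ne_top μ _) g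
    rwa [Measure.restrict_univ] at this
  have hvA : ∀ n, inner ℝ e (v (A n)) = 0 := fun n => by
    rw [hin, integral_congr_ae (hv (A n))]
    simp only [hA]
    rw [integral_const_mul, integral_finsetSum]
    · simp only [integral_mul_left_eq_self (fun x => f x), hf, Finset.sum_const_zero, mul_zero]
    · intro k _
      exact (leftTranslate f (a ^ k)).continuous.integrable_of_hasCompactSupport
        (HasCompactSupport.of_compactSpace _)
  have hz0 : inner ℝ e (z : Lp ℝ 2 μ) = 0 := by
    refine tendsto_nhds_unique (Tendsto.inner (tendsto_const_nhds (x := e)) hz) ?_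
    simp only [hvA]
    exact tendsto_const_nhds
  have hc0 : c = 0 := by
    rw [hin, integral_congr_ae hc] at hz0
    simpa using hz0
  have hz' : (z : Lp ℝ 2 μ) = 0 := by
    apply Lp.ext
    filter_upwards [hc, Lp.coeFn_zero ℝ 2 μ] with x h1 h2
    rw [h1, h2, hc0]; rfl
  rw [hz'] at hz
  have h3 := hz.enorm
  rw [enorm_zero] at h3
  refine h3.congr fun n => ?_
  rw [Lp.enorm_def, eLpNorm_congr_ae (hv (A n))]
  exact congrArg (fun g => eLpNorm g 2 μ) (funext (hA n))

/-- Unique ergodicity of an ergodic translation of a compact group. -/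
theorem eventually_abs_birkhoffAverage_lt {a : X} (ha : Ergodic (fun x : X => a * x) μ)
    (f : C(X, ℝ)) (hf : ∫ x, f x ∂μ = 0) {ε : ℝ} (hε : 0 < ε) :
    ∀ᶠ n : ℕ in atTop, ∀ x, |(n : ℝ)⁻¹ * ∑ k ∈ Finset.range n, f (a ^ k * x)| < ε := by
  set A : ℕ → X → ℝ := fun n x => (n : ℝ)⁻¹ * ∑ k ∈ Finset.range n, f (a ^ k * x) with hA
  have hlim := tendsto_eLpNorm_birkhoffAverage ha f hf
  have hnhds : ∀ᶠ z in 𝓝 (1 : X), dist (leftTranslate f z) f < ε / 2 := by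
    have h1 := (continuous_leftTranslate f).tendsto 1
    rw [leftTranslate_one] at h1
    exact h1 (Metric.ball_mem_nhds f (half_pos hε))
  obtain ⟨N, hN, hNo, hN1⟩ := eventually_nhds_iff.1 hnhds
  have hNpos : 0 < μ N := hNo.measure_pos μ ⟨1, hN1⟩
  have hAN : ∀ n x z, z ∈ N → |A n (z * x) - A n x| ≤ ε / 2 := by
    intro n x z hz
    have h1 : ∀ w, |f (z * w) - f w| ≤ ε / 2 := fun w => by
      have h2 := (ContinuousMap.dist_apply_le_dist (f := leftTranslate f z) (g := f) w).trans
        (hN z hz).le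
      exact h2
    have h3 : A n (z * x) - A n x =
        (n : ℝ)⁻¹ * ∑ k ∈ Finset.range n, (f (z * (a ^ k * x)) - f (a ^ k * x)) := by
      simp only [hA, ← mul_sub, ← Finset.sum_sub_distrib]
      congr 1
      refine Finset.sum_congr rfl fun k _ => ?_
      rw [mul_left_comm]
    rw [h3, abs_mul, abs_of_nonneg (by positivity : (0 : ℝ) ≤ (n : ℝ)⁻¹)]
    have h4 : |∑ k ∈ Finset.range n, (f (z * (a ^ k * x)) - f (a ^ k * x))| ≤ n * (ε / 2) := by
      refine (Finset.abs_sum_le_sum_abs _ _).trans ?_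
      refine (Finset.sum_le_card_nsmul _ _ _ fun k _ => h1 _).trans ?_
      rw [Finset.card_range, nsmul_eq_mul]
    rcases Nat.eq_zero_or_pos n with rfl | hn
    · simp; positivity
    · rw [inv_mul_le_iff₀ (by positivity)]
      exact h4
  have hsmall : ∀ᶠ n : ℕ in atTop, eLpNorm (A n) 2 μ ^ 2 < ENNReal.ofReal (ε / 2) ^ 2 * μ N := by
    have h1 := (ENNReal.continuous_pow 2).tendsto 0 |>.comp hlim
    simp only [ne_eq, OfNat.ofNat_ne_zero, not_false_eq_true, zero_pow] at h1
    refine h1.eventually_lt_const ?_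
    exact ENNReal.mul_pos (pow_ne_zero _ (by simpa using hε)) hNpos.ne'
  filter_upwards [hsmall] with n hn x
  by_contra! hx
  refine absurd hn (not_lt.2 ?_)
  rw [← lintegral_enorm_sq]
  have h1 : ∫⁻ z, ‖A n z‖ₑ ^ 2 ∂μ = ∫⁻ z, ‖A n (z * x)‖ₑ ^ 2 ∂μ := by
    have := lintegral_mul_left_eq_self (μ := μ) (fun z => ‖A n z‖ₑ ^ 2) x
    rw [← this]
    simp only [mul_comm x]
  rw [h1, ← setLIntegral_const]
  refine (lintegral_mono_ae ?_).trans (setLIntegral_le_lintegral N _)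
  rw [ae_restrict_iff' hNo.measurableSet]
  refine ae_of_all _ fun z hz => ?_
  gcongr
  rw [Real.enorm_eq_ofReal_abs]
  refine ENNReal.ofReal_le_ofReal ?_
  have h2 := hAN n x z hz
  have h3 := abs_sub_abs_le_abs_sub (A n x) (A n (z * x))
  rw [abs_sub_comm] at h3
  change ε ≤ |A n x| at hx
  linarith

theorem exists_forall_abs_birkhoffSum_ge {a : X} (ha : Ergodic (fun x : X => a * x) μ)
    (f : C(X, ℝ)) (hf : ∫ x, f x ∂μ ≠ 0) :
    ∀ᶠ n : ℕ in atTop, ∀ x, |∫ x, f x ∂μ| / 2 * n ≤ |∑ k ∈ Finset.range n, f (a ^ k * x)| := by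
  set c := ∫ x, f x ∂μ with hc
  have hfi : Integrable f μ := f.continuous.integrable_of_hasCompactSupport
    (HasCompactSupport.of_compactSpace _)
  have h0 : ∫ x, (f - ContinuousMap.const X c) x ∂μ = 0 := by
    simp only [ContinuousMap.sub_apply, ContinuousMap.const_apply]
    rw [integral_sub hfi (integrable_const c)]
    simp [hc]
  filter_upwards [eventually_abs_birkhoffAverage_lt ha _ h0 (half_pos (abs_pos.2 hf)),
    eventually_gt_atTop 0] with n hn hn0 x
  have h1 := hn x
  simp only [ContinuousMap.sub_apply, ContinuousMap.const_apply, Finset.sum_sub_distrib,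
    Finset.sum_const, Finset.card_range, nsmul_eq_mul] at h1
  have hn0' : (0 : ℝ) < n := by exact_mod_cast hn0
  rw [abs_mul, abs_of_pos (inv_pos.2 hn0'), inv_mul_lt_iff₀ hn0'] at h1
  have h2 := abs_sub_abs_le_abs_sub (n * c) (∑ k ∈ Finset.range n, f (a ^ k * x))
  rw [abs_sub_comm, abs_mul, abs_of_pos hn0'] at h2
  linarith

end CompactGroup

section Decay

variable {X : Type*} [MetricSpace X] [CompactSpace X] [CommGroup X] [IsTopologicalGroup X]

/-- `f` is Lipschitz along the flow `F_t x = y_t x`. -/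
def IsFlowLipschitz (y : ℝ → X) (f : C(X, ℂ)) : Prop :=
  ∃ L : ℝ, 0 ≤ L ∧ ∀ t x, ‖f (y t * x) - f x‖ ≤ L * |t|

theorem exists_isFlowLipschitz_dist_lt {y : ℝ → X} (hy : Continuous y)
    (hy_add : ∀ s t : ℝ, y (s + t) = y s * y t) (f : C(X, ℂ)) {ε : ℝ} (hε : 0 < ε) :
    ∃ g : C(X, ℂ), IsFlowLipschitz y g ∧ dist g f < ε := by
  have hy0 : y 0 = 1 := by
    have := hy_add 0 0
    rw [add_zero] at this
    exact (left_eq_mul.1 this)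
  have h1 : ∀ᶠ s in 𝓝 (0 : ℝ), dist (leftTranslate f (y s)) f < ε / 2 := by
    have h2 := ((continuous_leftTranslate f).comp hy).tendsto 0
    simp only [Function.comp_def, hy0, leftTranslate_one] at h2
    exact h2 (Metric.ball_mem_nhds f (half_pos hε))
  obtain ⟨δ, hδ, hδs⟩ := Metric.eventually_nhds_iff.1 h1
  set a := δ / 2 with ha
  have ha0 : 0 < a := half_pos hδ
  have hcont : Continuous fun p : X × ℝ => f (y p.2 * p.1) :=
    f.continuous.comp ((hy.comp continuous_snd).mul continuous_fst)
  have hcx : ∀ x, Continuous fun s : ℝ => f (y s * x) := fun x =>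
    f.continuous.comp (hy.mul continuous_const)
  let g : C(X, ℂ) := ⟨fun x => (a : ℂ)⁻¹ * ∫ s in (0 : ℝ)..a, f (y s * x),
    continuous_const.mul
      (intervalIntegral.continuous_parametric_intervalIntegral_of_continuous' hcont 0 a)⟩
  have hg : ∀ x, g x = (a : ℂ)⁻¹ * ∫ s in (0 : ℝ)..a, f (y s * x) := fun _ => rfl
  have hna : ‖(a : ℂ)⁻¹‖ = a⁻¹ := by
    rw [norm_inv, Complex.norm_real, Real.norm_of_nonneg ha0.le]
  obtain ⟨M, hM0, hM⟩ : ∃ M : ℝ, 0 ≤ M ∧ ∀ x, ‖f x‖ ≤ M := ⟨‖f‖, norm_nonneg _, f.norm_coe_le_norm⟩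
  refine ⟨g, ⟨a⁻¹ * (M + M), by positivity, fun t x => ?_⟩, ?_⟩
  · have e1 : ∫ s in (0 : ℝ)..a, f (y s * (y t * x)) = ∫ s in t..(a + t), f (y s * x) := by
      have e2 : ∀ s, f (y s * (y t * x)) = f (y (s + t) * x) := fun s => by
        rw [hy_add, mul_assoc]
      simp only [e2]
      rw [intervalIntegral.integral_comp_add_right (fun s => f (y s * x)), zero_add]
    have hi : ∀ b c : ℝ, IntervalIntegrable (fun s => f (y s * x)) volume b c := fun b c =>
      (hcx x).intervalIntegrable b c
    have e3 : (∫ s in t..(a + t), f (y s * x)) - ∫ s in (0 : ℝ)..a, f (y s * x) =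
        (∫ s in a..(a + t), f (y s * x)) - ∫ s in (0 : ℝ)..t, f (y s * x) := by
      have h2 := intervalIntegral.integral_add_adjacent_intervals (hi 0 t) (hi t (a + t))
      have h3 := intervalIntegral.integral_add_adjacent_intervals (hi 0 a) (hi a (a + t))
      rw [← h3] at h2
      linear_combination h2
    rw [hg, hg, ← mul_sub, e1, e3, norm_mul, hna, mul_assoc]
    gcongr
    rw [add_mul]
    refine (norm_sub_le _ _).trans (add_le_add ?_ ?_)
    · have := intervalIntegral.norm_integral_le_of_norm_le_const (a := a) (b := a + t)
        (f := fun s => f (y s * x)) (C := M) fun s _ => hM _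
      simpa using this
    · have := intervalIntegral.norm_integral_le_of_norm_le_const (a := 0) (b := t)
        (f := fun s => f (y s * x)) (C := M) fun s _ => hM _
      simpa using this
  · refine lt_of_le_of_lt ((ContinuousMap.dist_le (half_pos hε).le).2 fun x => ?_) (half_lt_self hε)
    have e1 : g x - f x = (a : ℂ)⁻¹ * ∫ s in (0 : ℝ)..a, (f (y s * x) - f x) := by
      rw [intervalIntegral.integral_sub ((hcx x).intervalIntegrable _ _)
        (intervalIntegrable_const), intervalIntegral.integral_const, hg, sub_zero, mul_sub,
        Complex.real_smul, inv_mul_cancel_left₀ (by exact_mod_cast ha0.ne')]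
    rw [dist_eq_norm, e1, norm_mul, hna, inv_mul_le_iff₀ ha0]
    have h2 := intervalIntegral.norm_integral_le_of_norm_le_const (a := 0) (b := a)
        (f := fun s => f (y s * x) - f x) (C := ε / 2) fun s hs => by
      rw [Set.uIoc_of_le ha0.le] at hs
      have h3 : dist s 0 < δ := by
        rw [Real.dist_eq, sub_zero, abs_of_pos hs.1]
        linarith [hs.2]
      rw [← dist_eq_norm]
      exact (ContinuousMap.dist_apply_le_dist (f := leftTranslate f (y s)) (g := f) x).trans
        (hδs h3).le
    rw [sub_zero, abs_of_pos ha0] at h2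
    linarith

variable [MeasurableSpace X] [BorelSpace X] {μ : Measure X} [μ.IsHaarMeasure]
  [IsProbabilityMeasure μ]

theorem dense_toLp_isFlowLipschitz {y : ℝ → X} (hy : Continuous y)
    (hy_add : ∀ s t : ℝ, y (s + t) = y s * y t) :
    Dense {v : Lp ℂ 2 μ | ∃ f : C(X, ℂ), IsFlowLipschitz y f ∧ ContinuousMap.toLp 2 μ ℂ f = v} := by
  have h1 : DenseRange (ContinuousMap.toLp 2 μ ℂ : C(X, ℂ) → Lp ℂ 2 μ) :=
    ContinuousMap.toLp_denseRange ℂ μ ℂ ENNReal.ofNat_ne_top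
  have h2 : Dense {f : C(X, ℂ) | IsFlowLipschitz y f} := fun f =>
    Metric.mem_closure_iff.2 fun ε hε => by
      obtain ⟨g, hg, hgf⟩ := exists_isFlowLipschitz_dist_lt hy hy_add f hε
      exact ⟨g, hg, by rwa [dist_comm]⟩
  exact h1.dense_image (ContinuousMap.toLp 2 μ ℂ).continuous h2

theorem norm_div_sub_div_le {p p' : ℂ} {s s' m B : ℝ} (hm : 0 < m) (hs : m ≤ |s|)
    (hs' : m ≤ |s'|) (hp' : ‖p'‖ ≤ B) :
    ‖p' / (s' : ℂ) - p / (s : ℂ)‖ ≤ m⁻¹ * ‖p' - p‖ + (m ^ 2)⁻¹ * B * |s' - s| := by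
  have hs0 : (s : ℂ) ≠ 0 := by
    have : s ≠ 0 := abs_pos.1 (hm.trans_le hs)
    exact_mod_cast this
  have hs0' : (s' : ℂ) ≠ 0 := by
    have : s' ≠ 0 := abs_pos.1 (hm.trans_le hs')
    exact_mod_cast this
  have e : p' / (s' : ℂ) - p / (s : ℂ) =
      (p' - p) / (s : ℂ) + p' * (((s - s' : ℝ) : ℂ) / (s * s')) := by
    push_cast
    field_simp
    ring
  have hB : 0 ≤ B := (norm_nonneg _).trans hp'
  have h1 : ‖(p' - p) / (s : ℂ)‖ ≤ m⁻¹ * ‖p' - p‖ := by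
    rw [norm_div, Complex.norm_real, Real.norm_eq_abs, div_eq_inv_mul]
    gcongr
  have h2 : ‖p' * (((s - s' : ℝ) : ℂ) / (s * s'))‖ ≤ (m ^ 2)⁻¹ * B * |s' - s| := by
    rw [norm_mul, norm_div, norm_mul, Complex.norm_real, Complex.norm_real, Complex.norm_real,
      Real.norm_eq_abs, Real.norm_eq_abs, Real.norm_eq_abs, abs_sub_comm s s', div_eq_inv_mul]
    have h3 : (|s| * |s'|)⁻¹ ≤ (m ^ 2)⁻¹ := by
      rw [sq]; gcongr
    calc ‖p'‖ * ((|s| * |s'|)⁻¹ * |s' - s|) ≤ B * ((m ^ 2)⁻¹ * |s' - s|) := by gcongr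
      _ = _ := by ring
  rw [e]
  exact (norm_add_le _ _).trans (add_le_add h1 h2)

theorem exists_norm_correlation_le {y : ℝ → X} (herg : Ergodic (fun x : X => y 1 * x) μ)
    {w : X → ℂ} (hwm : Measurable w) (hw1 : ∀ x, ‖w x‖ = 1) {S : C(X, ℝ)}
    (hw : HasPhaseDeriv μ y w S) (hS0 : ∫ x, S x ∂μ ≠ 0) {C : ℝ} (hC : ∀ᶠ t : ℝ in 𝓝[>] 0,
      eLpNorm (fun x => S (y t * x) - S x) 1 μ ≤ ENNReal.ofReal (t * C))
    {f d : C(X, ℂ)} (hf : IsFlowLipschitz y f) (hd : IsFlowLipschitz y d) :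
    ∃ R : ℝ, ∀ᶠ n : ℕ in atTop, ‖∫ x, star (d x) *
      ((∏ k ∈ Finset.range n, w (y 1 ^ k * x)) * f (y 1 ^ n * x)) ∂μ‖ ≤ R / n := by
  obtain ⟨Lf, hLf0, hLf⟩ := hf
  obtain ⟨Ld, hLd0, hLd⟩ := hd
  set κ := |∫ x, S x ∂μ| / 2 with hκ
  have hκ0 : 0 < κ := half_pos (abs_pos.2 hS0)
  set Lp := Ld * ‖f‖ + ‖d‖ * Lf with hLp
  have hLp0 : 0 ≤ Lp := by positivity
  set B := ‖d‖ * ‖f‖ with hB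
  have hB0 : 0 ≤ B := by positivity
  refine ⟨κ⁻¹ * Lp + (κ ^ 2)⁻¹ * B * |C|, ?_⟩
  filter_upwards [exists_forall_abs_birkhoffSum_ge herg S hS0, eventually_gt_atTop 0]
    with n hn hn0
  have hn0' : (0 : ℝ) < n := by exact_mod_cast hn0
  set m := κ * n with hm
  have hm0 : 0 < m := by positivity
  let Sn : C(X, ℝ) := ∑ k ∈ Finset.range n, leftTranslate S (y 1 ^ k)
  have hSn : ∀ x, Sn x = ∑ k ∈ Finset.range n, S (y 1 ^ k * x) := fun x => by
    simp only [Sn, ContinuousMap.sum_apply]; rfl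
  have hSm : ∀ x, m ≤ |Sn x| := fun x => by rw [hSn]; exact hn x
  have hSne : ∀ x, (Sn x : ℂ) ≠ 0 := fun x => by
    have : Sn x ≠ 0 := abs_pos.1 (hm0.trans_le (hSm x))
    exact_mod_cast this
  let wn : X → ℂ := fun x => ∏ k ∈ Finset.range n, w (y 1 ^ k * x)
  have hwn : HasPhaseDeriv μ y wn Sn := by
    have h1 := hw.prod (n := n) (fun k => y 1 ^ k) S.continuous.measurable
    have h2 : (fun x => ∑ k ∈ Finset.range n, S (y 1 ^ k * x)) = Sn := funext fun x => (hSn x).symm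
    rwa [h2] at h1
  have hwnm : Measurable wn :=
    Finset.measurable_fun_prod _ fun k _ => hwm.comp (measurable_const_mul _)
  have hwn1 : ∀ x, ‖wn x‖ = 1 := fun x => by
    simp only [wn, norm_prod, hw1, Finset.prod_const_one]
  let P : X → ℂ := fun x => star (d x) * f (y 1 ^ n * x)
  have hPc : Continuous P :=
    (d.continuous.star).mul (f.continuous.comp (continuous_const_mul _))
  have hPB : ∀ x, ‖P x‖ ≤ B := fun x => by
    rw [norm_mul, norm_star]
    exact mul_le_mul (d.norm_coe_le_norm _) (f.norm_coe_le_norm _) (norm_nonneg _) (norm_nonneg _)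
  have hPL : ∀ t x, 0 < t → ‖P (y t * x) - P x‖ ≤ t * Lp := fun t x ht => by
    have e : P (y t * x) - P x = star (d (y t * x) - d x) * f (y 1 ^ n * (y t * x)) +
        star (d x) * (f (y t * (y 1 ^ n * x)) - f (y 1 ^ n * x)) := by
      simp only [P, star_sub, mul_left_comm (y t)]
      ring
    rw [e]
    have h1 := hLd t x
    have h2 := hLf t (y 1 ^ n * x)
    rw [abs_of_pos ht] at h1 h2
    calc _ ≤ ‖d (y t * x) - d x‖ * ‖f (y 1 ^ n * (y t * x))‖ +
          ‖d x‖ * ‖f (y t * (y 1 ^ n * x)) - f (y 1 ^ n * x)‖ := by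
          refine (norm_add_le _ _).trans (le_of_eq ?_)
          rw [norm_mul, norm_mul, norm_star, norm_star]
      _ ≤ (Ld * t) * ‖f‖ + ‖d‖ * (Lf * t) := by
          gcongr
          exacts [f.norm_coe_le_norm _, d.norm_coe_le_norm _]
      _ = t * Lp := by rw [hLp]; ring
  let Φ : X → ℂ := fun x => P x / (Sn x : ℂ)
  have hΦc : Continuous Φ :=
    hPc.div (Complex.continuous_ofReal.comp Sn.continuous) hSne
  have hΦM : ∀ x, ‖Φ x‖ ≤ B / m := fun x => by
    rw [norm_div, Complex.norm_real, Real.norm_eq_abs]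
    exact div_le_div₀ hB0 (hPB x) hm0 (hSm x)
  have hSnL : ∀ᶠ t : ℝ in 𝓝[>] 0,
      eLpNorm (fun x => Sn (y t * x) - Sn x) 1 μ ≤ n * ENNReal.ofReal (t * |C|) := by
    filter_upwards [hC, self_mem_nhdsWithin] with t ht ht0
    have ht0 : (0 : ℝ) < t := ht0
    have hmS : ∀ a : X, AEStronglyMeasurable (fun x => S (y t * x) - S x) μ := fun a =>
      ((S.continuous.comp (continuous_const_mul _)).sub S.continuous).aestronglyMeasurable
    have hmk : ∀ k, AEStronglyMeasurable
        (fun x => S (y t * (y 1 ^ k * x)) - S (y 1 ^ k * x)) μ := fun k =>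
      (hmS 1).comp_measurePreserving (measurePreserving_mul_left μ (y 1 ^ k))
    have e : (fun x => Sn (y t * x) - Sn x) =
        ∑ k ∈ Finset.range n, fun x => S (y t * (y 1 ^ k * x)) - S (y 1 ^ k * x) := by
      ext x
      rw [hSn, hSn, Finset.sum_apply, ← Finset.sum_sub_distrib]
      simp only [mul_left_comm (y t)]
    rw [e]
    refine (eLpNorm_sum_le (fun k _ => hmk k) le_rfl).trans ?_
    calc _ ≤ ∑ k ∈ Finset.range n, ENNReal.ofReal (t * |C|) := by
          refine Finset.sum_le_sum fun k _ => ?_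
          have h3 := eLpNorm_comp_measurePreserving (p := 1) (hmS 1)
            (measurePreserving_mul_left μ (y 1 ^ k))
          refine (le_of_eq h3).trans (ht.trans (ENNReal.ofReal_le_ofReal ?_))
          exact mul_le_mul_of_nonneg_left (le_abs_self C) ht0.le
      _ = _ := by rw [Finset.sum_const, Finset.card_range, nsmul_eq_mul]
  have hfin := hwn.norm_integral_le hwnm hwn1 Sn.continuous.measurable
    (B := ‖Sn‖) (fun x => Sn.norm_coe_le_norm x) hΦc.measurable hΦM
    (L := (κ⁻¹ * Lp + (κ ^ 2)⁻¹ * B * |C|) / n) (by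
      filter_upwards [hSnL, self_mem_nhdsWithin] with t ht ht0
      have ht0 : (0 : ℝ) < t := ht0
      have hpt : ∀ x, ‖Φ (y t * x) - Φ x‖ₑ ≤ ENNReal.ofReal (m⁻¹ * (t * Lp)) +
          ENNReal.ofReal ((m ^ 2)⁻¹ * B) * ‖Sn (y t * x) - Sn x‖ₑ := fun x => by
        rw [← ofReal_norm, Real.enorm_eq_ofReal_abs,
          ← ENNReal.ofReal_mul (by positivity : 0 ≤ (m ^ 2)⁻¹ * B),
          ← ENNReal.ofReal_add (by positivity) (by positivity)]
        refine ENNReal.ofReal_le_ofReal ?_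
        refine (norm_div_sub_div_le hm0 (hSm _) (hSm _) (hPB _)).trans ?_
        gcongr
        exact hPL t x ht0
      rw [eLpNorm_one_eq_lintegral_enorm] at ht ⊢
      refine (lintegral_mono hpt).trans ?_
      rw [lintegral_add_left measurable_const, lintegral_const, measure_univ, mul_one,
        lintegral_const_mul' _ _ ENNReal.ofReal_ne_top]
      calc _ ≤ ENNReal.ofReal (m⁻¹ * (t * Lp)) + ENNReal.ofReal ((m ^ 2)⁻¹ * B) *
            (n * ENNReal.ofReal (t * |C|)) := by gcongr
        _ = _ := by
          rw [← ENNReal.ofReal_natCast, ← ENNReal.ofReal_mul (by positivity),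
            ← ENNReal.ofReal_mul (by positivity),
            ← ENNReal.ofReal_add (by positivity) (by positivity)]
          congr 1
          rw [hm]
          field_simp)
  have e : ∀ x, wn x * Sn x * Φ x = star (d x) *
      ((∏ k ∈ Finset.range n, w (y 1 ^ k * x)) * f (y 1 ^ n * x)) := fun x => by
    have h1 : (Sn x : ℂ) * Φ x = P x := mul_div_cancel₀ _ (hSne x)
    rw [mul_assoc, h1]
    change wn x * (star (d x) * f (y 1 ^ n * x)) = star (d x) * (wn x * f (y 1 ^ n * x))
    ring
  simp only [e] at hfin
  rw [← ofReal_norm] at hfin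
  exact (ENNReal.ofReal_le_ofReal_iff (by positivity)).1 hfin

end Decay

section Transfer

variable {K H H' : Type*} [NormedAddCommGroup K] [InnerProductSpace ℂ K]
  [NormedAddCommGroup H] [InnerProductSpace ℂ H] [NormedAddCommGroup H'] [InnerProductSpace ℂ H']

theorem exists_seq_intertwiners [SecondCountableTopology H] {S : K ≃ₗᵢ[ℂ] K} {U : H ≃ₗᵢ[ℂ] H}
    {M : Submodule ℂ H} {Y : Set H} (hY : Y.Nonempty)
    (hYM : M ≤ (Submodule.span ℂ Y).topologicalClosure) (hMc : IsClosed (M : Set H))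
    (hT : ∀ f ∈ Y, ∃ T : K →L[ℂ] H, Intertwines S U T ∧ (∀ x, T x ∈ M) ∧
      f ∈ (LinearMap.range T.toLinearMap).topologicalClosure) :
    ∃ T : ℕ → K →L[ℂ] H, (∀ i, Intertwines S U (T i)) ∧
      (⨆ i, LinearMap.range (T i).toLinearMap).topologicalClosure = M := by
  obtain ⟨t, htY, htc, hYt⟩ :=
    (TopologicalSpace.IsSeparable.of_separableSpace Y).exists_countable_dense_subset
  have htne : t.Nonempty := by
    obtain ⟨f, hf⟩ := hY
    exact closure_nonempty_iff.1 ⟨f, hYt hf⟩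
  obtain ⟨v, rfl⟩ := htc.exists_eq_range htne
  choose T hTU hTM hTv using fun i => hT (v i) (htY ⟨i, rfl⟩)
  refine ⟨T, hTU, le_antisymm (Submodule.topologicalClosure_minimal _ (iSup_le fun i => ?_) hMc)
    (hYM.trans (Submodule.topologicalClosure_minimal _ (Submodule.span_le.2 ?_)
      (Submodule.isClosed_topologicalClosure _)))⟩
  · rintro _ ⟨x, rfl⟩
    exact hTM i x
  · refine hYt.trans (closure_minimal ?_ (Submodule.isClosed_topologicalClosure _))
    rintro _ ⟨i, rfl⟩
    exact Submodule.topologicalClosure_mono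
      (le_iSup (fun i => LinearMap.range (T i).toLinearMap) i) (hTv i)

theorem IsSpectralMeasure.map {U : H ≃ₗᵢ[ℂ] H} {W : H' ≃ₗᵢ[ℂ] H'} {J : H →L[ℂ] H'}
    (hJ : Intertwines U W J) (hJJ : ∀ x z, inner ℂ (J x) (J z) = inner ℂ x z) {f : H}
    {σ : Measure UnitAddCircle} (hσ : IsSpectralMeasure U f σ) : IsSpectralMeasure W (J f) σ :=
  ⟨hσ.1, fun n => by rw [hσ.2, ← hJ.map_zpow, hJJ]⟩

theorem HasLebesgueSpectrumOn.map {U : H ≃ₗᵢ[ℂ] H} {W : H' ≃ₗᵢ[ℂ] H'} {J : H →L[ℂ] H'}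
    (hJ : Intertwines U W J) (hJJ : ∀ x z, inner ℂ (J x) (J z) = inner ℂ x z)
    (hU : HasLebesgueSpectrumOn U ⊤) :
    HasLebesgueSpectrumOn W (LinearMap.range J.toLinearMap) := by
  refine ⟨hJ.map_mem_range_iff, ?_, ?_⟩
  · rintro _ ⟨f, rfl⟩
    obtain ⟨σ, hσ, hσ'⟩ := hU.2.1 f trivial
    exact ⟨σ, hσ.map hJ hJJ, hσ'⟩
  · obtain ⟨f, -, σ, hσ, hσ'⟩ := hU.2.2
    exact ⟨J f, ⟨f, rfl⟩, σ, hσ.map hJ hJJ, hσ'⟩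

theorem hasLebesgueSpectrumOn_top [CompleteSpace H] {U : H ≃ₗᵢ[ℂ] H} {T : ℕ → CircleL2 →L[ℂ] H}
    (hT : ∀ i, Intertwines circleShift U (T i))
    (hTd : (⨆ i, LinearMap.range (T i).toLinearMap).topologicalClosure = ⊤)
    {J : CircleL2 →L[ℂ] H} (hJ : Intertwines circleShift U J)
    (hJJ : ∀ x z, inner ℂ (J x) (J z) = inner ℂ x z) : HasLebesgueSpectrumOn U ⊤ := by
  refine ⟨fun f => by simp, fun f _ => exists_spectralMeasure hT (hTd ▸ trivial),
    J (fourierBasis 0), trivial, _, isSpectralMeasure_haarAddCircle hJ hJJ,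
    Measure.AbsolutelyContinuous.rfl, Measure.AbsolutelyContinuous.rfl⟩

end Transfer

section Fiber

variable {X : Type*} [MeasurableSpace X]

variable {G : Type*} [CommGroup G] [MeasurableSpace G] [TopologicalSpace G]

/-- The isometry `ψ ↦ ψ ⊗ χ` of `L²(X)` onto `L_χ`. -/
noncomputable def fiberEmbedding [BorelSpace G] (μ : Measure X) [SFinite μ] (ν : Measure G)
    [IsProbabilityMeasure ν] (χ : PontryaginDual G) : Lp ℂ 2 μ →ₗᵢ[ℂ] Lp ℂ 2 (μ.prod ν) :=
  (weightedCompₗᵢ id (MeasurePreserving.id _) (fun p : X × G => (χ p.2 : ℂ))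
    ((measurable_character χ).comp measurable_snd) (fun _ => Circle.norm_coe _)).comp
  (Lp.compMeasurePreservingₗᵢ ℂ Prod.fst measurePreserving_fst)

theorem fiberEmbedding_coeFn [BorelSpace G] (μ : Measure X) [SFinite μ] (ν : Measure G)
    [IsProbabilityMeasure ν] (χ : PontryaginDual G) (ψ : Lp ℂ 2 μ) :
    fiberEmbedding μ ν χ ψ =ᵐ[μ.prod ν] fun p => ψ p.1 * (χ p.2 : ℂ) := by
  have h1 : fiberEmbedding μ ν χ ψ =ᵐ[μ.prod ν] fun p => (χ p.2 : ℂ) *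
      (Lp.compMeasurePreservingₗᵢ ℂ Prod.fst measurePreserving_fst ψ : Lp ℂ 2 (μ.prod ν)) p :=
    weightedCompₗᵢ_coeFn id (MeasurePreserving.id _) (fun p : X × G => (χ p.2 : ℂ))
      ((measurable_character χ).comp measurable_snd) (fun _ => Circle.norm_coe _) _
  have h2 : (Lp.compMeasurePreservingₗᵢ ℂ Prod.fst measurePreserving_fst ψ :
      Lp ℂ 2 (μ.prod ν)) =ᵐ[μ.prod ν] ψ ∘ Prod.fst :=
    Lp.coeFn_compMeasurePreserving ψ measurePreserving_fst
  filter_upwards [h1, h2] with p e1 e2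
  rw [e1, e2, mul_comm]
  rfl

theorem fiberSubspace_eq_range [BorelSpace G] (μ : Measure X) [SFinite μ] (ν : Measure G)
    [IsProbabilityMeasure ν] (χ : PontryaginDual G) : fiberSubspace μ ν χ =
      LinearMap.range (fiberEmbedding μ ν χ).toContinuousLinearMap.toLinearMap := by
  ext Ψ
  constructor
  · rintro ⟨ψ, h⟩
    refine ⟨ψ, ?_⟩
    apply Lp.ext
    filter_upwards [h, fiberEmbedding_coeFn μ ν χ ψ] with p e1 e2
    rw [e1]
    exact e2
  · rintro ⟨ψ, rfl⟩
    exact ⟨ψ, fiberEmbedding_coeFn μ ν χ ψ⟩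

theorem fiberEmbedding_intertwines [CommGroup X] [MeasurableMul X] [BorelSpace G]
    [MeasurableMul₂ G] [MeasurableInv G] (μ : Measure X) [μ.IsMulLeftInvariant] [SFinite μ]
    (ν : Measure G) [ν.IsMulLeftInvariant]
    [IsProbabilityMeasure ν] (a : X) (φ : X → G) (hφ : Measurable φ) (χ : PontryaginDual G) :
    Intertwines (fiberKoopman μ a φ hφ χ) (skewKoopman μ ν a φ hφ)
      (fiberEmbedding μ ν χ).toContinuousLinearMap := by
  intro ψ
  apply Lp.ext
  have h1 := fiberEmbedding_coeFn μ ν χ (fiberKoopman μ a φ hφ χ ψ)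
  have h2 : fiberKoopman μ a φ hφ χ ψ =ᵐ[μ] fun x => (χ (φ x) : ℂ) * ψ (a * x) :=
    weightedKoopman_coeFn _ _ _ _ _ ψ
  have h3 : skewKoopman μ ν a φ hφ (fiberEmbedding μ ν χ ψ) =ᵐ[μ.prod ν] fun p =>
      1 * (fiberEmbedding μ ν χ ψ) (skewProduct a φ hφ p) :=
    weightedKoopman_coeFn _ _ _ _ _ _
  have h4 := (measurePreserving_skewProduct μ ν a φ hφ).quasiMeasurePreserving.ae
    (fiberEmbedding_coeFn μ ν χ ψ)
  filter_upwards [h1, Measure.quasiMeasurePreserving_fst.ae h2, h3, h4] with p e1 e2 e3 e4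
  refine Eq.trans e1 (Eq.trans ?_ e3.symm)
  rw [e4, e2]
  change (χ (φ p.1) : ℂ) * ψ (a * p.1) * (χ p.2 : ℂ) =
    1 * (ψ (a * p.1) * (χ (φ p.1 * p.2) : ℂ))
  rw [map_mul, Circle.coe_mul]
  ring

theorem integral_star_character_mul_eq_zero [IsTopologicalGroup G] [BorelSpace G] (ν : Measure G)
    [ν.IsMulLeftInvariant] {χ χ' : PontryaginDual G} (h : χ ≠ χ') :
    ∫ z, star (χ z : ℂ) * (χ' z : ℂ) ∂ν = 0 := by
  obtain ⟨z₀, hz₀⟩ := DFunLike.ne_iff.1 h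
  set I := ∫ z, star (χ z : ℂ) * (χ' z : ℂ) ∂ν with hI
  have h1 : star (χ z₀ : ℂ) * (χ' z₀ : ℂ) * I = I := by
    conv_rhs => rw [hI, ← integral_mul_left_eq_self _ z₀]
    rw [hI, ← integral_const_mul]
    refine integral_congr_ae (ae_of_all _ fun z => ?_)
    simp only [map_mul, Circle.coe_mul, star_mul']
    ring
  by_contra hI0
  have h2 : star (χ z₀ : ℂ) * (χ' z₀ : ℂ) = 1 := mul_right_cancel₀ hI0 (by rw [h1, one_mul])
  refine hz₀ (Circle.ext ?_)
  have h3 : (χ z₀ : ℂ) * star (χ z₀ : ℂ) = 1 := by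
    rw [RCLike.star_def, Complex.mul_conj, Circle.normSq_coe, Complex.ofReal_one]
  calc (χ z₀ : ℂ) = χ z₀ * (star (χ z₀ : ℂ) * (χ' z₀ : ℂ)) := by rw [h2, mul_one]
    _ = χ' z₀ := by rw [← mul_assoc, h3, one_mul]

theorem inner_fiberEmbedding_eq_zero [IsTopologicalGroup G] [BorelSpace G] (μ : Measure X)
    [SFinite μ] (ν : Measure G) [ν.IsMulLeftInvariant] [IsProbabilityMeasure ν]
    {χ χ' : PontryaginDual G} (h : χ ≠ χ') (ψ ψ' : Lp ℂ 2 μ) :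
    inner ℂ (fiberEmbedding μ ν χ ψ) (fiberEmbedding μ ν χ' ψ') = 0 := by
  rw [L2.inner_def]
  have e : ∀ᵐ p ∂μ.prod ν, inner ℂ (fiberEmbedding μ ν χ ψ p) (fiberEmbedding μ ν χ' ψ' p) =
      (star (ψ p.1) * ψ' p.1) * (star (χ p.2 : ℂ) * (χ' p.2 : ℂ)) := by
    filter_upwards [fiberEmbedding_coeFn μ ν χ ψ, fiberEmbedding_coeFn μ ν χ' ψ'] with p e1 e2
    rw [e1, e2, RCLike.inner_apply, map_mul, RCLike.star_def]
    ring
  rw [integral_congr_ae e, integral_prod_mul (fun x => star (ψ x) * ψ' x)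
    (fun z => star (χ z : ℂ) * (χ' z : ℂ)), integral_star_character_mul_eq_zero ν h, mul_zero]

theorem fiberKoopman_pow_coeFn [CommGroup X] [MeasurableMul X] [BorelSpace G]
    (μ : Measure X) [μ.IsMulLeftInvariant] (a : X) (φ : X → G) (hφ : Measurable φ)
    (χ : PontryaginDual G) (n : ℕ) (f : Lp ℂ 2 μ) :
    (fiberKoopman μ a φ hφ χ ^ (n : ℤ)) f =ᵐ[μ] fun x =>
      (∏ k ∈ Finset.range n, (χ (φ (a ^ k * x)) : ℂ)) * f (a ^ n * x) := by
  induction n with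
  | zero => exact ae_of_all _ fun x => by simp
  | succ n ih =>
    push_cast
    rw [← zpow_succ_apply]
    have h1 : fiberKoopman μ a φ hφ χ ((fiberKoopman μ a φ hφ χ ^ (n : ℤ)) f) =ᵐ[μ]
        fun x => (χ (φ x) : ℂ) * ((fiberKoopman μ a φ hφ χ ^ (n : ℤ)) f : Lp ℂ 2 μ) (a * x) :=
      weightedKoopman_coeFn _ _ _ _ _ _
    filter_upwards [h1, (measurePreserving_mul_left μ a).quasiMeasurePreserving.ae ih]
      with x e1 e2
    rw [e1, e2, Finset.prod_range_succ']
    simp only [pow_succ, pow_zero, one_mul, mul_assoc]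
    ring

end Fiber

theorem summable_norm_inner_zpow_sq {H : Type*} [NormedAddCommGroup H] [InnerProductSpace ℂ H]
    {U : H ≃ₗᵢ[ℂ] H} {D : Set H} (h : ∀ f ∈ D, ∀ d ∈ D, ∃ R : ℝ, ∀ᶠ n : ℕ in atTop,
      ‖inner ℂ d ((U ^ (n : ℤ)) f)‖ ≤ R / n) {f d : H} (hf : f ∈ D) (hd : d ∈ D) :
    Summable fun n : ℤ => ‖inner ℂ d ((U ^ n) f)‖ ^ 2 := by
  have key : ∀ f ∈ D, ∀ d ∈ D, Summable fun n : ℕ => ‖inner ℂ d ((U ^ (n : ℤ)) f)‖ ^ 2 := by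
    intro f hf d hd
    obtain ⟨R, hR⟩ := h f hf d hd
    have hs : Summable fun n : ℕ => R ^ 2 * (1 / (n : ℝ) ^ 2) :=
      (Real.summable_one_div_nat_pow.2 one_lt_two).mul_left _
    refine hs.of_norm_bounded_eventually_nat ?_
    filter_upwards [hR] with n hn
    rw [Real.norm_of_nonneg (by positivity), mul_one_div, ← div_pow]
    gcongr
  refine summable_int_iff_summable_nat_and_neg.2 ⟨key f hf d hd, (key d hd f hf).congr fun n => ?_⟩
  have e : (U ^ (n : ℤ)) ((U ^ (-(n : ℤ))) f) = f := by
    rw [← linearIsometryEquiv_mul_apply, ← zpow_add, add_neg_cancel, zpow_zero]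
    rfl
  rw [← (U ^ (n : ℤ)).inner_map_map d, e, norm_inner_symm]

theorem pow_apply_of_add {X : Type*} [Group X] {y : ℝ → X}
    (hy_add : ∀ s t : ℝ, y (s + t) = y s * y t)
    (t : ℝ) (n : ℕ) : y t ^ n = y (n * t) := by
  induction n with
  | zero =>
    have h := hy_add 0 0
    rw [add_zero] at h
    have h' : y 0 = 1 := by simpa using h
    simp [h']
  | succ n ih => rw [pow_succ, ih, ← hy_add]; congr 1; push_cast; ring

section Rigidity

variable {X : Type*} [MetricSpace X] [CommGroup X] [MeasurableSpace X] [BorelSpace X]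
  {μ : Measure X} [μ.IsHaarMeasure] {y : ℝ → X}

theorem character_eq_one_of_apply_eq_one {a : X} (herg : Ergodic (fun x : X => a * x) μ)
    {θ : X →* Circle} (hθ : Continuous θ) (h : θ a = 1) (x : X) : θ x = 1 := by
  obtain ⟨c, hc⟩ := herg.ae_eq_const_of_ae_eq_comp_ae (g := θ) hθ.aestronglyMeasurable
    (ae_of_all _ fun x => by simp [h])
  have h2 := (hθ.ae_eq_iff_eq μ continuous_const).1 hc
  rw [h2, ← map_one θ, h2]

theorem character_eq_one_of_apply_pow_eq_one (hy_add : ∀ s t : ℝ, y (s + t) = y s * y t)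
    (herg : Ergodic (fun x : X => y 1 * x) μ) {θ : X →* Circle} (hθ : Continuous θ) {k : ℕ}
    (hk : k ≠ 0) (h : θ (y 1) ^ k = 1) (x : X) : θ x = 1 := by
  have h1 : ∀ x, (θ ^ k) x = 1 :=
    character_eq_one_of_apply_eq_one herg (hθ.pow k) h
  refine character_eq_one_of_apply_eq_one herg hθ ?_ x
  have h2 := pow_apply_of_add hy_add (1 / k) k
  rw [mul_one_div_cancel (Nat.cast_ne_zero.2 hk)] at h2
  rw [← h2, map_pow]
  exact h1 _

theorem exists_hasPhaseDeriv_character_mul [CompactSpace X] [IsTopologicalGroup X]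
    [IsProbabilityMeasure μ] (hy : Continuous y)
    (hy_add : ∀ s t : ℝ, y (s + t) = y s * y t) (herg : Ergodic (fun x : X => y 1 * x) μ)
    {θ : X →* Circle} (hθ : Continuous θ) (hθ1 : ∃ x, θ x ≠ 1) {u : X → ℂ} (hum : Measurable u)
    (hu1 : ∀ x, ‖u x‖ = 1) (hu : IsFlowRegular μ y u) :
    ∃ S : C(X, ℝ), HasPhaseDeriv μ y (fun x => (θ x : ℂ) * u x) S ∧ ∫ x, S x ∂μ ≠ 0 ∧
      ∃ C : ℝ, ∀ᶠ t : ℝ in 𝓝[>] 0,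
        eLpNorm (fun x => S (y t * x) - S x) 1 μ ≤ ENNReal.ofReal (t * C) := by
  obtain ⟨ρ, hρ, hph, hint, C, hC⟩ := hu.exists_hasPhaseDeriv hum hu1
  obtain ⟨c, hc⟩ := exists_eq_exp_of_continuous_character (f := fun t => (θ (y t) : ℂ))
    (continuous_subtype_val.comp (hθ.comp hy))
    (fun s t => by rw [hy_add, map_mul, Circle.coe_mul]) (fun t => Circle.norm_coe _)
  have hc0 : c ≠ 0 := by
    rintro rfl
    obtain ⟨x, hx⟩ := hθ1
    refine hx (character_eq_one_of_apply_eq_one herg hθ (Circle.ext ?_) x)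
    rw [hc 1]
    simp
  have h1 : HasPhaseDeriv μ y (fun x => (θ x : ℂ)) (fun _ => c) := by
    refine ⟨fun _ _ => c, fun _ => aestronglyMeasurable_const, fun t _ => ae_of_all _ fun x => ?_,
      by simp⟩
    beta_reduce
    rw [map_mul, Circle.coe_mul, hc t, mul_comm, mul_comm c t]
  refine ⟨⟨fun x => c + ρ x, continuous_const.add hρ⟩,
    h1.mul aestronglyMeasurable_const hρ.aestronglyMeasurable hph, ?_, C, ?_⟩
  · have h2 : Integrable ρ μ :=
      hρ.integrable_of_hasCompactSupport (HasCompactSupport.of_compactSpace ρ)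
    simpa [integral_add (integrable_const c) h2, hint] using hc0
  · filter_upwards [hC] with t ht
    simpa using ht

end Rigidity

section Twisted

variable {X : Type*} [MetricSpace X] [CommGroup X] [IsTopologicalGroup X]
  [MeasurableSpace X] [BorelSpace X] {μ : Measure X} [μ.IsHaarMeasure]
  {y : ℝ → X} {G : Type*} [TopologicalSpace G] [CommGroup G] [MeasurableSpace G] [BorelSpace G]

theorem exists_norm_inner_fiberKoopman_le [CompactSpace X] [IsProbabilityMeasure μ]
    (herg : Ergodic (fun x : X => y 1 * x) μ)
    {φ : X → G} (hφ : Measurable φ) (χ : PontryaginDual G) {S : C(X, ℝ)}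
    (hw : HasPhaseDeriv μ y (fun x => (χ (φ x) : ℂ)) S) (hS0 : ∫ x, S x ∂μ ≠ 0) {C : ℝ}
    (hC : ∀ᶠ t : ℝ in 𝓝[>] 0,
      eLpNorm (fun x => S (y t * x) - S x) 1 μ ≤ ENNReal.ofReal (t * C))
    {f d : C(X, ℂ)} (hf : IsFlowLipschitz y f) (hd : IsFlowLipschitz y d) :
    ∃ R : ℝ, ∀ᶠ n : ℕ in atTop, ‖inner ℂ (ContinuousMap.toLp 2 μ ℂ d)
      ((fiberKoopman μ (y 1) φ hφ χ ^ (n : ℤ)) (ContinuousMap.toLp 2 μ ℂ f))‖ ≤ R / n := by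
  obtain ⟨R, hR⟩ := exists_norm_correlation_le herg ((measurable_character χ).comp hφ)
    (fun _ => Circle.norm_coe _) hw hS0 hC hf hd
  refine ⟨R, hR.mono fun n hn => ?_⟩
  rw [L2.inner_def]
  refine (congrArg norm (integral_congr_ae ?_)).trans_le hn
  filter_upwards [fiberKoopman_pow_coeFn μ (y 1) φ hφ χ n (ContinuousMap.toLp 2 μ ℂ f),
    ContinuousMap.coeFn_toLp (p := 2) μ (𝕜 := ℂ) d,
    (measurePreserving_mul_left μ (y 1 ^ n)).quasiMeasurePreserving.ae
      (ContinuousMap.coeFn_toLp (p := 2) μ (𝕜 := ℂ) f)] with x e1 e2 e3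
  rw [e1, e2, e3, RCLike.inner_apply, mul_comm]
  rfl

theorem exists_intertwiner_fiberKoopman [CompactSpace X] [IsProbabilityMeasure μ]
    (hy : Continuous y)
    (hy_add : ∀ s t : ℝ, y (s + t) = y s * y t) (herg : Ergodic (fun x : X => y 1 * x) μ)
    {φ : X → G} (hφ : Measurable φ) (χ : PontryaginDual G) {S : C(X, ℝ)}
    (hw : HasPhaseDeriv μ y (fun x => (χ (φ x) : ℂ)) S) (hS0 : ∫ x, S x ∂μ ≠ 0) {C : ℝ}
    (hC : ∀ᶠ t : ℝ in 𝓝[>] 0,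
      eLpNorm (fun x => S (y t * x) - S x) 1 μ ≤ ENNReal.ofReal (t * C))
    {f : C(X, ℂ)} (hf : IsFlowLipschitz y f) :
    ∃ T : CircleL2 →L[ℂ] Lp ℂ 2 μ, Intertwines circleShift (fiberKoopman μ (y 1) φ hφ χ) T ∧
      ContinuousMap.toLp 2 μ ℂ f ∈ (LinearMap.range T.toLinearMap).topologicalClosure := by
  refine exists_intertwiner_of_summable fourierBasis circleShift_fourierBasis _
    (dense_toLp_isFlowLipschitz hy hy_add) _ fun d hd => summable_norm_inner_zpow_sq
      (D := {v | ∃ f, IsFlowLipschitz y f ∧ ContinuousMap.toLp 2 μ ℂ f = v}) ?_ ⟨f, hf, rfl⟩ hd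
  rintro _ ⟨f, hf, rfl⟩ _ ⟨d, hd, rfl⟩
  exact exists_norm_inner_fiberKoopman_le herg hφ χ hw hS0 hC hf hd

theorem exists_isometric_intertwiner_fiberKoopman (hy_add : ∀ s t : ℝ, y (s + t) = y s * y t)
    (herg : Ergodic (fun x : X => y 1 * x) μ) {φ : X → G} (hφ : Measurable φ)
    (χ : PontryaginDual G) {θ : X →* Circle} (hθ : Continuous θ) (hθ1 : ∃ x, θ x ≠ 1)
    {T : CircleL2 →L[ℂ] Lp ℂ 2 μ} (hT : Intertwines circleShift (fiberKoopman μ (y 1) φ hφ χ) T)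
    (hT0 : T ≠ 0) :
    ∃ J : CircleL2 →L[ℂ] Lp ℂ 2 μ, Intertwines circleShift (fiberKoopman μ (y 1) φ hφ χ) J ∧
      ∀ x z, inner ℂ (J x) (J z) = inner ℂ x z := by
  obtain ⟨α, hα⟩ := (AddCircle.homeomorphCircle (T := 1) one_ne_zero).surjective (θ (y 1))
  rw [AddCircle.homeomorphCircle_apply] at hα
  have hcm : ∀ k : ℕ, Measurable fun x => ((θ x ^ k : Circle) : ℂ) := fun k =>
    (continuous_subtype_val.comp (hθ.pow k)).measurable
  refine exists_isometric_intertwiner_of_rotation hT hT0 (α := α) ?_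
    (fun k => weightedKoopman (MeasurableEquiv.refl X) (MeasurePreserving.id μ)
      (fun x => ((θ x ^ k : Circle) : ℂ)) (hcm k) fun _ => Circle.norm_coe _) fun k x => ?_
  · refine addOrderOf_eq_zero_iff'.2 fun n hn h => ?_
    obtain ⟨x, hx⟩ := hθ1
    refine hx (character_eq_one_of_apply_pow_eq_one hy_add herg hθ hn.ne' ?_ x)
    rw [← hα, ← AddCircle.toCircle_nsmul, h, AddCircle.toCircle_zero]
  · set κ := weightedKoopman (MeasurableEquiv.refl X) (MeasurePreserving.id μ)
      (fun x => ((θ x ^ k : Circle) : ℂ)) (hcm k) fun _ => Circle.norm_coe _ with hκ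
    have hκc : ∀ f, κ f =ᵐ[μ] fun x => ((θ x ^ k : Circle) : ℂ) * f x := fun f =>
      weightedKoopman_coeFn _ _ _ _ _ f
    have hUc : ∀ f, fiberKoopman μ (y 1) φ hφ χ f =ᵐ[μ] fun x => (χ (φ x) : ℂ) * f (y 1 * x) :=
      fun f => weightedKoopman_coeFn _ _ _ _ _ f
    apply Lp.ext
    filter_upwards [hUc (κ x), (measurePreserving_mul_left μ (y 1)).quasiMeasurePreserving.ae
      (hκc x), Lp.coeFn_smul (fourier 1 (k • α) : ℂ) (κ (fiberKoopman μ (y 1) φ hφ χ x)),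
      hκc (fiberKoopman μ (y 1) φ hφ χ x), hUc x] with z e1 e2 e3 e4 e5
    rw [e1, e2, e3, Pi.smul_apply, e4, e5, fourier_one, AddCircle.toCircle_nsmul, hα, map_mul,
      mul_pow, Circle.coe_mul, smul_eq_mul]
    ring

end Twisted

section Character

variable {X G : Type*} [TopologicalSpace X] [Monoid X] [TopologicalSpace G] [CommGroup G]

/-- The character `χ ∘ ξ` of `X`. -/
noncomputable def pullbackCharacter (ξ : X →ₜ* G) (χ : PontryaginDual G) : X →* Circle where
  toFun x := χ (ξ x)
  map_one' := by simp
  map_mul' := by simp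

theorem continuous_pullbackCharacter (ξ : X →ₜ* G) (χ : PontryaginDual G) :
    Continuous (pullbackCharacter ξ χ) :=
  (map_continuous χ).comp ξ.continuous

theorem character_pow_apply (χ : PontryaginDual G) (n : ℕ) (z : G) : (χ ^ n) z = χ z ^ n := by
  induction n with
  | zero => rfl
  | succ n ih => rw [pow_succ, pow_succ, ← ih]; rfl

end Character

section SkewProduct

variable {X : Type*} [MetricSpace X] [CommGroup X] [MeasurableSpace X] [BorelSpace X]
  {μ : Measure X} [μ.IsHaarMeasure] {G : Type*} [TopologicalSpace G] [CommGroup G]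
  {y : ℝ → X} {ξ : X →ₜ* G}

theorem exists_intertwiners_of_isFlowRegular [CompactSpace X] [IsTopologicalGroup X]
    [IsProbabilityMeasure μ] [MeasurableSpace G] [BorelSpace G] (hy : Continuous y)
    (hy_add : ∀ s t : ℝ, y (s + t) = y s * y t) (herg : Ergodic (fun x : X => y 1 * x) μ)
    {φ : X → G} (hφ : Measurable φ) {η : X → G} (hφξη : ∀ x, φ x = ξ x * η x) {χ : PontryaginDual G}
    (hχ : ∃ x, χ (ξ x) ≠ 1) (hη : IsFlowRegular μ y (fun x => (χ (η x) : ℂ))) :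
    (∃ J : CircleL2 →L[ℂ] Lp ℂ 2 μ, Intertwines circleShift (fiberKoopman μ (y 1) φ hφ χ) J ∧
      ∀ x z, inner ℂ (J x) (J z) = inner ℂ x z) ∧
    ∀ f, IsFlowLipschitz y f → ∃ T : CircleL2 →L[ℂ] Lp ℂ 2 μ,
      Intertwines circleShift (fiberKoopman μ (y 1) φ hφ χ) T ∧
      ContinuousMap.toLp 2 μ ℂ f ∈ (LinearMap.range T.toLinearMap).topologicalClosure := by
  set θ := pullbackCharacter ξ χ with hθ
  have hθc : Continuous θ := continuous_pullbackCharacter ξ χ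
  have hw : ∀ x, (χ (φ x) : ℂ) = (θ x : ℂ) * (χ (η x) : ℂ) := fun x => by
    rw [hφξη, map_mul, Circle.coe_mul]
    rfl
  have hu : (fun x => (χ (η x) : ℂ)) = fun x => (θ x : ℂ)⁻¹ * (χ (φ x) : ℂ) := by
    funext x
    rw [hw, inv_mul_cancel_left₀ (Circle.coe_ne_zero _)]
  have hum : Measurable fun x => (χ (η x) : ℂ) := by
    rw [hu]
    exact (continuous_subtype_val.comp hθc).measurable.inv.mul ((measurable_character χ).comp hφ)
  obtain ⟨S, hS, hS0, C, hC⟩ := exists_hasPhaseDeriv_character_mul hy hy_add herg hθc hχ hum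
    (fun _ => Circle.norm_coe _) hη
  have hS' : HasPhaseDeriv μ y (fun x => (χ (φ x) : ℂ)) S := by
    rwa [funext hw]
  have hT := fun f hf => exists_intertwiner_fiberKoopman hy hy_add herg hφ χ hS' hS0 hC (f := f) hf
  refine ⟨?_, hT⟩
  obtain ⟨T, hTU, h1⟩ := hT 1 ⟨0, le_rfl, by simp⟩
  refine exists_isometric_intertwiner_fiberKoopman hy_add herg hφ χ hθc hχ hTU ?_
  rintro rfl
  have h2 : LinearMap.range (0 : CircleL2 →L[ℂ] Lp ℂ 2 μ).toLinearMap = ⊥ := LinearMap.range_zero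
  rw [h2, (Submodule.closed_of_finiteDimensional _).submodule_topologicalClosure_eq,
    Submodule.mem_bot] at h1
  have h3 := ContinuousMap.toLp_injective (p := 2) μ (𝕜 := ℂ) (h1.trans (map_zero _).symm)
  exact one_ne_zero (congrArg (fun f : C(X, ℂ) => f 1) h3)

theorem exists_character_pow_apply_ne_one (hy_add : ∀ s t : ℝ, y (s + t) = y s * y t)
    (herg : Ergodic (fun x : X => y 1 * x) μ) {χ : PontryaginDual G} (hχ : ∃ x, χ (ξ x) ≠ 1)
    {n : ℕ} (hn : n ≠ 0) : ∃ x, (χ ^ n) (ξ x) ≠ 1 := by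
  obtain ⟨x, hx⟩ := hχ
  refine ⟨y 1, fun h => hx ?_⟩
  rw [character_pow_apply] at h
  exact character_eq_one_of_apply_pow_eq_one hy_add herg (continuous_pullbackCharacter ξ χ) hn h x

theorem character_pow_injective (hy_add : ∀ s t : ℝ, y (s + t) = y s * y t)
    (herg : Ergodic (fun x : X => y 1 * x) μ) {χ : PontryaginDual G} (hχ : ∃ x, χ (ξ x) ≠ 1) :
    Function.Injective fun n : ℕ => χ ^ n := by
  refine injective_pow_iff_not_isOfFinOrder.2 fun h => ?_
  obtain ⟨n, hn, h1⟩ := isOfFinOrder_iff_pow_eq_one.1 h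
  obtain ⟨x, hx⟩ := exists_character_pow_apply_ne_one hy_add herg hχ hn.ne'
  exact hx (by rw [h1]; rfl)

end SkewProduct

theorem mainTheorem6
    {E : Type*} [NormedAddCommGroup E] [NormedSpace ℝ E] [FiniteDimensional ℝ E]
    {X : Type*} [MetricSpace X] [CompactSpace X] [CommGroup X] [IsTopologicalGroup X]
    [ChartedSpace E X] [LieGroup 𝓘(ℝ, E) ∞ X] [MeasurableSpace X] [BorelSpace X]
    (μ : Measure X) [μ.IsHaarMeasure] [IsProbabilityMeasure μ]
    {G : Type*} [MetricSpace G] [CompactSpace G] [CommGroup G] [IsTopologicalGroup G]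
    [MeasurableSpace G] [BorelSpace G]
    (ν : Measure G) [ν.IsHaarMeasure] [IsProbabilityMeasure ν]
    (y : ℝ → X) (hy : Continuous y) (hy_add : ∀ s t : ℝ, y (s + t) = y s * y t)
    (hy_erg : Ergodic (fun x : X => y 1 * x) μ)
    (φ : X → G) (hφ : Measurable φ)
    (ξ : X →ₜ* G) (η : X → G) (hφξη : ∀ x, φ x = ξ x * η x)
    (hη : ∀ χ : PontryaginDual G, (∃ x, χ (ξ x) ≠ 1) →
      IsFlowRegular μ y (fun x => (χ (η x) : ℂ))) :
    (∀ χ : PontryaginDual G, (∃ x, χ (ξ x) ≠ 1) →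
      HasLebesgueSpectrumOn (fiberKoopman μ (y 1) φ hφ χ) ⊤ ∧
      HasLebesgueSpectrumOn (skewKoopman μ ν (y 1) φ hφ) (fiberSubspace μ ν χ)) ∧
    ((∃ χ : PontryaginDual G, ∃ x, χ (ξ x) ≠ 1) →
      HasCountableLebesgueSpectrumOn (skewKoopman μ ν (y 1) φ hφ)
        (⨆ (χ : PontryaginDual G) (_ : ∃ x, χ (ξ x) ≠ 1),
          fiberSubspace μ ν χ).topologicalClosure) := by
  have : Fact ((2 : ℝ≥0∞) ≠ ⊤) := ⟨ENNReal.ofNat_ne_top⟩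
  have key := fun χ hχ => exists_intertwiners_of_isFlowRegular (ξ := ξ) hy hy_add hy_erg hφ hφξη
    (χ := χ) hχ (hη χ hχ)
  have hD := dense_toLp_isFlowLipschitz (μ := μ) hy hy_add
  set D := {v : Lp ℂ 2 μ | ∃ f : C(X, ℂ), IsFlowLipschitz y f ∧ ContinuousMap.toLp 2 μ ℂ f = v}
  have hDn : D.Nonempty := hD.nonempty
  have hι : ∀ χ : PontryaginDual G, Intertwines (fiberKoopman μ (y 1) φ hφ χ)
      (skewKoopman μ ν (y 1) φ hφ) (fiberEmbedding μ ν χ).toContinuousLinearMap :=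
    fun χ => fiberEmbedding_intertwines μ ν (y 1) φ hφ χ
  refine ⟨fun χ hχ => ?_, fun ⟨χ₀, hχ₀⟩ => ?_⟩
  · obtain ⟨⟨J, hJ, hJJ⟩, hT⟩ := key χ hχ
    obtain ⟨T, hTU, hTd⟩ := exists_seq_intertwiners (M := ⊤) (Y := D) (S := circleShift)
      (U := fiberKoopman μ (y 1) φ hφ χ) hDn
      (fun v _ => closure_mono Submodule.subset_span (hD v)) isClosed_univ (by
        rintro _ ⟨f, hf, rfl⟩
        obtain ⟨T, hTU, hTf⟩ := hT f hf
        exact ⟨T, hTU, fun _ => trivial, hTf⟩)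
    have htop := hasLebesgueSpectrumOn_top hTU hTd hJ hJJ
    refine ⟨htop, ?_⟩
    rw [fiberSubspace_eq_range]
    exact htop.map (hι χ) (fiberEmbedding μ ν χ).inner_map_map
  · have hle : ∀ χ : PontryaginDual G, (∃ x, χ (ξ x) ≠ 1) → ∀ v, fiberEmbedding μ ν χ v ∈
        ⨆ (χ : PontryaginDual G) (_ : ∃ x, χ (ξ x) ≠ 1), fiberSubspace μ ν χ := fun χ hχ v =>
      Submodule.mem_iSup_of_mem χ (Submodule.mem_iSup_of_mem hχ
        (by rw [fiberSubspace_eq_range]; exact ⟨v, rfl⟩))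
    set M := ⨆ (χ : PontryaginDual G) (_ : ∃ x, χ (ξ x) ≠ 1), fiberSubspace μ ν χ
    set Y := {Ψ | ∃ χ : PontryaginDual G, (∃ x, χ (ξ x) ≠ 1) ∧ ∃ v ∈ D, fiberEmbedding μ ν χ v = Ψ}
    have hYM : M.topologicalClosure ≤ (Submodule.span ℂ Y).topologicalClosure := by
      refine Submodule.topologicalClosure_minimal _ (iSup₂_le fun χ hχ => ?_)
        (Submodule.isClosed_topologicalClosure _)
      rw [fiberSubspace_eq_range]
      rintro _ ⟨v, rfl⟩
      refine closure_mono Submodule.subset_span ?_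
      refine map_mem_closure (fiberEmbedding μ ν χ).continuous (hD v) fun d hd => ?_
      exact ⟨χ, hχ, d, hd, rfl⟩
    obtain ⟨T, hTU, hTd⟩ := exists_seq_intertwiners (S := circleShift)
      (U := skewKoopman μ ν (y 1) φ hφ)
      (hDn.elim fun v hv => (⟨_, χ₀, hχ₀, v, hv, rfl⟩ : Y.Nonempty)) hYM
      (Submodule.isClosed_topologicalClosure _) (by
        rintro _ ⟨χ, hχ, _, ⟨f, hf, rfl⟩, rfl⟩
        obtain ⟨T, hTU, hTf⟩ := (key χ hχ).2 f hf
        refine ⟨_, (hι χ).comp hTU, fun x => M.le_topologicalClosure (hle χ hχ (T x)), ?_⟩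
        refine map_mem_closure (fiberEmbedding μ ν χ).continuous hTf ?_
        rintro _ ⟨x, rfl⟩
        exact ⟨x, rfl⟩)
    have hpow : ∀ k : ℕ, ∃ x, (χ₀ ^ (k + 1)) (ξ x) ≠ 1 := fun k =>
      exists_character_pow_apply_ne_one hy_add hy_erg hχ₀ k.succ_ne_zero
    choose J hJ hJJ using fun k => (key _ (hpow k)).1
    refine hasCountableLebesgueSpectrumOn_of_isometries fourierBasis circleShift_fourierBasis hTU
      hTd (fun k => (hι (χ₀ ^ (k + 1))).comp (hJ k))
      (fun k x => M.le_topologicalClosure (hle _ (hpow k) (J k x)))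
      (fun k x z => ((fiberEmbedding μ ν _).inner_map_map _ _).trans (hJJ k x z))
      fun i j hij x z => inner_fiberEmbedding_eq_zero μ ν (fun h => hij ?_) _ _
    exact Nat.succ_injective (character_pow_injective hy_add hy_erg hχ₀ h)
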